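/- Let $\delta>0$ and let $\mathcal X=\mathcal X_\delta$ be the set of $\chi\in C^\infty(\mathbb R)$ such that $\operatorname{supp}\chi\subset[0,\infty)$, $\operatorname{supp}\chi'\subset(0,\delta/2)$, $\chi'\ge 0$ and $\sqrt{\chi'}\in C^\infty(\mathbb R)$. Let $H$ be a self-adjoint operator on a complex Hilbert space $\mathcal H$ and let $W_1,W_2,\dots$ be bounded operators on $\mathcal H$ such that $\sum_j W_j^*W_j$ converges strongly to a bounded operator. Let $\Phi$ be a self-adjoint operator on $\mathcal H$ that is bounded from below. Assume that $(\Phi+c)^{-1}$ exists as a bounded operator and $(\Phi+c)^{-1}\mathcal D(H)\subset\mathcal D(H)$ for some $c\ge0$, and that for some integer $n\ge1$ and all $k=1,\dots,n+1$ $$M_k:=1+\|\mathrm{ad}_\Phi^k(H)\|^2+\Big\|\sum_{j}W_j^*W_j\Big\|+\sum_{j}\|\mathrm{ad}_\Phi^k(W_j)\|^2<\infty .$$ Here $\mathrm{ad}_\Phi(A)=[\Phi,A]$. A commutator with $\Phi$ is understood as a quadratic form (on $\mathcal D(\Phi)\cap\mathcal D(H)$ for $[\Phi,H]$ and on $\mathcal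 D(\Phi)$ for $[\Phi,A]$ with $A$ bounded), identified with the bounded operator representing it; its norm is $\infty$ if there is no such operator. Put $\mu_n:=\max_{2\le k\le n+1}M_k$. For $f:\mathbb R\to\mathbb R$ bounded and continuous, $v,t\in\mathbb R$ and $s>0$ write $f_{ts}:=f\big((\Phi-vt)/s\big)$, defined by functional calculus. For $A=\Phi$ or $A$ bounded and self-adjoint let $$G'(A):=\tfrac12\sum_{j}\big(W_j^*[A,W_j]+[W_j^*,A]W_j\big),$$ a strongly convergent series. 1. For every $\chi\in\mathcal X$ there are functions $\xi^2,\xi^3,\dots\in\mathcal X$ depending only on $\chi$ (and $\delta$), and, for each $n\ge1$, a constant $C>0$ depending only on $n$ and $\chi$ (and $\delta$), such that for all $\mathcal H,H,(W_j),\Phi$ as above and all $v,t\in\mathbb R$, $s>0$: the operator $\chi_{ts}$ maps $\mathcal D(H)$ into itself, $[H,\chi_{ts}]$ extends from $\mathcal D(H)$ to a bounded operator, $[H,\Phi]$ is represented by a bounded operator, and $$i[H,\chi_{ts}]=s^{-1}\sqrt{\chi'_{ts}}\;i[H,\Phi]\,\sqrt{\chi'_{ts}}+\mathrm{Rem}_H,\qquad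 \pm\mathrm{Rem}_H\le\sum_{k=2}^n\frac{M_k}{s^k}(\xi^k)'_{ts}+C\,\frac{M_{n+1}}{s^{n+1}} .$$ 2. For every $\chi\in\mathcal X$ there are functions $\xi^2,\xi^3,\dots\in\mathcal X$ depending only on $\chi$ (and $\delta$), and, for each $n\ge1$, a constant $C>0$ depending only on $n$ and $\chi$ (and $\delta$), such that for all $\mathcal H,H,(W_j),\Phi$ as above and all $v,t\in\mathbb R$, $s>0$: $G'(\chi_{ts})$ and $G'(\Phi)$ are well-defined bounded operators, and $$G'(\chi_{ts})=s^{-1}\sqrt{\chi'_{ts}}\;G'(\Phi)\,\sqrt{\chi'_{ts}}+\mathrm{Rem}_W,\qquad \pm\mathrm{Rem}_W\le\sum_{k=2}^n\frac{M_k}{s^k}(\xi^k)'_{ts}+C\,\frac{\mu_n}{s^{n+1}} .$$ The inequalities are between bounded self-adjoint operators, and the sums over $k$ are empty for $n=1$. -/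

import Mathlib

open Complex Filter Topology
open scoped InnerProductSpace ENNReal ContDiff

namespace LightCone

section Operators

variable {𝓗 : Type*} [NormedAddCommGroup 𝓗] [InnerProductSpace ℂ 𝓗] [CompleteSpace 𝓗]

/-! ### Functional calculus of an unbounded self-adjoint operator -/

/-- The map `u ↦ Φ u + i u` on the domain of `Φ`. -/
noncomputable def addI (Φ : 𝓗 →ₗ.[ℂ] 𝓗) : Φ.domain →ₗ[ℂ] 𝓗 :=
  Φ.toFun + I • Φ.domain.subtype

/-- The resolvent `(Φ + i)⁻¹`: the bounded operator determined by `(Φ + i) u ↦ u` on the range of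
`Φ + i`, which is all of `𝓗` when `Φ` is self-adjoint (see `resolventI_spec`). -/
noncomputable def resolventI (Φ : 𝓗 →ₗ.[ℂ] 𝓗) : 𝓗 →L[ℂ] 𝓗 :=
  Φ.domain.subtype.extendOfNorm (addI Φ)

/-- For `r = 1 / (lam + i)` with `lam` real, this is `f lam / (lam + i)`; it is `0` at `r = 0`
(the point `lam = ∞`). -/
noncomputable def regularized (f : ℝ → ℝ) (r : ℂ) : ℂ := (f (r⁻¹ - I).re : ℂ) * r

/-- The operator `f(Φ) (Φ + i)⁻¹`, given by the continuous functional calculus of the bounded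
normal operator `(Φ + i)⁻¹`. -/
noncomputable def regularizedCalc (Φ : 𝓗 →ₗ.[ℂ] 𝓗) (f : ℝ → ℝ) : 𝓗 →L[ℂ] 𝓗 :=
  cfc (regularized f) (resolventI Φ)

/-- `f(Φ)` for `Φ` self-adjoint and `f` bounded and continuous: the bounded operator determined on
the dense subspace `D(Φ) = Ran (Φ + i)⁻¹` by `(Φ + i)⁻¹ x ↦ f(Φ) (Φ + i)⁻¹ x`
(see `fnCalc_resolventI`). -/
noncomputable def fnCalc (Φ : 𝓗 →ₗ.[ℂ] 𝓗) (f : ℝ → ℝ) : 𝓗 →L[ℂ] 𝓗 :=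
  (regularizedCalc Φ f).toLinearMap.extendOfNorm (resolventI Φ).toLinearMap

/-- `f_ts = f ((Φ - v t) / s)`. -/
noncomputable def fts (Φ : 𝓗 →ₗ.[ℂ] 𝓗) (f : ℝ → ℝ) (v t s : ℝ) : 𝓗 →L[ℂ] 𝓗 :=
  fnCalc Φ fun lam => f ((lam - v * t) / s)

theorem inner_symm {Φ : 𝓗 →ₗ.[ℂ] 𝓗} (hΦ : IsSelfAdjoint Φ) (u v : Φ.domain) :
    ⟪Φ u, (v : 𝓗)⟫_ℂ = ⟪(u : 𝓗), Φ v⟫_ℂ := by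
  have h := LinearPMap.adjoint_isFormalAdjoint hΦ.dense_domain
  rw [LinearPMap.isSelfAdjoint_def.mp hΦ] at h
  exact h u v

theorem norm_addI_sq {Φ : 𝓗 →ₗ.[ℂ] 𝓗} (hΦ : IsSelfAdjoint Φ) (u : Φ.domain) :
    ‖addI Φ u‖ ^ 2 = ‖Φ u‖ ^ 2 + ‖(u : 𝓗)‖ ^ 2 := by
  have h1 : addI Φ u = Φ u + I • (u : 𝓗) := rfl
  have h2 : (⟪Φ u, (u : 𝓗)⟫_ℂ).im = 0 := by
    have h3 : (starRingEnd ℂ) ⟪Φ u, (u : 𝓗)⟫_ℂ = ⟪Φ u, (u : 𝓗)⟫_ℂ := by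
      rw [inner_conj_symm, inner_symm hΦ]
    exact Complex.conj_eq_iff_im.mp h3
  rw [h1, @norm_add_sq ℂ, inner_smul_right, norm_smul]
  simp [h2]

theorem norm_le_addI {Φ : 𝓗 →ₗ.[ℂ] 𝓗} (hΦ : IsSelfAdjoint Φ) (u : Φ.domain) :
    ‖(u : 𝓗)‖ ≤ ‖addI Φ u‖ := by
  have := norm_addI_sq hΦ u
  exact le_of_sq_le_sq (by nlinarith [sq_nonneg ‖Φ u‖]) (norm_nonneg _)

theorem exists_of_adjoint {Φ : 𝓗 →ₗ.[ℂ] 𝓗} (hΦ : IsSelfAdjoint Φ) {w z : 𝓗}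
    (h : ∀ u : Φ.domain, ⟪z, (u : 𝓗)⟫_ℂ = ⟪w, Φ u⟫_ℂ) :
    ∃ u : Φ.domain, (u : 𝓗) = w ∧ Φ u = z := by
  have h4 : w ∈ Φ.adjoint.domain := LinearPMap.mem_adjoint_domain_of_exists w ⟨_, h⟩
  have h5 := LinearPMap.adjoint_apply_eq hΦ.dense_domain ⟨w, h4⟩ h
  have key : ∀ Ψ : 𝓗 →ₗ.[ℂ] 𝓗, Ψ = Φ → ∀ h : w ∈ Ψ.domain, Ψ ⟨w, h⟩ = z →
      ∃ u : Φ.domain, (u : 𝓗) = w ∧ Φ u = z := by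
    rintro Ψ rfl h h'
    exact ⟨⟨w, h⟩, rfl, h'⟩
  exact key _ (LinearPMap.isSelfAdjoint_def.mp hΦ) h4 h5

theorem denseRange_addI {Φ : 𝓗 →ₗ.[ℂ] 𝓗} (hΦ : IsSelfAdjoint Φ) : DenseRange (addI Φ) := by
  have : Dense ((LinearMap.range (addI Φ) : Submodule ℂ 𝓗) : Set 𝓗) := by
    rw [Submodule.dense_iff_topologicalClosure_eq_top,
      Submodule.topologicalClosure_eq_top_iff, Submodule.eq_bot_iff]
    intro w hw
    have h1 : ∀ u : Φ.domain, ⟪I • w, (u : 𝓗)⟫_ℂ = ⟪w, Φ u⟫_ℂ := by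
      intro u
      have h2 := (Submodule.mem_orthogonal' _ _).mp hw (addI Φ u) ⟨u, rfl⟩
      have h3 : addI Φ u = Φ u + I • (u : 𝓗) := rfl
      rw [h3, inner_add_right, inner_smul_right] at h2
      rw [inner_smul_left]
      simp only [conj_I]
      linear_combination -h2
    obtain ⟨u, hu, hu'⟩ := exists_of_adjoint hΦ h1
    have h6 := inner_symm hΦ u u
    rw [hu', hu, inner_smul_left, inner_smul_right] at h6
    have h7 : ⟪w, w⟫_ℂ = 0 := by
      simp only [conj_I] at h6
      have : I * ⟪w, w⟫_ℂ = 0 := by linear_combination (-1 / 2 : ℂ) * h6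
      simpa using this
    exact inner_self_eq_zero.mp h7
  exact this

theorem resolventI_addI {Φ : 𝓗 →ₗ.[ℂ] 𝓗} (hΦ : IsSelfAdjoint Φ) (u : Φ.domain) :
    resolventI Φ (addI Φ u) = u :=
  LinearMap.extendOfNorm_eq (denseRange_addI hΦ)
    ⟨1, fun x => by simpa using norm_le_addI hΦ x⟩ u

theorem surjective_addI {Φ : 𝓗 →ₗ.[ℂ] 𝓗} (hΦ : IsSelfAdjoint Φ) :
    Function.Surjective (addI Φ) := by
  intro x
  obtain ⟨a, ha, hax⟩ := mem_closure_iff_seq_limit.mp (denseRange_addI hΦ x)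
  choose u hu using ha
  have h1 : Tendsto (fun n => (u n : 𝓗)) atTop (𝓝 (resolventI Φ x)) := by
    have := ((resolventI Φ).continuous.tendsto x).comp hax
    refine this.congr fun n => ?_
    simp [← hu n, resolventI_addI hΦ]
  have h2 : Tendsto (fun n => Φ (u n)) atTop (𝓝 (x - I • resolventI Φ x)) := by
    refine (hax.sub (h1.const_smul I)).congr fun n => ?_
    rw [← hu n]
    exact add_sub_cancel_right (Φ (u n)) (I • (u n : 𝓗))
  have h3 : (resolventI Φ x, x - I • resolventI Φ x) ∈ Φ.graph :=
    hΦ.isClosed.mem_of_tendsto (h1.prodMk_nhds h2) (Eventually.of_forall fun n => Φ.mem_graph _)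
  obtain ⟨y, hy1, hy2⟩ := (LinearPMap.mem_graph_iff Φ).mp h3
  refine ⟨y, ?_⟩
  have h4 : addI Φ y = Φ y + I • (y : 𝓗) := rfl
  rw [h4, hy2, hy1]
  simp

/-- For self-adjoint `Φ`, `resolventI Φ` is the two-sided inverse of `Φ + i`. -/
theorem resolventI_spec {Φ : 𝓗 →ₗ.[ℂ] 𝓗} (hΦ : IsSelfAdjoint Φ) :
    (∀ u : Φ.domain, resolventI Φ (Φ u + I • (u : 𝓗)) = u) ∧
      ∀ x : 𝓗, ∃ u : Φ.domain, (u : 𝓗) = resolventI Φ x ∧ Φ u + I • (u : 𝓗) = x := by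
  refine ⟨resolventI_addI hΦ, fun x => ?_⟩
  obtain ⟨u, rfl⟩ := surjective_addI hΦ x
  exact ⟨u, (resolventI_addI hΦ u).symm, rfl⟩

theorem isStarNormal_resolventI {Φ : 𝓗 →ₗ.[ℂ] 𝓗} (hΦ : IsSelfAdjoint Φ) :
    IsStarNormal (resolventI Φ) := by
  obtain ⟨hl, hr⟩ := resolventI_spec hΦ
  set R := resolventI Φ
  have hadj : ∀ u : Φ.domain, R.adjoint (Φ u - I • (u : 𝓗)) = u := by
    intro u
    refine ext_inner_right ℂ fun y => ?_
    obtain ⟨v, hv, rfl⟩ := hr y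
    rw [ContinuousLinearMap.adjoint_inner_left, ← hv, inner_sub_left, inner_add_right,
      inner_smul_left, inner_smul_right, inner_symm hΦ]
    simp only [conj_I]
    ring
  have h1 : ∀ x, R x = R.adjoint x - (2 * I) • R.adjoint (R x) := by
    intro x
    obtain ⟨u, hu, hx⟩ := hr x
    have := hadj u
    rw [← hu, ← map_smul, ← map_sub]
    conv_lhs => rw [← this]
    congr 1
    rw [← hx]
    module
  have h2 : ∀ x, R.adjoint x = R x + (2 * I) • R (R.adjoint x) := by
    intro x
    obtain ⟨w, hw, hx⟩ := exists_of_adjoint hΦ (w := R.adjoint x) (z := x + I • R.adjoint x) (by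
      intro v
      have h3 : ⟪R.adjoint x, Φ v + I • (v : 𝓗)⟫_ℂ = ⟪x, (v : 𝓗)⟫_ℂ := by
        rw [ContinuousLinearMap.adjoint_inner_left, hl]
      rw [inner_add_right, inner_smul_right] at h3
      rw [inner_add_left, inner_smul_left]
      simp only [conj_I]
      linear_combination -h3)
    have := hl w
    rw [← map_smul, ← map_add]
    conv_lhs => rw [← hw, ← this]
    congr 1
    rw [hx, hw]
    module
  refine ⟨?_⟩
  ext x
  have h3 : (2 * I) • R.adjoint (R x) = (2 * I) • R (R.adjoint x) := by
    have e1 := h1 x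
    have e2 := h2 x
    rw [eq_sub_iff_add_eq] at e1
    exact add_left_cancel (e1.trans e2)
  exact smul_right_injective 𝓗 (by simp : (2 * I) ≠ 0) h3

theorem continuous_regularized {f : ℝ → ℝ} (hf : Continuous f) {M : ℝ} (hM : ∀ x, |f x| ≤ M) :
    Continuous (regularized f) := by
  rw [continuous_iff_continuousAt]
  intro r
  by_cases hr : r = 0
  · subst hr
    have h0 : regularized f 0 = 0 := by simp [regularized]
    rw [ContinuousAt, h0]
    refine squeeze_zero_norm (a := fun r : ℂ => M * ‖r‖) (fun r => ?_) ?_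
    · rw [regularized, norm_mul, Complex.norm_real, Real.norm_eq_abs]
      exact mul_le_mul_of_nonneg_right (hM _) (norm_nonneg _)
    · have : Continuous fun r : ℂ => M * ‖r‖ := by fun_prop
      simpa using this.tendsto 0
  · have h1 : ContinuousAt (fun r : ℂ => (r⁻¹ - I).re) r :=
      Complex.continuous_re.continuousAt.comp ((continuousAt_inv₀ hr).sub continuousAt_const)
    exact (Complex.continuous_ofReal.continuousAt.comp (hf.continuousAt.comp h1)).mul
      continuousAt_id

open scoped ComplexOrder in
theorem norm_regularizedCalc_le {Φ : 𝓗 →ₗ.[ℂ] 𝓗} (hΦ : IsSelfAdjoint Φ) {f : ℝ → ℝ}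
    (hf : Continuous f) {M : ℝ} (hM : ∀ x, |f x| ≤ M) (x : 𝓗) :
    ‖regularizedCalc Φ f x‖ ≤ M * ‖resolventI Φ x‖ := by
  have hM0 : 0 ≤ M := (abs_nonneg _).trans (hM 0)
  have hN := isStarNormal_resolventI hΦ
  set R := resolventI Φ with hR
  have hc := continuous_regularized hf hM
  have e1 : star (regularizedCalc Φ f) * regularizedCalc Φ f
      = cfc (fun r => star (regularized f r) * regularized f r) R := by
    rw [regularizedCalc, ← cfc_star, ← cfc_mul _ _ R (by fun_prop) (by fun_prop)]
  have e2 : ((M : ℂ) ^ 2) • (star R * R) = cfc (fun r : ℂ => (M : ℂ) ^ 2 * (star r * r)) R := by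
    rw [cfc_const_mul _ _ R (by fun_prop), cfc_mul _ _ R (by fun_prop) (by fun_prop), cfc_star,
      cfc_id' ℂ R]
  have e3 : star (regularizedCalc Φ f) * regularizedCalc Φ f ≤ ((M : ℂ) ^ 2) • (star R * R) := by
    rw [e1, e2]
    refine cfc_mono (fun r _ => ?_) (by fun_prop) (by fun_prop)
    have h1 : star (regularized f r) * regularized f r
        = ((f (r⁻¹ - I).re ^ 2 * ‖r‖ ^ 2 : ℝ) : ℂ) := by
      have := Complex.conj_mul' (regularized f r)
      rw [RCLike.star_def, this, regularized, norm_mul, Complex.norm_real, Real.norm_eq_abs]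
      push_cast
      rw [mul_pow]
      norm_cast
      rw [sq_abs]
    have h2 : (M : ℂ) ^ 2 * (star r * r) = ((M ^ 2 * ‖r‖ ^ 2 : ℝ) : ℂ) := by
      rw [RCLike.star_def, Complex.conj_mul']
      push_cast
      ring
    rw [h1, h2, Complex.real_le_real]
    refine mul_le_mul_of_nonneg_right ?_ (by positivity)
    exact sq_le_sq.mpr (by rw [abs_of_nonneg hM0]; exact hM _)
  have e4 := (ContinuousLinearMap.le_def _ _ |>.mp e3).re_inner_nonneg_right x
  have e5 : ‖regularizedCalc Φ f x‖ ^ 2 ≤ M ^ 2 * ‖R x‖ ^ 2 := by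
    simp only [sub_apply, smul_apply,
      ContinuousLinearMap.mul_def, ContinuousLinearMap.comp_apply, ContinuousLinearMap.star_eq_adjoint, inner_sub_right,
      inner_smul_right, ContinuousLinearMap.adjoint_inner_right, inner_self_eq_norm_sq_to_K] at e4
    have e6 : (M : ℂ) ^ 2 * (‖R x‖ : ℂ) ^ 2 - (‖regularizedCalc Φ f x‖ : ℂ) ^ 2
        = ((M ^ 2 * ‖R x‖ ^ 2 - ‖regularizedCalc Φ f x‖ ^ 2 : ℝ) : ℂ) := by
      push_cast
      rfl
    have e7 := e4.trans_eq ((congrArg Complex.re e6).trans (Complex.ofReal_re _))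
    linarith
  exact le_of_sq_le_sq (by rw [mul_pow]; exact e5) (by positivity)

/-- The defining property of `f(Φ)`. -/
theorem fnCalc_resolventI {Φ : 𝓗 →ₗ.[ℂ] 𝓗} (hΦ : IsSelfAdjoint Φ) {f : ℝ → ℝ}
    (hf : Continuous f) {M : ℝ} (hM : ∀ x, |f x| ≤ M) (x : 𝓗) :
    fnCalc Φ f (resolventI Φ x) = regularizedCalc Φ f x := by
  refine LinearMap.extendOfNorm_eq (e := (resolventI Φ).toLinearMap) ?_
    ⟨M, fun y => norm_regularizedCalc_le hΦ hf hM y⟩ x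
  refine hΦ.dense_domain.mono ?_
  intro u hu
  exact ⟨_, (resolventI_spec hΦ).1 ⟨u, hu⟩⟩

/-! ### Commutators with bounded extensions -/

/-- The commutator `[A, B]` of two (unbounded) self-adjoint operators, as a quadratic form on
`D(A) ∩ D(B)`, is given by the bounded operator `C`. -/
def IsCommutator (A B : 𝓗 →ₗ.[ℂ] 𝓗) (C : 𝓗 →L[ℂ] 𝓗) : Prop :=
  ∀ (u v : 𝓗) (uA : u ∈ A.domain) (uB : u ∈ B.domain) (vA : v ∈ A.domain) (vB : v ∈ B.domain),
    ⟪A ⟨u, uA⟩, B ⟨v, vB⟩⟫_ℂ - ⟪B ⟨u, uB⟩, A ⟨v, vA⟩⟫_ℂ = ⟪u, C v⟫_ℂ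

/-- The commutator `[Φ, A]` of a self-adjoint operator `Φ` and a bounded operator `A`, as a
quadratic form on `D(Φ)`, is given by the bounded operator `C`. -/
def IsBddCommutator (Φ : 𝓗 →ₗ.[ℂ] 𝓗) (A C : 𝓗 →L[ℂ] 𝓗) : Prop :=
  ∀ u v : Φ.domain, ⟪Φ u, A v⟫_ℂ - ⟪(u : 𝓗), A (Φ v)⟫_ℂ = ⟪(u : 𝓗), C v⟫_ℂ

/-- `C` is the bounded operator `ad_Φ^k(A)`, for `A` bounded, where `ad_Φ(A) = [Φ, A]`. -/
def IsAd (Φ : 𝓗 →ₗ.[ℂ] 𝓗) (A : 𝓗 →L[ℂ] 𝓗) : ℕ → (𝓗 →L[ℂ] 𝓗) → Prop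
  | 0, C => C = A
  | k + 1, C => ∃ B, IsAd Φ A k B ∧ IsBddCommutator Φ B C

/-- `C` is the bounded operator `ad_Φ^k(H)`, for `H` self-adjoint and `k ≥ 1`. -/
def IsAdUnbdd (Φ H : 𝓗 →ₗ.[ℂ] 𝓗) : ℕ → (𝓗 →L[ℂ] 𝓗) → Prop
  | 0, _ => False
  | 1, C => IsCommutator Φ H C
  | k + 2, C => ∃ B, IsAdUnbdd Φ H (k + 1) B ∧ IsBddCommutator Φ B C

/-- The norm of the bounded operator specified by `P`, and `∞` if there is no such operator. -/
noncomputable def extNorm (P : (𝓗 →L[ℂ] 𝓗) → Prop) : ℝ≥0∞ :=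
  ⨅ (C : 𝓗 →L[ℂ] 𝓗) (_ : P C), ‖C‖ₑ

/-- The series `∑_j T_j` converges strongly to `S`. -/
def StrongSum (T : ℕ → 𝓗 →L[ℂ] 𝓗) (S : 𝓗 →L[ℂ] 𝓗) : Prop :=
  ∀ u : 𝓗, Tendsto (fun N => ∑ j ∈ Finset.range N, T j u) atTop (𝓝 (S u))

/-- `M_k = 1 + ‖ad_Φ^k(H)‖² + ‖S‖ + ∑_j ‖ad_Φ^k(W_j)‖²`, where `S = ∑_j W_j^* W_j`. -/
noncomputable def M (H Φ : 𝓗 →ₗ.[ℂ] 𝓗) (W : ℕ → 𝓗 →L[ℂ] 𝓗) (S : 𝓗 →L[ℂ] 𝓗) (k : ℕ) : ℝ≥0∞ :=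
  1 + extNorm (IsAdUnbdd Φ H k) ^ 2 + ‖S‖ₑ + ∑' j, extNorm (IsAd Φ (W j) k) ^ 2

/-- `μ_n`, the maximum of `M_k` over `2 ≤ k ≤ n + 1`. -/
noncomputable def mu (H Φ : 𝓗 →ₗ.[ℂ] 𝓗) (W : ℕ → 𝓗 →L[ℂ] 𝓗) (S : 𝓗 →L[ℂ] 𝓗) (n : ℕ) : ℝ≥0∞ :=
  (Finset.Icc 2 (n + 1)).sup (M H Φ W S)

/-- The standing assumptions: `H` and `Φ` are self-adjoint, `Φ` is bounded from below,
`∑_j W_j^* W_j = S` strongly, `(Φ + c)⁻¹` exists and preserves `D(H)` for some `c ≥ 0`, and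
`M_k < ∞` for `1 ≤ k ≤ n + 1`. -/
structure Assumptions (n : ℕ) (H Φ : 𝓗 →ₗ.[ℂ] 𝓗) (W : ℕ → 𝓗 →L[ℂ] 𝓗) (S : 𝓗 →L[ℂ] 𝓗) :
    Prop where
  selfAdjoint_H : IsSelfAdjoint H
  selfAdjoint_Φ : IsSelfAdjoint Φ
  bddBelow_Φ : ∃ m : ℝ, ∀ u : Φ.domain, m * ‖(u : 𝓗)‖ ^ 2 ≤ (⟪Φ u, (u : 𝓗)⟫_ℂ).re
  strongSum_W : StrongSum (fun j => (W j).adjoint ∘L W j) S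
  preserves_domain : ∃ c : ℝ, 0 ≤ c ∧
    Function.Bijective (fun u : Φ.domain => Φ u + (c : ℂ) • (u : 𝓗)) ∧
    ∀ u : Φ.domain, Φ u + (c : ℂ) • (u : 𝓗) ∈ H.domain → (u : 𝓗) ∈ H.domain
  finite_M : ∀ k, 1 ≤ k → k ≤ n + 1 → M H Φ W S k < ⊤

/-! ### The two parts of the dual Lindblad generator -/

/-- `A` preserves `D(H)`, and `[H, A]`, defined on `D(H)`, extends to the bounded operator `K`. -/
def IsDomainCommutator (H : 𝓗 →ₗ.[ℂ] 𝓗) (A K : 𝓗 →L[ℂ] 𝓗) : Prop :=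
  ∀ u : H.domain, ∃ h : A u ∈ H.domain, K u = H ⟨A u, h⟩ - A (H u)

/-- `G = G'(A) = 1/2 ∑_j (W_j^* [A, W_j] + [W_j^*, A] W_j)` for `A` bounded. -/
def IsGPrime (W : ℕ → 𝓗 →L[ℂ] 𝓗) (A G : 𝓗 →L[ℂ] 𝓗) : Prop :=
  StrongSum (fun j => (1 / 2 : ℂ) •
    ((W j).adjoint ∘L (A ∘L W j - W j ∘L A)
      + ((W j).adjoint ∘L A - A ∘L (W j).adjoint) ∘L W j)) G

/-- `G = G'(Φ) = 1/2 ∑_j (W_j^* [Φ, W_j] + [W_j^*, Φ] W_j)` for `Φ` self-adjoint, where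
`D_j = [Φ, W_j]` and `-D'_j = [W_j^*, Φ]` are bounded. -/
def IsGPrimeUnbdd (W : ℕ → 𝓗 →L[ℂ] 𝓗) (Φ : 𝓗 →ₗ.[ℂ] 𝓗) (G : 𝓗 →L[ℂ] 𝓗) : Prop :=
  ∃ D D' : ℕ → 𝓗 →L[ℂ] 𝓗,
    (∀ j, IsBddCommutator Φ (W j) (D j)) ∧ (∀ j, IsBddCommutator Φ (W j).adjoint (D' j)) ∧
    StrongSum (fun j => (1 / 2 : ℂ) • ((W j).adjoint ∘L D j + (-D' j) ∘L W j)) G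

/-- `√χ'_ts`. -/
noncomputable def sqrtDeriv (Φ : 𝓗 →ₗ.[ℂ] 𝓗) (χ : ℝ → ℝ) (v t s : ℝ) : 𝓗 →L[ℂ] 𝓗 :=
  fts Φ (fun lam => √(deriv χ lam)) v t s

/-- `A - s⁻¹ √χ'_ts B √χ'_ts`. -/
noncomputable def remainder (Φ : 𝓗 →ₗ.[ℂ] 𝓗) (χ : ℝ → ℝ) (v t s : ℝ) (A B : 𝓗 →L[ℂ] 𝓗) :
    𝓗 →L[ℂ] 𝓗 :=
  A - ((s⁻¹ : ℝ) : ℂ) • (sqrtDeriv Φ χ v t s ∘L B ∘L sqrtDeriv Φ χ v t s)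

/-- `∑_{k=2}^n M_k s^{-k} (ξ^k)'_ts + b s^{-(n+1)}`. -/
noncomputable def errorBound (n : ℕ) (H Φ : 𝓗 →ₗ.[ℂ] 𝓗) (W : ℕ → 𝓗 →L[ℂ] 𝓗) (S : 𝓗 →L[ℂ] 𝓗)
    (ξ : ℕ → ℝ → ℝ) (b v t s : ℝ) : 𝓗 →L[ℂ] 𝓗 :=
  ∑ k ∈ Finset.Icc 2 n, (((M H Φ W S k).toReal / s ^ k : ℝ) : ℂ) • fts Φ (deriv (ξ k)) v t s
    + ((b / s ^ (n + 1) : ℝ) : ℂ) • ContinuousLinearMap.id ℂ 𝓗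

end Operators

/-- The class of cutoff functions `𝒳_δ`. -/
def cutoffs (δ : ℝ) : Set (ℝ → ℝ) :=
  {χ | ContDiff ℝ ∞ χ ∧ tsupport χ ⊆ Set.Ici 0 ∧ tsupport (deriv χ) ⊆ Set.Ioo 0 (δ / 2) ∧
    (∀ x, 0 ≤ deriv χ x) ∧ ContDiff ℝ ∞ fun x => √(deriv χ x)}

end LightCone

universe u

/-!
The commutator expansion is proved for a bounded self-adjoint operator `A` in place of
`(Φ - v t) / s`, with constants which do not depend on the norm of `A`, and is then carried over to
`Φ` by a strong limit.

*Bounded operators.* For a test function `f`, write `f(A) = ∫ f̂(τ) e^{2πiτA} dτ` (`cfc_eq_integral`).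
Taylor's formula for `e^{2πiτA₂} B e^{-2πiτA}` (`IsIncrement.norm_sub_taylor_le`) expands
`B f(A) - f(A₂) B` in the multiple commutators of `B`, with coefficients `f^{(k)}(A₂)` on the left and
a remainder controlled by the highest commutator and a moment of `f̂` (`norm_incr_sub_le`). A cutoff
`χ` is not compactly supported, but near the spectrum of `A` it equals a test function whose moments
are controlled by those of `χ'` (`exists_test_eq_cutoff`).

*Symmetric form.* With `u = √χ'`, the expansions of the commutators with `χ(A)` and `u(A)` combine to
one around `u(A) C u(A)`, where `C` is the first commutator (`CutoffData.norm_incr_add_le`). Its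
coefficients are supported where a plateau function `g` of `χ'` equals `1`. A second expansion, all of
whose terms vanish because the derivatives of `g` do, permits the insertion of `g(A)` on the right as
well (`norm_sub_comp_plateau_le`). The term of order `k` is therefore bounded in form by a multiple
of `g(A)²`, so that a multiple of the primitive of `g²` serves as `ξ^k` (`sqPrimitive`).

*The Hamiltonian.* The increment `e^{2πiτA} H e^{-2πiτA} - H` is a bounded operator although `H` is
not: the graph of `H` is invariant under the exponential of a triangular matrix of bounded operators
(`IsDomainCommutator.exists_increment`). The expansion only refers to this increment.

*The jump operators.* The operators `W_1, …, W_N` are combined into one column with values in a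
Hilbert sum, which turns sums over `j` into single norms. Moving `u(A)` through `W` produces products
of two intermediate commutators. These are controlled by `‖W‖` and the highest commutator, by a
Landau–Kolmogorov inequality for commutators (`norm_iterate_ad_le_of_lt`); this is the reason why
`‖∑ W_j^* W_j‖` is part of `M_k` (`CutoffData.norm_inner_commutator_sub_le`).

*The limit.* For `Φ ≥ m` and `J = (Φ - m + κ)⁻¹`, the Yosida approximant `κ + m - κ² J` of `Φ` is
bounded, and its commutators are those of `Φ` between two factors `T = κ J`. Since `T` is a
contraction commuting with `J`, multiple commutators have the form `T^k ad_Φ^k(B) T^k`, and their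
norms do not increase (`IsRegularization.iterate_ad`). As `κ → ∞`, `T → 1` and the functional calculus
of the approximants converges strongly to that of `Φ` (`exists_isApproximation`), and so do both sides
of the estimates (`IsApproximation.exists_commutator_estimate`,
`IsApproximation.norm_sum_inner_commutator_sub_le`).
-/

namespace LightCone

open scoped FourierTransform
open MeasureTheory

/-! ### Fourier transforms of test functions -/

/-- Smooth functions with compact support on the real line. -/
def IsTest (f : ℝ → ℝ) : Prop := ContDiff ℝ ∞ f ∧ HasCompactSupport f

/-- The Fourier transform `τ ↦ ∫ f(x) e^{-2πiτx} dx` of a real function. -/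
noncomputable def ft (f : ℝ → ℝ) (τ : ℝ) : ℂ := 𝓕 (fun x => (f x : ℂ)) τ

/-- The frequency `2πiτ`. -/
noncomputable def freq (τ : ℝ) : ℂ := 2 * Real.pi * I * τ

/-- The moment `∫ |2πτ|^m |f̂(τ)| dτ`. -/
noncomputable def ftMoment (m : ℕ) (f : ℝ → ℝ) : ℝ := ∫ τ, ‖freq τ‖ ^ m * ‖ft f τ‖

theorem continuous_freq : Continuous freq := by
  unfold freq; fun_prop

theorem norm_freq (τ : ℝ) : ‖freq τ‖ = 2 * Real.pi * |τ| := by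
  simp [freq, abs_of_pos Real.pi_pos]

theorem freq_neg (τ : ℝ) : freq (-τ) = -freq τ := by simp [freq]

/-- A test function as a complex-valued Schwartz function. -/
noncomputable def IsTest.toSchwartz {f : ℝ → ℝ} (hf : IsTest f) : SchwartzMap ℝ ℂ :=
  HasCompactSupport.toSchwartzMap (f := fun x => (f x : ℂ))
    (hf.2.comp_left (g := Complex.ofReal) rfl) (Complex.ofRealCLM.contDiff.comp hf.1)

theorem IsTest.fourier_toSchwartz {f : ℝ → ℝ} (hf : IsTest f) (τ : ℝ) :
    (𝓕 hf.toSchwartz) τ = ft f τ := rfl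

theorem IsTest.continuous_ft {f : ℝ → ℝ} (hf : IsTest f) : Continuous (ft f) :=
  (𝓕 hf.toSchwartz).continuous

theorem IsTest.integrable_moment {f : ℝ → ℝ} (hf : IsTest f) (m : ℕ) :
    Integrable fun τ => ‖freq τ‖ ^ m * ‖ft f τ‖ := by
  have := ((𝓕 hf.toSchwartz).integrable_pow_mul volume m).const_mul ((2 * Real.pi) ^ m)
  refine this.congr (Eventually.of_forall fun τ => ?_)
  simp only [hf.fourier_toSchwartz, norm_freq, mul_pow, Real.norm_eq_abs]
  ring

theorem ftMoment_nonneg (m : ℕ) (f : ℝ → ℝ) : 0 ≤ ftMoment m f :=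
  integral_nonneg fun _ => by positivity

theorem IsTest.deriv {f : ℝ → ℝ} (hf : IsTest f) : IsTest (deriv f) :=
  ⟨((contDiff_infty_iff_deriv).mp hf.1).2, hf.2.deriv⟩

theorem IsTest.iteratedDeriv {f : ℝ → ℝ} (hf : IsTest f) (k : ℕ) : IsTest (iteratedDeriv k f) := by
  induction k with
  | zero => simpa using hf
  | succ k ih => rw [iteratedDeriv_succ]; exact ih.deriv

theorem IsTest.integrable {f : ℝ → ℝ} (hf : IsTest f) : Integrable f :=
  hf.1.continuous.integrable_of_hasCompactSupport hf.2

theorem IsTest.ft_deriv {f : ℝ → ℝ} (hf : IsTest f) (τ : ℝ) :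
    ft (_root_.deriv f) τ = freq τ * ft f τ := by
  have hd : ∀ x, HasDerivAt (fun x => (f x : ℂ)) ((_root_.deriv f x : ℝ) : ℂ) x := fun x =>
    ((hf.1.differentiable (by simp)) x).hasDerivAt.ofReal_comp
  have hd' : _root_.deriv (fun x => (f x : ℂ)) = fun x => ((_root_.deriv f x : ℝ) : ℂ) :=
    funext fun x => (hd x).deriv
  have := Real.fourier_deriv (f := fun x => (f x : ℂ)) hf.integrable.ofReal
    (fun x => (hd x).differentiableAt) (by rw [hd']; exact hf.deriv.integrable.ofReal)
  rw [hd'] at this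
  exact (congrFun this τ).trans (by simp [ft, freq])

theorem IsTest.ft_iteratedDeriv {f : ℝ → ℝ} (hf : IsTest f) (k : ℕ) (τ : ℝ) :
    ft (_root_.iteratedDeriv k f) τ = freq τ ^ k * ft f τ := by
  induction k with
  | zero => simp
  | succ k ih => rw [iteratedDeriv_succ, (hf.iteratedDeriv k).ft_deriv, ih]; ring

theorem IsTest.inversion {f : ℝ → ℝ} (hf : IsTest f) (x : ℝ) :
    ∫ τ, ft f τ * exp (freq τ * x) = f x := by
  have h := FourierTransform.fourierInv_fourier_eq (F := SchwartzMap ℝ ℂ) hf.toSchwartz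
  have h2 : 𝓕⁻ (𝓕 hf.toSchwartz) x = f x := by rw [h]; rfl
  rw [SchwartzMap.fourierInv_coe, Real.fourierInv_eq'] at h2
  rw [← h2]
  refine integral_congr_ae (Eventually.of_forall fun τ => ?_)
  simp only [smul_eq_mul, hf.fourier_toSchwartz, freq]
  rw [mul_comm]
  congr 2
  simp
  ring

theorem ft_comp_sub (f : ℝ → ℝ) (L τ : ℝ) : ‖ft (fun x => f (x - L)) τ‖ = ‖ft f τ‖ := by
  have := congrFun (VectorFourier.fourierIntegral_comp_add_right Real.fourierChar volume
    (innerₗ ℝ) (fun x : ℝ => (f x : ℂ)) (-L)) τ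
  have h2 : ft (fun x => f (x - L)) τ = _ := this
  rw [h2, Circle.smul_def, norm_smul, Circle.norm_coe, one_mul]
  rfl

theorem integrable_ft_sub {f g : ℝ → ℝ} (hf : Integrable f) (hg : Integrable g) (τ : ℝ) :
    ft (fun x => f x - g x) τ = ft f τ - ft g τ := by
  simp only [ft]
  have hf' : Integrable fun x => (f x : ℂ) := hf.ofReal
  have hg' : Integrable fun x => (g x : ℂ) := hg.ofReal
  simp only [Real.fourier_eq, ofReal_sub, smul_sub]
  exact integral_sub ((Real.fourierIntegral_convergent_iff τ).2 hf')
    ((Real.fourierIntegral_convergent_iff τ).2 hg')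

/-- The moments of `χ - χ(· - L)` are controlled by those of `χ'`, uniformly in `L`. -/
theorem ftMoment_sub_translate_le {χ : ℝ → ℝ} (hχ : ContDiff ℝ ∞ χ) (hg : IsTest (deriv χ)) (L : ℝ)
    (hψ : IsTest fun x => χ x - χ (x - L)) (m : ℕ) :
    ftMoment (m + 1) (fun x => χ x - χ (x - L)) ≤ 2 * ftMoment m (deriv χ) := by
  rw [ftMoment, ftMoment, ← integral_const_mul]
  refine integral_mono (hψ.integrable_moment _) ((hg.integrable_moment m).const_mul 2) fun τ => ?_
  have hd : Differentiable ℝ χ := hχ.differentiable (by simp)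
  have h1 : deriv (fun x => χ x - χ (x - L)) = fun x => deriv χ x - deriv χ (x - L) := by
    funext x
    have h3 : DifferentiableAt ℝ (fun x => χ (x - L)) x :=
      DifferentiableAt.comp x (hd _) (differentiableAt_id.sub_const L)
    rw [deriv_fun_sub (hd x) h3, deriv_comp_sub_const (f := χ)]
  have h2 := hψ.ft_deriv τ
  rw [h1, integrable_ft_sub hg.integrable (hg.integrable.comp_sub_right L)] at h2
  calc ‖freq τ‖ ^ (m + 1) * ‖ft (fun x => χ x - χ (x - L)) τ‖
      = ‖freq τ‖ ^ m * ‖freq τ * ft (fun x => χ x - χ (x - L)) τ‖ := by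
        rw [norm_mul]; ring
    _ ≤ ‖freq τ‖ ^ m * (‖ft (deriv χ) τ‖ + ‖ft (deriv χ) τ‖) := by
        rw [← h2]
        gcongr
        refine (norm_sub_le _ _).trans_eq ?_
        rw [ft_comp_sub (deriv χ)]
    _ = 2 * (‖freq τ‖ ^ m * ‖ft (deriv χ) τ‖) := by ring

/-! ### Taylor's formula in the interaction picture -/

section Bounded

variable {𝓗 : Type*} [NormedAddCommGroup 𝓗] [InnerProductSpace ℂ 𝓗] [CompleteSpace 𝓗]
variable {𝓗₂ : Type*} [NormedAddCommGroup 𝓗₂] [InnerProductSpace ℂ 𝓗₂] [CompleteSpace 𝓗₂]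

/-- The unitary group `e^{2πiτA}` of a bounded self-adjoint operator `A`. -/
noncomputable def V (A : 𝓗 →L[ℂ] 𝓗) (τ : ℝ) : 𝓗 →L[ℂ] 𝓗 := NormedSpace.exp (freq τ • A)

/-- The commutator `A₂ B - B A` of `B : 𝓗 → 𝓗₂` with a pair of bounded operators. -/
def ad (A₂ : 𝓗₂ →L[ℂ] 𝓗₂) (A : 𝓗 →L[ℂ] 𝓗) (B : 𝓗 →L[ℂ] 𝓗₂) : 𝓗 →L[ℂ] 𝓗₂ :=
  A₂ ∘L B - B ∘L A

theorem hasDerivAt_freq (τ : ℝ) : HasDerivAt freq (2 * Real.pi * I) τ := by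
  have := (hasDerivAt_id τ).ofReal_comp.const_mul (2 * Real.pi * I : ℂ)
  unfold freq
  simpa using this

theorem V_zero (A : 𝓗 →L[ℂ] 𝓗) : V A 0 = 1 := by
  simp [V, freq, NormedSpace.exp_zero]

theorem V_mul_neg (A : 𝓗 →L[ℂ] 𝓗) (τ : ℝ) : V A τ * V A (-τ) = 1 := by
  let _ : NormedAlgebra ℚ (𝓗 →L[ℂ] 𝓗) := NormedAlgebra.restrictScalars ℚ ℂ _
  rw [V, V, freq_neg, ← NormedSpace.exp_add_of_commute, neg_smul, add_neg_cancel,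
    NormedSpace.exp_zero]
  exact ((Commute.refl A).smul_left _).smul_right _

theorem V_neg_mul (A : 𝓗 →L[ℂ] 𝓗) (τ : ℝ) : V A (-τ) * V A τ = 1 := by
  simpa using V_mul_neg A (-τ)

theorem star_V {A : 𝓗 →L[ℂ] 𝓗} (hA : IsSelfAdjoint A) (τ : ℝ) : star (V A τ) = V A (-τ) := by
  rw [V, NormedSpace.star_exp, V, star_smul, hA.star_eq, freq_neg]
  congr 2
  simp [freq]

theorem V_mem_unitary {A : 𝓗 →L[ℂ] 𝓗} (hA : IsSelfAdjoint A) (τ : ℝ) :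
    V A τ ∈ unitary (𝓗 →L[ℂ] 𝓗) :=
  Unitary.mem_iff.mpr ⟨by rw [star_V hA, V_neg_mul], by rw [star_V hA, V_mul_neg]⟩

theorem norm_V_comp {A : 𝓗 →L[ℂ] 𝓗} (hA : IsSelfAdjoint A) (τ : ℝ) {F : Type*}
    [NormedAddCommGroup F] [NormedSpace ℂ F] (B : F →L[ℂ] 𝓗) : ‖V A τ ∘L B‖ ≤ ‖B‖ := by
  refine ContinuousLinearMap.opNorm_le_bound _ (norm_nonneg _) fun x => ?_
  have h : ‖V A τ (B x)‖ = ‖B x‖ := by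
    have := ContinuousLinearMap.norm_map_of_mem_unitary (V_mem_unitary hA τ) (B x)
    exact this
  rw [ContinuousLinearMap.comp_apply, h]
  exact B.le_opNorm x

theorem norm_V_le {A : 𝓗 →L[ℂ] 𝓗} (hA : IsSelfAdjoint A) (τ : ℝ) : ‖V A τ‖ ≤ 1 := by
  have := norm_V_comp hA τ (ContinuousLinearMap.id ℂ 𝓗)
  exact this.trans ContinuousLinearMap.norm_id_le

theorem norm_comp_V {A : 𝓗 →L[ℂ] 𝓗} (hA : IsSelfAdjoint A) (τ : ℝ) {F : Type*}
    [NormedAddCommGroup F] [NormedSpace ℂ F] (B : 𝓗 →L[ℂ] F) : ‖B ∘L V A τ‖ ≤ ‖B‖ :=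
  (B.opNorm_comp_le _).trans
    (mul_le_of_le_one_right (norm_nonneg _) (norm_V_le hA τ))

theorem hasDerivAt_V (A : 𝓗 →L[ℂ] 𝓗) (τ : ℝ) :
    HasDerivAt (V A) ((2 * Real.pi * I : ℂ) • (A * V A τ)) τ :=
  HasDerivAt.scomp τ (hasDerivAt_exp_smul_const' (𝕂 := ℂ) A (freq τ)) (hasDerivAt_freq τ)

theorem continuous_V (A : 𝓗 →L[ℂ] 𝓗) : Continuous (V A) :=
  continuous_iff_continuousAt.mpr fun τ => (hasDerivAt_V A τ).continuousAt

/-- The interaction picture: `d/dτ e^{2πiτA₂} C e^{-2πiτA} = 2πi e^{2πiτA₂} ad(C) e^{-2πiτA}`. -/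
theorem hasDerivAt_conj (A₂ : 𝓗₂ →L[ℂ] 𝓗₂) (A : 𝓗 →L[ℂ] 𝓗) (C : 𝓗 →L[ℂ] 𝓗₂) (τ : ℝ) :
    HasDerivAt (fun τ => V A₂ τ ∘L C ∘L V A (-τ))
      ((2 * Real.pi * I : ℂ) • (V A₂ τ ∘L ad A₂ A C ∘L V A (-τ))) τ := by
  have h1 : ∀ z : ℂ, HasDerivAt (fun z : ℂ => NormedSpace.exp (z • A₂) ∘L C ∘L
      NormedSpace.exp (z • (-A)))
      ((NormedSpace.exp (z • A₂) * A₂) ∘L C ∘L NormedSpace.exp (z • (-A)) +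
        NormedSpace.exp (z • A₂) ∘L C ∘L (-A * NormedSpace.exp (z • (-A)))) z := by
    intro z
    have e1 := hasDerivAt_exp_smul_const (𝕂 := ℂ) A₂ z
    have e2 := hasDerivAt_exp_smul_const' (𝕂 := ℂ) (-A) z
    have e3 := ((hasDerivAt_const z C).clm_comp e2)
    have e4 := e1.clm_comp e3
    refine e4.congr_deriv ?_
    simp
  have h2 := HasDerivAt.scomp τ (h1 (freq τ)) (hasDerivAt_freq τ)
  have h3 : ∀ τ, V A (-τ) = NormedSpace.exp (freq τ • (-A)) := fun τ => by
    rw [V, freq_neg, neg_smul, smul_neg]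
  have h4 : (fun τ => V A₂ τ ∘L C ∘L V A (-τ)) = (fun z : ℂ => NormedSpace.exp (z • A₂) ∘L C ∘L
      NormedSpace.exp (z • (-A))) ∘ freq := by
    funext τ
    rw [h3]
    rfl
  rw [h4]
  refine h2.congr_deriv ?_
  rw [← h3]
  congr 1
  ext x
  simp [ad, V, sub_eq_add_neg]

theorem norm_le_of_norm_deriv_le_pow {E : Type*} [NormedAddCommGroup E] [NormedSpace ℝ E]
    {f f' : ℝ → E} (hf : ∀ σ, HasDerivAt f (f' σ) σ) (h0 : f 0 = 0) {K : ℝ} {m : ℕ}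
    (hb : ∀ σ, ‖f' σ‖ ≤ K * |σ| ^ m) (τ : ℝ) : ‖f τ‖ ≤ K * |τ| ^ (m + 1) / (m + 1) := by
  have key : ∀ (f f' : ℝ → E), (∀ σ, HasDerivAt f (f' σ) σ) → f 0 = 0 →
      (∀ σ, ‖f' σ‖ ≤ K * |σ| ^ m) → ∀ τ, 0 ≤ τ → ‖f τ‖ ≤ K * |τ| ^ (m + 1) / (m + 1) := by
    intro f f' hf h0 hb τ hτ
    rw [abs_of_nonneg hτ]
    refine image_norm_le_of_norm_deriv_right_le_deriv_boundary (f := f) (f' := f') (a := 0) (b := τ)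
      (B := fun x => K * x ^ (m + 1) / (m + 1)) (B' := fun x => K * x ^ m)
      (fun x _ => (hf x).continuousAt.continuousWithinAt)
      (fun x _ => (hf x).hasDerivWithinAt) (by simp [h0]) (fun x => ?_) (fun x hx => ?_)
      ⟨hτ, le_rfl⟩
    · have h1 := (((hasDerivAt_id x).pow (m + 1)).const_mul K).div_const ((m : ℝ) + 1)
      refine h1.congr_deriv ?_
      have : (m : ℝ) + 1 ≠ 0 := by positivity
      simp
      field_simp
    · simpa [abs_of_nonneg hx.1] using hb x
  rcases le_total 0 τ with h | h
  · exact key f f' hf h0 hb τ h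
  · have h1 := key (fun σ => f (-σ)) (fun σ => -f' (-σ))
      (fun σ => by
        have := (hf (-σ)).scomp σ (hasDerivAt_neg σ)
        simpa [Function.comp_def] using this) (by simpa using h0)
      (fun σ => by simpa using hb (-σ)) (-τ) (by linarith)
    simpa using h1

/-- `Y` integrates the interaction picture of `C`: `Y(0) = 0` and
`Y'(τ) = 2πi e^{2πiτA₂} C e^{-2πiτA}`. If `C = A₂ B - B A` then `Y(τ) = e^{2πiτA₂} B e^{-2πiτA} - B`;
the notion makes sense even if `B` itself is unbounded. -/
structure IsIncrement (A₂ : 𝓗₂ →L[ℂ] 𝓗₂) (A : 𝓗 →L[ℂ] 𝓗) (C : 𝓗 →L[ℂ] 𝓗₂)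
    (Y : ℝ → 𝓗 →L[ℂ] 𝓗₂) : Prop where
  zero : Y 0 = 0
  hasDerivAt : ∀ τ, HasDerivAt Y ((2 * Real.pi * I : ℂ) • (V A₂ τ ∘L C ∘L V A (-τ))) τ

theorem isIncrement_conj (A₂ : 𝓗₂ →L[ℂ] 𝓗₂) (A : 𝓗 →L[ℂ] 𝓗) (B : 𝓗 →L[ℂ] 𝓗₂) :
    IsIncrement A₂ A (ad A₂ A B) fun τ => V A₂ τ ∘L B ∘L V A (-τ) - B where
  zero := by
    simp only [neg_zero, V_zero]
    ext x
    simp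
  hasDerivAt τ := (hasDerivAt_conj A₂ A B τ).sub_const B

theorem IsIncrement.continuous {A₂ : 𝓗₂ →L[ℂ] 𝓗₂} {A : 𝓗 →L[ℂ] 𝓗} {C : 𝓗 →L[ℂ] 𝓗₂}
    {Y : ℝ → 𝓗 →L[ℂ] 𝓗₂} (hY : IsIncrement A₂ A C Y) : Continuous Y :=
  continuous_iff_continuousAt.mpr fun τ => (hY.hasDerivAt τ).continuousAt

/-- Taylor's formula for the interaction picture. Unitarity of both groups makes the remainder depend
on the commutator of the highest order only, and not on the norms of `A` and `A₂`. -/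
theorem IsIncrement.norm_sub_taylor_le {A₂ : 𝓗₂ →L[ℂ] 𝓗₂} {A : 𝓗 →L[ℂ] 𝓗}
    (hA₂ : IsSelfAdjoint A₂) (hA : IsSelfAdjoint A) (m : ℕ) {C : 𝓗 →L[ℂ] 𝓗₂}
    {Y : ℝ → 𝓗 →L[ℂ] 𝓗₂} (hY : IsIncrement A₂ A C Y) (τ : ℝ) :
    ‖Y τ - ∑ k ∈ Finset.range m, (freq τ ^ (k + 1) / ((k + 1).factorial : ℂ)) • (ad A₂ A)^[k] C‖
      ≤ ‖freq τ‖ ^ (m + 1) / ((m + 1).factorial : ℝ) * ‖(ad A₂ A)^[m] C‖ := by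
  induction m generalizing C Y τ with
  | zero =>
    have h := norm_le_of_norm_deriv_le_pow (m := 0) (K := 2 * Real.pi * ‖C‖) hY.hasDerivAt hY.zero
      (fun σ => by
        rw [norm_smul, pow_zero, mul_one]
        refine mul_le_mul (by simp [abs_of_pos Real.pi_pos]) ?_ (norm_nonneg _) (by positivity)
        exact (norm_V_comp hA₂ σ _).trans (norm_comp_V hA _ _)) τ
    simp only [Finset.range_zero, Finset.sum_empty, sub_zero, norm_freq]
    refine h.trans_eq ?_
    simp
    ring
  | succ m ih =>
    set Z : ℝ → 𝓗 →L[ℂ] 𝓗₂ := fun τ => V A₂ τ ∘L C ∘L V A (-τ) - C with hZ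
    have hZ' := fun σ => ih (isIncrement_conj A₂ A C) σ
    set r : ℝ → 𝓗 →L[ℂ] 𝓗₂ := fun τ => Y τ - ∑ k ∈ Finset.range (m + 1),
      (freq τ ^ (k + 1) / ((k + 1).factorial : ℂ)) • (ad A₂ A)^[k] C with hr
    have hd : ∀ σ, HasDerivAt r ((2 * Real.pi * I : ℂ) • (Z σ - ∑ k ∈ Finset.range m,
        (freq σ ^ (k + 1) / ((k + 1).factorial : ℂ)) • (ad A₂ A)^[k] (ad A₂ A C))) σ := by
      intro σ
      have h1 : HasDerivAt (fun τ => ∑ k ∈ Finset.range (m + 1),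
          (freq τ ^ (k + 1) / ((k + 1).factorial : ℂ)) • (ad A₂ A)^[k] C)
          (∑ k ∈ Finset.range (m + 1), ((2 * Real.pi * I : ℂ) * (freq σ ^ k / (k.factorial : ℂ))) •
            (ad A₂ A)^[k] C) σ := by
        refine HasDerivAt.fun_sum fun k _ => ?_
        have h2 := ((hasDerivAt_freq σ).pow (k + 1)).div_const ((k + 1).factorial : ℂ)
        have h3 := h2.smul_const ((ad A₂ A)^[k] C)
        refine h3.congr_deriv ?_
        congr 1
        rw [Nat.factorial_succ]
        have : (k.factorial : ℂ) ≠ 0 := Nat.cast_ne_zero.mpr (Nat.factorial_ne_zero k)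
        have h4 : (k : ℂ) + 1 ≠ 0 := Nat.cast_add_one_ne_zero k
        push_cast
        field_simp
      refine ((hY.hasDerivAt σ).sub h1).congr_deriv ?_
      have h5 : Z σ = V A₂ σ ∘L C ∘L V A (-σ) - C := rfl
      rw [Finset.sum_range_succ', h5, smul_sub, smul_sub, Finset.smul_sum]
      simp only [pow_zero, Nat.factorial_zero, Nat.cast_one, div_one, mul_one,
        Function.iterate_zero, id, ← mul_smul, Function.iterate_succ_apply]
      abel
    have h0 : r 0 = 0 := by
      simp only [hr, hY.zero, zero_sub, neg_eq_zero]
      refine Finset.sum_eq_zero fun k _ => ?_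
      simp [freq]
    have h := norm_le_of_norm_deriv_le_pow (m := m + 1) hd h0
      (K := 2 * Real.pi * ((2 * Real.pi) ^ (m + 1) / ((m + 1).factorial : ℝ) *
        ‖(ad A₂ A)^[m] (ad A₂ A C)‖))
      (fun σ => by
        rw [norm_smul, mul_assoc (2 * Real.pi)]
        refine mul_le_mul (by simp [abs_of_pos Real.pi_pos]) ?_ (norm_nonneg _) (by positivity)
        refine (hZ' σ).trans_eq ?_
        rw [norm_freq]
        ring) τ
    refine h.trans_eq ?_
    rw [norm_freq, Nat.factorial_succ (m + 1), Function.iterate_succ_apply]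
    have : ((m + 1).factorial : ℝ) ≠ 0 := Nat.cast_ne_zero.mpr (Nat.factorial_ne_zero _)
    have h4 : (m : ℝ) + 1 + 1 ≠ 0 := by positivity
    push_cast
    field_simp
    ring

/-! ### Functional calculus as a Fourier integral -/

theorem V_eq_cfc {A : 𝓗 →L[ℂ] 𝓗} (hA : IsSelfAdjoint A) (τ : ℝ) :
    V A τ = cfc (fun z : ℂ => exp (freq τ * z)) A := by
  have hN : IsStarNormal A := hA.isStarNormal
  have hN' : IsStarNormal (freq τ • A) := by
    refine ⟨?_⟩
    rw [star_smul]
    exact (hN.star_comm_self.smul_left _).smul_right _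
  have h := CFC.complex_exp_eq_normedSpace_exp (a := freq τ • A) hN'
  rw [V, ← h, ← cfc_comp_smul (freq τ) exp A (by fun_prop)]
  rfl

theorem integrable_ft_smul_V {f : ℝ → ℝ} (hf : IsTest f) {A : 𝓗 →L[ℂ] 𝓗} (hA : IsSelfAdjoint A) :
    Integrable fun τ => ft f τ • V A τ := by
  refine (hf.integrable_moment 0).mono'
    ((hf.continuous_ft.smul (continuous_V A)).aestronglyMeasurable)
    (Eventually.of_forall fun τ => ?_)
  rw [norm_smul, pow_zero, one_mul]
  exact mul_le_of_le_one_right (norm_nonneg _) (norm_V_le hA τ)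

theorem cfc_eq_integral {f : ℝ → ℝ} (hf : IsTest f) {A : 𝓗 →L[ℂ] 𝓗} (hA : IsSelfAdjoint A) :
    cfc f A = ∫ τ, ft f τ • V A τ := by
  have hN : IsStarNormal A := hA.isStarNormal
  have h1 : ∀ τ, ft f τ • V A τ = cfc (fun z : ℂ => ft f τ * exp (freq τ * z)) A := fun τ => by
    rw [cfc_const_mul _ _ A (by fun_prop), V_eq_cfc hA]
  have hre : ∀ z ∈ spectrum ℂ A, ((z.re : ℝ) : ℂ) = z := fun z hz =>
    (hA.mem_spectrum_eq_re hz).symm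
  have h2 : cfc (fun z : ℂ => ∫ τ, ft f τ * exp (freq τ * z)) A =
      ∫ τ, cfc (fun z : ℂ => ft f τ * exp (freq τ * z)) A := by
    refine cfc_integral (fun τ z => ft f τ * exp (freq τ * z)) (fun τ => ‖freq τ‖ ^ 0 * ‖ft f τ‖) A
      ?_ ?_ (hf.integrable_moment 0).2 hN
    · refine Continuous.continuousOn ?_
      have := hf.continuous_ft
      have := continuous_freq
      unfold Function.uncurry
      fun_prop
    · refine Eventually.of_forall fun τ z hz => ?_
      rw [norm_mul, ← hre z hz, Complex.norm_exp]
      have : (freq τ * ((z.re : ℝ) : ℂ)).re = 0 := by simp [freq]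
      simp [this]
  simp only [h1, ← h2]
  rw [cfc_real_eq_complex f hA]
  refine cfc_congr fun z hz => ?_
  rw [← hf.inversion z.re]
  simp only [hre z hz]

/-- The operator `∫ f̂(τ) e^{2πiτA₂} Y(-τ) dτ`. If `Y` comes from `B` it is `B f(A) - f(A₂) B`. -/
noncomputable def incr (A₂ : 𝓗₂ →L[ℂ] 𝓗₂) (f : ℝ → ℝ) (Y : ℝ → 𝓗 →L[ℂ] 𝓗₂) : 𝓗 →L[ℂ] 𝓗₂ :=
  ∫ τ, ft f τ • (V A₂ τ ∘L Y (-τ))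

theorem incr_conj {f : ℝ → ℝ} (hf : IsTest f) {A₂ : 𝓗₂ →L[ℂ] 𝓗₂} {A : 𝓗 →L[ℂ] 𝓗}
    (hA₂ : IsSelfAdjoint A₂) (hA : IsSelfAdjoint A) (B : 𝓗 →L[ℂ] 𝓗₂) :
    incr A₂ f (fun τ => V A₂ τ ∘L B ∘L V A (-τ) - B) = B ∘L cfc f A - cfc f A₂ ∘L B := by
  have e1 : ∀ τ, ft f τ • (V A₂ τ ∘L (V A₂ (-τ) ∘L B ∘L V A (- -τ) - B)) =
      B ∘L (ft f τ • V A τ) - (ft f τ • V A₂ τ) ∘L B := by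
    intro τ
    have h : V A₂ τ ∘L (V A₂ (-τ) ∘L B ∘L V A (- -τ)) = B ∘L V A τ := by
      rw [← ContinuousLinearMap.comp_assoc, neg_neg]
      have := V_mul_neg A₂ τ
      rw [ContinuousLinearMap.mul_def] at this
      rw [this]
      rfl
    rw [ContinuousLinearMap.comp_sub, h, smul_sub, ContinuousLinearMap.comp_smul,
      ContinuousLinearMap.smul_comp]
  have i1 := integrable_ft_smul_V hf hA
  have i2 := integrable_ft_smul_V hf hA₂
  have c1 := (ContinuousLinearMap.compL ℂ 𝓗 𝓗 𝓗₂ B).integral_comp_comm i1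
  have c2 := ((ContinuousLinearMap.compL ℂ 𝓗 𝓗₂ 𝓗₂).flip B).integral_comp_comm i2
  simp only [ContinuousLinearMap.compL_apply, ContinuousLinearMap.flip_apply] at c1 c2
  rw [incr]
  simp only [e1]
  rw [integral_sub, c1, c2, cfc_eq_integral hf hA, cfc_eq_integral hf hA₂]
  · exact (ContinuousLinearMap.compL ℂ 𝓗 𝓗 𝓗₂ B).integrable_comp i1
  · exact ((ContinuousLinearMap.compL ℂ 𝓗 𝓗₂ 𝓗₂).flip B).integrable_comp i2

theorem integrable_incr {f : ℝ → ℝ} (hf : IsTest f) {A₂ : 𝓗₂ →L[ℂ] 𝓗₂} {A : 𝓗 →L[ℂ] 𝓗}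
    (hA₂ : IsSelfAdjoint A₂) (hA : IsSelfAdjoint A) {C : 𝓗 →L[ℂ] 𝓗₂} {Y : ℝ → 𝓗 →L[ℂ] 𝓗₂}
    (hY : IsIncrement A₂ A C Y) : Integrable fun τ => ft f τ • (V A₂ τ ∘L Y (-τ)) := by
  refine ((hf.integrable_moment 1).mul_const ‖C‖).mono' ?_ (Eventually.of_forall fun τ => ?_)
  · have h1 := hf.continuous_ft
    have h2 := continuous_V A₂
    have h3 := hY.continuous.comp continuous_neg
    exact (h1.smul (h2.clm_comp h3)).aestronglyMeasurable
  · rw [norm_smul]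
    have h1 := hY.norm_sub_taylor_le hA₂ hA 0 (-τ)
    simp only [Finset.range_zero, Finset.sum_empty, sub_zero, zero_add, pow_one,
      Nat.factorial_one, Nat.cast_one, div_one, Function.iterate_zero, id, freq_neg, norm_neg] at h1
    calc ‖ft f τ‖ * ‖V A₂ τ ∘L Y (-τ)‖ ≤ ‖ft f τ‖ * (‖freq τ‖ * ‖C‖) := by
          gcongr
          exact (norm_V_comp hA₂ τ _).trans h1
      _ = ‖freq τ‖ ^ 1 * ‖ft f τ‖ * ‖C‖ := by ring

/-- The commutator expansion with an error controlled by the highest commutator only. -/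
theorem norm_incr_sub_le {f : ℝ → ℝ} (hf : IsTest f) {A₂ : 𝓗₂ →L[ℂ] 𝓗₂} {A : 𝓗 →L[ℂ] 𝓗}
    (hA₂ : IsSelfAdjoint A₂) (hA : IsSelfAdjoint A) {C : 𝓗 →L[ℂ] 𝓗₂} {Y : ℝ → 𝓗 →L[ℂ] 𝓗₂}
    (hY : IsIncrement A₂ A C Y) (m : ℕ) :
    ‖incr A₂ f Y - ∑ k ∈ Finset.range m, ((-1 : ℂ) ^ (k + 1) / ((k + 1).factorial : ℂ)) •
      (cfc (iteratedDeriv (k + 1) f) A₂ ∘L (ad A₂ A)^[k] C)‖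
      ≤ ftMoment (m + 1) f / ((m + 1).factorial : ℝ) * ‖(ad A₂ A)^[m] C‖ := by
  have i2 := fun k => integrable_ft_smul_V (hf.iteratedDeriv (k + 1)) hA₂
  have i3 : ∀ k, Integrable fun τ => ((-1 : ℂ) ^ (k + 1) / ((k + 1).factorial : ℂ)) •
      ((ft (iteratedDeriv (k + 1) f) τ • V A₂ τ) ∘L (ad A₂ A)^[k] C) := by
    intro k
    have := (((ContinuousLinearMap.compL ℂ 𝓗 𝓗₂ 𝓗₂).flip ((ad A₂ A)^[k] C)).integrable_comp
      (i2 k)).smul ((-1 : ℂ) ^ (k + 1) / ((k + 1).factorial : ℂ))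
    exact this
  have e1 : ∀ k, ((-1 : ℂ) ^ (k + 1) / ((k + 1).factorial : ℂ)) •
      (cfc (iteratedDeriv (k + 1) f) A₂ ∘L (ad A₂ A)^[k] C) =
      ∫ τ, ((-1 : ℂ) ^ (k + 1) / ((k + 1).factorial : ℂ)) •
      ((ft (iteratedDeriv (k + 1) f) τ • V A₂ τ) ∘L (ad A₂ A)^[k] C) := by
    intro k
    have c2 := ((ContinuousLinearMap.compL ℂ 𝓗 𝓗₂ 𝓗₂).flip
      ((ad A₂ A)^[k] C)).integral_comp_comm (i2 k)
    simp only [ContinuousLinearMap.compL_apply, ContinuousLinearMap.flip_apply] at c2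
    rw [integral_smul, c2, cfc_eq_integral (hf.iteratedDeriv (k + 1)) hA₂]
  simp only [e1]
  rw [← integral_finsetSum _ fun k _ => i3 k, incr,
    ← integral_sub (integrable_incr hf hA₂ hA hY) (integrable_finsetSum _ fun k _ => i3 k)]
  have e2 : ftMoment (m + 1) f / ((m + 1).factorial : ℝ) * ‖(ad A₂ A)^[m] C‖ =
      ∫ τ, ‖freq τ‖ ^ (m + 1) * ‖ft f τ‖ * (‖(ad A₂ A)^[m] C‖ / ((m + 1).factorial : ℝ)) := by
    rw [integral_mul_const, ftMoment]
    ring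
  rw [e2]
  refine norm_integral_le_of_norm_le ((hf.integrable_moment (m + 1)).mul_const _)
    (Eventually.of_forall fun τ => ?_)
  have e3 : ft f τ • (V A₂ τ ∘L Y (-τ)) - ∑ k ∈ Finset.range m,
      ((-1 : ℂ) ^ (k + 1) / ((k + 1).factorial : ℂ)) •
      ((ft (iteratedDeriv (k + 1) f) τ • V A₂ τ) ∘L (ad A₂ A)^[k] C) =
      ft f τ • (V A₂ τ ∘L (Y (-τ) - ∑ k ∈ Finset.range m,
        (freq (-τ) ^ (k + 1) / ((k + 1).factorial : ℂ)) • (ad A₂ A)^[k] C)) := by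
    rw [ContinuousLinearMap.comp_sub, smul_sub, ContinuousLinearMap.comp_finsetSum,
      Finset.smul_sum]
    congr 1
    refine Finset.sum_congr rfl fun k _ => ?_
    rw [hf.ft_iteratedDeriv, ContinuousLinearMap.smul_comp, ContinuousLinearMap.comp_smul,
      smul_smul, smul_smul, freq_neg, neg_pow (freq τ)]
    congr 1
    ring
  rw [e3, norm_smul]
  calc ‖ft f τ‖ * ‖V A₂ τ ∘L (Y (-τ) - ∑ k ∈ Finset.range m,
        (freq (-τ) ^ (k + 1) / ((k + 1).factorial : ℂ)) • (ad A₂ A)^[k] C)‖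
      ≤ ‖ft f τ‖ * (‖freq τ‖ ^ (m + 1) / ((m + 1).factorial : ℝ) * ‖(ad A₂ A)^[m] C‖) := by
        gcongr
        refine (norm_V_comp hA₂ τ _).trans ((hY.norm_sub_taylor_le hA₂ hA m (-τ)).trans_eq ?_)
        rw [freq_neg, norm_neg]
    _ = _ := by ring

end Bounded

/-! ### Localized commutator expansions -/

/-- The supremum norm of a real function; it is `0` for unbounded functions. -/
noncomputable def supNorm (f : ℝ → ℝ) : ℝ := ⨆ x, |f x|

/-- `g` equals `1` in a neighbourhood of the support of `f`. -/
def IsPlateau (g f : ℝ → ℝ) : Prop := ∀ x ∈ tsupport f, ∀ᶠ y in 𝓝 x, g y = 1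

/-- The coefficient `(-1)^{k+1} f^{(k+1)} / (k+1)!` of the commutator expansion. -/
noncomputable def taylorCoeff (f : ℝ → ℝ) (k : ℕ) (x : ℝ) : ℝ :=
  (-1) ^ (k + 1) / ((k + 1).factorial : ℝ) * iteratedDeriv (k + 1) f x

theorem supNorm_nonneg (f : ℝ → ℝ) : 0 ≤ supNorm f := Real.iSup_nonneg fun _ => abs_nonneg _

theorem IsTest.abs_le_supNorm {f : ℝ → ℝ} (hf : IsTest f) (x : ℝ) : |f x| ≤ supNorm f := by
  obtain ⟨C, hC⟩ := hf.2.exists_bound_of_continuous hf.1.continuous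
  exact le_ciSup (f := fun x => |f x|) ⟨C, by rintro _ ⟨y, rfl⟩; exact hC y⟩ x

theorem IsTest.continuous {f : ℝ → ℝ} (hf : IsTest f) : Continuous f := hf.1.continuous

theorem IsTest.const_mul {f : ℝ → ℝ} (hf : IsTest f) (c : ℝ) : IsTest fun x => c * f x :=
  ⟨contDiff_const.mul hf.1, hf.2.mul_left⟩

theorem IsTest.add {f g : ℝ → ℝ} (hf : IsTest f) (hg : IsTest g) : IsTest fun x => f x + g x :=
  ⟨hf.1.add hg.1, HasCompactSupport.add hf.2 hg.2⟩

theorem IsTest.mul {f g : ℝ → ℝ} (hf : IsTest f) (hg : IsTest g) : IsTest fun x => f x * g x :=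
  ⟨hf.1.mul hg.1, hf.2.mul_right⟩

theorem IsTest.taylorCoeff {f : ℝ → ℝ} (hf : IsTest f) (k : ℕ) : IsTest (taylorCoeff f k) :=
  (hf.iteratedDeriv (k + 1)).const_mul _

theorem taylorCoeff_succ_eq (f : ℝ → ℝ) (k : ℕ) : taylorCoeff f (k + 1) = fun x =>
    (-1) ^ (k + 2) / ((k + 2).factorial : ℝ) * iteratedDeriv (k + 1) (deriv f) x := by
  funext x
  rw [taylorCoeff, iteratedDeriv_succ']

theorem IsPlateau.mul_eq {g f : ℝ → ℝ} (h : IsPlateau g f) (x : ℝ) : f x * g x = f x := by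
  by_cases hx : f x = 0
  · simp [hx]
  · rw [(h x (subset_tsupport f hx)).self_of_nhds, mul_one]

theorem IsPlateau.mul_taylorCoeff {g f : ℝ → ℝ} (h : IsPlateau g f) (k : ℕ) (x : ℝ) :
    f x * taylorCoeff g k x = 0 := by
  by_cases hx : f x = 0
  · simp [hx]
  · have h1 : g =ᶠ[𝓝 x] fun _ => (1 : ℝ) := h x (subset_tsupport f hx)
    rw [taylorCoeff, h1.iteratedDeriv_eq, iteratedDeriv_const]
    simp

theorem IsPlateau.mono {g f h : ℝ → ℝ} (hg : IsPlateau g f) (hh : ∀ x, f x = 0 → h x = 0) :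
    IsPlateau g h := fun x hx => hg x <| by
  refine closure_mono (fun y hy => ?_) hx
  exact fun h0 => hy (hh y h0)

theorem IsPlateau.deriv {g f : ℝ → ℝ} (h : IsPlateau g f) : IsPlateau g (deriv f) :=
  fun x hx => h x (tsupport_deriv_subset hx)

theorem IsPlateau.iteratedDeriv {g f : ℝ → ℝ} (h : IsPlateau g f) (k : ℕ) :
    IsPlateau g (iteratedDeriv k f) := by
  induction k with
  | zero => simpa using h
  | succ k ih => rw [iteratedDeriv_succ]; exact ih.deriv

theorem IsPlateau.add {g f h : ℝ → ℝ} (hf : IsPlateau g f) (hh : IsPlateau g h) :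
    IsPlateau g fun x => f x + h x := fun x hx => by
  rcases tsupport_add f h hx with h1 | h1
  exacts [hf x h1, hh x h1]

theorem IsPlateau.taylorCoeff {g f : ℝ → ℝ} (h : IsPlateau g f) (k : ℕ) :
    IsPlateau g (taylorCoeff f k) :=
  (h.iteratedDeriv (k + 1)).mono fun x hx => by simp [LightCone.taylorCoeff, hx]

section Bounded

variable {𝓗 : Type*} [NormedAddCommGroup 𝓗] [InnerProductSpace ℂ 𝓗] [CompleteSpace 𝓗]
variable {𝓗₂ : Type*} [NormedAddCommGroup 𝓗₂] [InnerProductSpace ℂ 𝓗₂] [CompleteSpace 𝓗₂]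

theorem norm_cfc_le_supNorm {f : ℝ → ℝ} (hf : IsTest f) (A : 𝓗 →L[ℂ] 𝓗) :
    ‖cfc f A‖ ≤ supNorm f :=
  norm_cfc_le (supNorm_nonneg f) fun x _ => hf.abs_le_supNorm x

theorem cfc_comp_cfc {f g h : ℝ → ℝ} (hf : Continuous f) (hg : Continuous g) (A : 𝓗 →L[ℂ] 𝓗)
    (hfg : ∀ x, f x * g x = h x) : cfc f A ∘L cfc g A = cfc h A := by
  rw [← funext hfg]
  exact (cfc_mul f g A hf.continuousOn hg.continuousOn).symm

theorem smul_cfc_iteratedDeriv {f : ℝ → ℝ} (hf : IsTest f) {A : 𝓗 →L[ℂ] 𝓗} (k : ℕ) :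
    ((-1 : ℂ) ^ (k + 1) / ((k + 1).factorial : ℂ)) • cfc (iteratedDeriv (k + 1) f) A =
      cfc (taylorCoeff f k) A := by
  have h := cfc_const_mul ((-1 : ℝ) ^ (k + 1) / ((k + 1).factorial : ℝ)) (iteratedDeriv (k + 1) f)
    A (hf.iteratedDeriv (k + 1)).continuous.continuousOn
  have h2 : taylorCoeff f k = fun x => (-1 : ℝ) ^ (k + 1) / ((k + 1).factorial : ℝ) *
    iteratedDeriv (k + 1) f x := rfl
  rw [h2, h, ← Complex.coe_smul]
  push_cast
  rfl

theorem norm_incr_sub_taylorCoeff_le {f : ℝ → ℝ} (hf : IsTest f) {A₂ : 𝓗₂ →L[ℂ] 𝓗₂}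
    {A : 𝓗 →L[ℂ] 𝓗} (hA₂ : IsSelfAdjoint A₂) (hA : IsSelfAdjoint A) {C : 𝓗 →L[ℂ] 𝓗₂}
    {Y : ℝ → 𝓗 →L[ℂ] 𝓗₂} (hY : IsIncrement A₂ A C Y) (m : ℕ) :
    ‖incr A₂ f Y - ∑ k ∈ Finset.range m, cfc (taylorCoeff f k) A₂ ∘L (ad A₂ A)^[k] C‖
      ≤ ftMoment (m + 1) f / ((m + 1).factorial : ℝ) * ‖(ad A₂ A)^[m] C‖ := by
  have h := norm_incr_sub_le hf hA₂ hA hY m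
  simpa only [← ContinuousLinearMap.smul_comp, smul_cfc_iteratedDeriv hf] using h

/-- An operator cut off on the left by `f` is, up to an error controlled by any of its higher
commutators, cut off on the right by a plateau function of `f`: all Taylor terms vanish. -/
theorem norm_sub_comp_plateau_le {f g : ℝ → ℝ} (hf : IsTest f) (hg : IsTest g)
    (hfg : IsPlateau g f) {A₂ : 𝓗₂ →L[ℂ] 𝓗₂} {A : 𝓗 →L[ℂ] 𝓗} (hA₂ : IsSelfAdjoint A₂)
    (hA : IsSelfAdjoint A) (B : 𝓗 →L[ℂ] 𝓗₂) {m : ℕ} (hm : 0 < m) :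
    ‖cfc f A₂ ∘L B - cfc f A₂ ∘L B ∘L cfc g A‖ ≤
      supNorm f * (ftMoment m g / (m.factorial : ℝ)) * ‖(ad A₂ A)^[m] B‖ := by
  obtain ⟨m, rfl⟩ := Nat.exists_eq_succ_of_ne_zero hm.ne'
  have h := norm_incr_sub_taylorCoeff_le hg hA₂ hA (isIncrement_conj A₂ A B) m
  rw [incr_conj hg hA₂ hA] at h
  set T := ∑ k ∈ Finset.range m, cfc (taylorCoeff g k) A₂ ∘L (ad A₂ A)^[k] (ad A₂ A B) with hT
  have h1 : cfc f A₂ ∘L T = 0 := by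
    rw [hT, ContinuousLinearMap.comp_finsetSum]
    refine Finset.sum_eq_zero fun k _ => ?_
    rw [← ContinuousLinearMap.comp_assoc, cfc_comp_cfc hf.continuous (hg.taylorCoeff k).continuous
      (h := fun _ => 0) A₂ (hfg.mul_taylorCoeff k)]
    simp
  have h2 : cfc f A₂ ∘L cfc g A₂ = cfc f A₂ :=
    cfc_comp_cfc hf.continuous hg.continuous A₂ hfg.mul_eq
  have h3 : cfc f A₂ ∘L B - cfc f A₂ ∘L B ∘L cfc g A =
      -(cfc f A₂ ∘L (B ∘L cfc g A - cfc g A₂ ∘L B - T)) := by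
    rw [ContinuousLinearMap.comp_sub, h1, ContinuousLinearMap.comp_sub,
      ← ContinuousLinearMap.comp_assoc (cfc f A₂) (cfc g A₂), h2]
    abel
  rw [h3, norm_neg, mul_assoc]
  refine (ContinuousLinearMap.opNorm_comp_le _ _).trans ?_
  exact mul_le_mul (norm_cfc_le_supNorm hf A₂) h (norm_nonneg _) (supNorm_nonneg _)

/-- The constant in `norm_sum_sub_localized_le`. -/
noncomputable def locConst (c : ℕ → ℝ → ℝ) (g : ℝ → ℝ) (p : ℕ) : ℝ :=
  ∑ k ∈ Finset.range p, supNorm (c k) * (ftMoment (p - k) g / ((p - k).factorial : ℝ))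

theorem locConst_nonneg (c : ℕ → ℝ → ℝ) (g : ℝ → ℝ) (p : ℕ) : 0 ≤ locConst c g p :=
  Finset.sum_nonneg fun _ _ => mul_nonneg (supNorm_nonneg _)
    (div_nonneg (ftMoment_nonneg _ _) (Nat.cast_nonneg _))

/-- In an expansion with localized coefficients, a plateau function may be inserted on the right of
every term. The term of order `k` is expanded `p - k` times, so that all errors are of order `p`. -/
theorem norm_sum_sub_localized_le {c : ℕ → ℝ → ℝ} {g : ℝ → ℝ} (hc : ∀ k, IsTest (c k))
    (hg : IsTest g) (hcg : ∀ k, IsPlateau g (c k)) {A₂ : 𝓗₂ →L[ℂ] 𝓗₂} {A : 𝓗 →L[ℂ] 𝓗}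
    (hA₂ : IsSelfAdjoint A₂) (hA : IsSelfAdjoint A) (B : 𝓗 →L[ℂ] 𝓗₂) (p : ℕ) :
    ‖∑ k ∈ Finset.range p, cfc (c k) A₂ ∘L (ad A₂ A)^[k] B -
      ∑ k ∈ Finset.range p, cfc (c k) A₂ ∘L (ad A₂ A)^[k] B ∘L cfc g A‖ ≤
      locConst c g p * ‖(ad A₂ A)^[p] B‖ := by
  rw [← Finset.sum_sub_distrib, locConst, Finset.sum_mul]
  refine norm_sum_le_of_le _ fun k hk => ?_
  have hk' := Finset.mem_range.mp hk
  have h := norm_sub_comp_plateau_le (hc k) hg (hcg k) hA₂ hA ((ad A₂ A)^[k] B)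
    (m := p - k) (by omega)
  rwa [← Function.iterate_add_apply, Nat.sub_add_cancel hk'.le] at h

/-- The constant in `norm_incr_sub_localized_le`. -/
noncomputable def incrConst (f g : ℝ → ℝ) (p : ℕ) : ℝ :=
  ftMoment (p + 1) f / ((p + 1).factorial : ℝ) + locConst (taylorCoeff f) g p

theorem incrConst_nonneg (f g : ℝ → ℝ) (p : ℕ) : 0 ≤ incrConst f g p :=
  add_nonneg (div_nonneg (ftMoment_nonneg _ _) (Nat.cast_nonneg _)) (locConst_nonneg _ _ _)

theorem norm_incr_sub_localized_le {f g : ℝ → ℝ} (hf : IsTest f) (hg : IsTest g)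
    (hfg : IsPlateau g f) {A₂ : 𝓗₂ →L[ℂ] 𝓗₂} {A : 𝓗 →L[ℂ] 𝓗} (hA₂ : IsSelfAdjoint A₂)
    (hA : IsSelfAdjoint A) {C : 𝓗 →L[ℂ] 𝓗₂} {Y : ℝ → 𝓗 →L[ℂ] 𝓗₂} (hY : IsIncrement A₂ A C Y)
    (p : ℕ) :
    ‖incr A₂ f Y - ∑ k ∈ Finset.range p, cfc (taylorCoeff f k) A₂ ∘L (ad A₂ A)^[k] C ∘L cfc g A‖
      ≤ incrConst f g p * ‖(ad A₂ A)^[p] C‖ := by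
  have h1 := norm_incr_sub_taylorCoeff_le hf hA₂ hA hY p
  have h2 := norm_sum_sub_localized_le (c := taylorCoeff f) (fun k => hf.taylorCoeff k) hg
    (fun k => hfg.taylorCoeff k) hA₂ hA C p
  rw [incrConst, add_mul]
  exact (norm_sub_le_norm_sub_add_norm_sub _ _ _).trans (add_le_add h1 h2)

/-! ### Expansion around the symmetrized leading term -/

/-- The coefficient of order `k + 2` in the expansion of
`χ(y) - χ(x) - (y - x) u(x) u(y)` in powers of `x - y` with coefficients depending on `x`. -/
noncomputable def symCoeff (χ u : ℝ → ℝ) (k : ℕ) (x : ℝ) : ℝ :=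
  taylorCoeff χ (k + 1) x + u x * taylorCoeff u k x

/-- A cutoff `χ` with `χ' = u²` and a plateau function `g` for `χ'`. -/
structure CutoffData (χ u g : ℝ → ℝ) : Prop where
  smooth : ContDiff ℝ ∞ χ
  deriv_test : IsTest (deriv χ)
  u_test : IsTest u
  g_test : IsTest g
  sq_eq : ∀ x, u x * u x = deriv χ x
  plateau : IsPlateau g (deriv χ)

namespace CutoffData

variable {χ u g : ℝ → ℝ}

theorem plateau_u (h : CutoffData χ u g) : IsPlateau g u :=
  h.plateau.mono fun x hx => by
    rw [← h.sq_eq] at hx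
    exact mul_self_eq_zero.mp hx

theorem symCoeff_test (h : CutoffData χ u g) (k : ℕ) : IsTest (symCoeff χ u k) := by
  refine IsTest.add ?_ (h.u_test.mul (h.u_test.taylorCoeff k))
  rw [taylorCoeff_succ_eq]
  exact (h.deriv_test.iteratedDeriv (k + 1)).const_mul _

theorem symCoeff_plateau (h : CutoffData χ u g) (k : ℕ) : IsPlateau g (symCoeff χ u k) := by
  refine IsPlateau.add ?_ (h.plateau_u.mono fun x hx => by simp [hx])
  rw [taylorCoeff_succ_eq]
  exact (h.plateau.iteratedDeriv (k + 1)).mono fun x hx => by simp [hx]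

end CutoffData

/-- The constant in `CutoffData.norm_incr_add_le`. -/
noncomputable def symConst (χ u g : ℝ → ℝ) (p : ℕ) : ℝ :=
  2 * ftMoment (p + 1) (deriv χ) / ((p + 2).factorial : ℝ) +
    supNorm u * (ftMoment (p + 1) u / ((p + 1).factorial : ℝ)) + locConst (symCoeff χ u) g p

theorem symConst_nonneg (χ u g : ℝ → ℝ) (p : ℕ) : 0 ≤ symConst χ u g p := by
  have h1 := ftMoment_nonneg (p + 1) (deriv χ)
  have h2 := ftMoment_nonneg (p + 1) u
  have h3 := supNorm_nonneg u
  have h4 := locConst_nonneg (symCoeff χ u) g p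
  unfold symConst
  positivity

/-- The symmetrized commutator expansion of a cutoff. Since `A` is bounded, the cutoff `χ`, which
is not compactly supported, may be replaced by a test function `ψ` equal to it near the spectrum. -/
theorem CutoffData.norm_incr_add_le {χ u g : ℝ → ℝ} (h : CutoffData χ u g)
    {A₂ : 𝓗₂ →L[ℂ] 𝓗₂} {A : 𝓗 →L[ℂ] 𝓗} (hA₂ : IsSelfAdjoint A₂) (hA : IsSelfAdjoint A)
    {C : 𝓗 →L[ℂ] 𝓗₂} {Y : ℝ → 𝓗 →L[ℂ] 𝓗₂} (hY : IsIncrement A₂ A C Y) {ψ : ℝ → ℝ}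
    (hψ : IsTest ψ) (hψχ : ∀ x ∈ spectrum ℝ A₂, ψ =ᶠ[𝓝 x] χ) (p : ℕ)
    (hm : ftMoment (p + 2) ψ ≤ 2 * ftMoment (p + 1) (deriv χ)) :
    ‖incr A₂ ψ Y + cfc u A₂ ∘L C ∘L cfc u A -
      ∑ k ∈ Finset.range p, cfc (symCoeff χ u k) A₂ ∘L (ad A₂ A)^[k + 1] C ∘L cfc g A‖
      ≤ symConst χ u g p * ‖(ad A₂ A)^[p + 1] C‖ := by
  have e1 := norm_incr_sub_taylorCoeff_le hψ hA₂ hA hY (p + 1)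
  have c1 : ∀ k, cfc (taylorCoeff ψ k) A₂ = cfc (taylorCoeff χ k) A₂ := fun k =>
    cfc_congr fun x hx => by simp only [taylorCoeff, (hψχ x hx).iteratedDeriv_eq]
  -- the first-order term `-χ'(A₂) C`, with `χ' = u²`
  have c0 : cfc (taylorCoeff χ 0) A₂ = -(cfc u A₂ ∘L cfc u A₂) := by
    rw [cfc_comp_cfc h.u_test.continuous h.u_test.continuous A₂ h.sq_eq, ← cfc_neg]
    refine cfc_congr fun x _ => ?_
    simp [taylorCoeff]
  rw [Finset.sum_range_succ'] at e1
  simp only [c1, c0, Function.iterate_zero, id] at e1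
  have e2 := norm_incr_sub_taylorCoeff_le h.u_test hA₂ hA (isIncrement_conj A₂ A C) p
  rw [incr_conj h.u_test hA₂ hA] at e2
  simp only [← Function.iterate_succ_apply] at e2
  have e3 := norm_sum_sub_localized_le h.symCoeff_test h.g_test h.symCoeff_plateau hA₂ hA
    (ad A₂ A C) p
  simp only [← Function.iterate_succ_apply] at e3
  have c2 : ∀ k, cfc (symCoeff χ u k) A₂ =
      cfc (taylorCoeff χ (k + 1)) A₂ + cfc u A₂ ∘L cfc (taylorCoeff u k) A₂ := by
    intro k
    have hc : Continuous (taylorCoeff χ (k + 1)) := by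
      rw [taylorCoeff_succ_eq]
      exact ((h.deriv_test.iteratedDeriv (k + 1)).const_mul _).continuous
    rw [cfc_comp_cfc h.u_test.continuous (h.u_test.taylorCoeff k).continuous A₂ fun x => rfl]
    exact cfc_add (a := A₂) (f := taylorCoeff χ (k + 1)) (hf := hc.continuousOn)
      (hg := (h.u_test.mul (h.u_test.taylorCoeff k)).continuous.continuousOn)
  set S₁ := ∑ k ∈ Finset.range p, cfc (taylorCoeff χ (k + 1)) A₂ ∘L (ad A₂ A)^[k + 1] C
  set S₂ := ∑ k ∈ Finset.range p, cfc (taylorCoeff u k) A₂ ∘L (ad A₂ A)^[k + 1] C with hS₂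
  set S₃ := ∑ k ∈ Finset.range p, cfc (symCoeff χ u k) A₂ ∘L (ad A₂ A)^[k + 1] C with hS₃
  have c3 : S₃ = S₁ + cfc u A₂ ∘L S₂ := by
    rw [hS₃, hS₂, ContinuousLinearMap.comp_finsetSum, ← Finset.sum_add_distrib]
    refine Finset.sum_congr rfl fun k _ => ?_
    rw [c2, ContinuousLinearMap.add_comp, ContinuousLinearMap.comp_assoc]
  have e4 : ‖cfc u A₂ ∘L (C ∘L cfc u A - cfc u A₂ ∘L C - S₂)‖ ≤
      supNorm u * (ftMoment (p + 1) u / ((p + 1).factorial : ℝ)) * ‖(ad A₂ A)^[p + 1] C‖ := by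
    rw [mul_assoc]
    refine (ContinuousLinearMap.opNorm_comp_le _ _).trans ?_
    exact mul_le_mul (norm_cfc_le_supNorm h.u_test A₂) e2 (norm_nonneg _) (supNorm_nonneg _)
  have e5 : ftMoment (p + 1 + 1) ψ / ((p + 1 + 1).factorial : ℝ) * ‖(ad A₂ A)^[p + 1] C‖ ≤
      2 * ftMoment (p + 1) (deriv χ) / ((p + 2).factorial : ℝ) * ‖(ad A₂ A)^[p + 1] C‖ := by
    gcongr
  have e6 := norm_add₃_le.trans (add_le_add (add_le_add (e1.trans e5) e4) e3)
  rw [symConst, add_mul, add_mul]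
  refine le_trans (le_of_eq ?_) e6
  congr 1
  rw [c3, ContinuousLinearMap.comp_sub, ContinuousLinearMap.comp_sub, ContinuousLinearMap.neg_comp,
    ContinuousLinearMap.comp_assoc]
  abel

end Bounded

section Interpolation

/-! ### Interpolation between commutators -/

/-- The sum of the absolute values of the entries of the inverse of the Vandermonde matrix with
nodes `0, i, …, (k-1) i`. -/
noncomputable def vandermondeConst (k : ℕ) : ℝ :=
  ∑ j, ∑ l, ‖(Matrix.vandermonde fun l : Fin k => I * ((l : ℕ) : ℂ))⁻¹ j l‖

theorem vandermondeConst_nonneg (k : ℕ) : 0 ≤ vandermondeConst k := by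
  unfold vandermondeConst
  positivity

/-- The coefficients of a polynomial are controlled by its values at the points
`0, i, …, (k-1) i`. -/
theorem norm_coeff_le {k : ℕ} {E : Type*} [NormedAddCommGroup E] [NormedSpace ℂ E]
    (a : Fin k → E) (R : ℝ)
    (hR : ∀ l : Fin k, ‖∑ j : Fin k, (I * (l : ℂ)) ^ (j : ℕ) • a j‖ ≤ R) (j : Fin k) :
    ‖a j‖ ≤ vandermondeConst k * R := by
  set M : Matrix (Fin k) (Fin k) ℂ := Matrix.vandermonde fun l => I * ((l : ℕ) : ℂ) with hM
  have hdet : IsUnit M.det := by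
    rw [isUnit_iff_ne_zero, hM, Matrix.det_vandermonde_ne_zero_iff]
    intro a b hab
    simp only [mul_eq_mul_left_iff, I_ne_zero, or_false, Nat.cast_inj] at hab
    exact Fin.ext hab
  have h1 : a j = ∑ l, M⁻¹ j l • ∑ i : Fin k, (I * (l : ℂ)) ^ (i : ℕ) • a i := by
    have h2 : ∀ i : Fin k, ∑ l, M⁻¹ j l * (I * (l : ℂ)) ^ (i : ℕ) = (1 : Matrix (Fin k) (Fin k) ℂ) j i := by
      intro i
      rw [← Matrix.nonsing_inv_mul M hdet, Matrix.mul_apply]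
      rfl
    simp only [Finset.smul_sum, smul_smul]
    rw [Finset.sum_comm]
    simp only [← Finset.sum_smul, h2]
    simp [Matrix.one_apply]
  have hR0 : 0 ≤ R := (norm_nonneg _).trans (hR j)
  rw [h1, vandermondeConst, Finset.sum_mul]
  refine (norm_sum_le_of_le _ fun l _ => ?_).trans
    (Finset.single_le_sum (f := fun j => (∑ l, ‖M⁻¹ j l‖) * R) (fun j _ => by positivity)
      (Finset.mem_univ j) |>.trans' (Finset.sum_mul _ _ _).ge)
  rw [norm_smul]
  exact mul_le_mul_of_nonneg_left (hR l) (norm_nonneg _)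

theorem iterate_ad_smul {𝓗 𝓗₂ : Type*} [NormedAddCommGroup 𝓗] [InnerProductSpace ℂ 𝓗]
    [NormedAddCommGroup 𝓗₂] [InnerProductSpace ℂ 𝓗₂] (A₂ : 𝓗₂ →L[ℂ] 𝓗₂) (A : 𝓗 →L[ℂ] 𝓗) (B : 𝓗 →L[ℂ] 𝓗₂)
    (z : ℂ) (k : ℕ) :
    (ad (z • A₂) (z • A))^[k] B = z ^ k • (ad A₂ A)^[k] B := by
  induction k with
  | zero => simp
  | succ k ih =>
    rw [Function.iterate_succ_apply', ih, Function.iterate_succ_apply', ad, ad, pow_succ']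
    ext x
    simp [smul_smul, mul_comm, smul_sub]

variable {𝓗 : Type*} [NormedAddCommGroup 𝓗] [InnerProductSpace ℂ 𝓗] [CompleteSpace 𝓗]
variable {𝓗₂ : Type*} [NormedAddCommGroup 𝓗₂] [InnerProductSpace ℂ 𝓗₂] [CompleteSpace 𝓗₂]

theorem norm_conj_taylor_le {A₂ : 𝓗₂ →L[ℂ] 𝓗₂} {A : 𝓗 →L[ℂ] 𝓗} (hA₂ : IsSelfAdjoint A₂)
    (hA : IsSelfAdjoint A) (B : 𝓗 →L[ℂ] 𝓗₂) (k : ℕ) (τ : ℝ) :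
    ‖∑ j ∈ Finset.range k, (freq τ ^ j / (j.factorial : ℂ)) • (ad A₂ A)^[j] B‖ ≤
      ‖B‖ + ‖freq τ‖ ^ k / (k.factorial : ℝ) * ‖(ad A₂ A)^[k] B‖ := by
  have h0 : ‖V A₂ τ ∘L B ∘L V A (-τ)‖ ≤ ‖B‖ :=
    (norm_V_comp hA₂ τ _).trans (norm_comp_V hA _ _)
  cases k with
  | zero => simp
  | succ k =>
    have h1 := (isIncrement_conj A₂ A B).norm_sub_taylor_le hA₂ hA k τ
    rw [Finset.sum_range_succ']
    simp only [← Function.iterate_succ_apply] at h1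
    simp only [pow_zero, Nat.factorial_zero, Nat.cast_one, div_one, one_smul,
      Function.iterate_zero, id]
    set S := ∑ j ∈ Finset.range k, (freq τ ^ (j + 1) / ((j + 1).factorial : ℂ)) •
      (ad A₂ A)^[j.succ] B with hS
    have h2 : S + B = V A₂ τ ∘L B ∘L V A (-τ) - (V A₂ τ ∘L B ∘L V A (-τ) - B - S) := by abel
    rw [h2]
    exact (norm_sub_le _ _).trans (add_le_add h0 h1)

/-- The Landau–Kolmogorov inequality for commutators: an intermediate commutator is controlled by
the operator and a higher commutator. Taylor's formula bounds the polynomial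
`∑_{j<k} (iτ)^j ad^j(B) / j!` at the times `τ = 0, …, k - 1`, which determine its coefficients. -/
theorem norm_iterate_ad_le_of_lt {k : ℕ} {A₂ : 𝓗₂ →L[ℂ] 𝓗₂}
    {A : 𝓗 →L[ℂ] 𝓗} (hA₂ : IsSelfAdjoint A₂) (hA : IsSelfAdjoint A) (B : 𝓗 →L[ℂ] 𝓗₂)
    {s : ℝ} (hs : 0 < s) {i : ℕ} (hi : i < k) :
    s ^ i * ‖(ad A₂ A)^[i] B‖ ≤
      vandermondeConst k * (k.factorial * (1 + (k : ℝ) ^ k)) * (‖B‖ + s ^ k * ‖(ad A₂ A)^[k] B‖) := by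
  set D := vandermondeConst k with hDdef
  have hD : 0 ≤ D := vandermondeConst_nonneg k
  have hs2 : (0 : ℝ) ≤ s ^ k * ‖(ad A₂ A)^[k] B‖ := by positivity
  set R := ‖B‖ + s ^ k * ‖(ad A₂ A)^[k] B‖ with hR
  have hsa₂ : IsSelfAdjoint ((s : ℂ) • A₂) := by
    rw [IsSelfAdjoint, star_smul, hA₂.star_eq]
    simp
  have hsa : IsSelfAdjoint ((s : ℂ) • A) := by
    rw [IsSelfAdjoint, star_smul, hA.star_eq]
    simp
  have h2 : ∀ l : Fin k, ‖∑ j : Fin k, (I * (l : ℂ)) ^ (j : ℕ) •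
      ((j : ℕ).factorial : ℂ)⁻¹ • ((s : ℂ) ^ (j : ℕ) • (ad A₂ A)^[j] B)‖ ≤
      (1 + (k : ℝ) ^ k) * R := by
    intro l
    have h3 := norm_conj_taylor_le hsa₂ hsa B k ((l : ℝ) / (2 * Real.pi))
    have h4 : freq ((l : ℝ) / (2 * Real.pi)) = I * (l : ℂ) := by
      have : (Real.pi : ℂ) ≠ 0 := ofReal_ne_zero.mpr Real.pi_ne_zero
      rw [freq]
      push_cast
      field_simp
    rw [h4] at h3
    simp only [iterate_ad_smul] at h3
    rw [Finset.sum_range] at h3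
    simp only [div_eq_mul_inv, mul_smul _ (_⁻¹ : ℂ)] at h3
    refine h3.trans ?_
    have h5 : ‖I * (l : ℂ)‖ ^ k * (k.factorial : ℝ)⁻¹ ≤ (k : ℝ) ^ k := by
      rw [← div_eq_mul_inv]
      have : (1 : ℝ) ≤ k.factorial := mod_cast Nat.factorial_pos k
      refine (div_le_self (by positivity) this).trans ?_
      refine pow_le_pow_left₀ (norm_nonneg _) ?_ k
      rw [norm_mul, norm_I, one_mul, Complex.norm_natCast]
      exact_mod_cast l.2.le
    have h6 : ‖(s : ℂ) ^ k • (ad A₂ A)^[k] B‖ = s ^ k * ‖(ad A₂ A)^[k] B‖ := by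
      rw [norm_smul, norm_pow, Complex.norm_real, Real.norm_of_nonneg hs.le]
    rw [h6]
    have h7 := mul_le_mul_of_nonneg_right h5 hs2
    have h8 : 0 ≤ (k : ℝ) ^ k * ‖B‖ := by positivity
    rw [hR, add_mul, one_mul, mul_add]
    linarith
  have h9 := norm_coeff_le _ _ h2 ⟨i, hi⟩
  simp only [norm_smul, norm_inv, norm_pow, Complex.norm_real, Real.norm_of_nonneg hs.le,
    Complex.norm_natCast] at h9
  have hf : (0 : ℝ) < (i.factorial : ℝ) := mod_cast Nat.factorial_pos i
  have hfk : (i.factorial : ℝ) ≤ (k.factorial : ℝ) := mod_cast Nat.factorial_le hi.le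
  rw [inv_mul_le_iff₀ hf] at h9
  have hR0 : 0 ≤ R := add_nonneg (norm_nonneg _) hs2
  have h10 : 0 ≤ D * ((1 + (k : ℝ) ^ k) * R) := by positivity
  calc s ^ i * ‖(ad A₂ A)^[i] B‖ ≤ i.factorial * (D * ((1 + (k : ℝ) ^ k) * R)) := h9
    _ ≤ k.factorial * (D * ((1 + (k : ℝ) ^ k) * R)) := mul_le_mul_of_nonneg_right hfk h10
    _ = D * (k.factorial * (1 + (k : ℝ) ^ k)) * R := by ring

/-- A constant for the inequality `norm_iterate_ad_le`. -/
noncomputable def interpConst (k : ℕ) : ℝ :=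
  vandermondeConst k * (k.factorial * (1 + (k : ℝ) ^ k)) + 1

theorem interpConst_pos (k : ℕ) : 0 < interpConst k := by
  have := vandermondeConst_nonneg k
  unfold interpConst
  positivity

end Interpolation

/-! ### Truncation of a cutoff -/

section Truncation

variable {δ : ℝ} {χ : ℝ → ℝ}

theorem cutoff_eq_zero (hχ : χ ∈ cutoffs δ) {x : ℝ} (hx : x < 0) : χ x = 0 := by
  by_contra h
  exact absurd (hχ.2.1 (subset_tsupport χ h)) (by simpa using hx)

theorem deriv_cutoff_eq_zero (hχ : χ ∈ cutoffs δ) {x : ℝ} (hx : δ / 2 ≤ x) : deriv χ x = 0 := by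
  by_contra h
  exact absurd (hχ.2.2.1 (subset_tsupport _ h)).2 (by simpa using hx)

theorem cutoff_eq_const (hχ : χ ∈ cutoffs δ) {x : ℝ} (hx : δ / 2 ≤ x) : χ x = χ (δ / 2) :=
  constant_of_has_deriv_right_zero (f := χ) (a := δ / 2) (b := x) hχ.1.continuous.continuousOn
    (fun y hy => by
      have := ((hχ.1.differentiable (by simp)) y).hasDerivAt.hasDerivWithinAt (s := Set.Ici y)
      rwa [deriv_cutoff_eq_zero hχ hy.1] at this) x ⟨hx, le_rfl⟩

theorem isTest_sub_translate (hχ : χ ∈ cutoffs δ) (L : ℝ) :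
    IsTest fun x => χ x - χ (x - L) := by
  refine ⟨hχ.1.sub (hχ.1.comp (contDiff_id.sub contDiff_const)), ?_⟩
  refine HasCompactSupport.of_support_subset_isCompact
    (K := Set.Icc (-|L|) (|δ / 2| + |L|)) isCompact_Icc fun x hx => ?_
  by_contra h
  refine hx ?_
  rw [Set.mem_Icc, not_and_or, not_le, not_le] at h
  have h1 := neg_abs_le L
  have h2 := le_abs_self L
  have h3 := le_abs_self (δ / 2)
  have h4 := abs_nonneg L
  rcases h with h | h
  · simp only
    rw [cutoff_eq_zero hχ (by linarith), cutoff_eq_zero hχ (by linarith), sub_zero]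
  · simp only
    rw [cutoff_eq_const hχ (x := x) (by linarith), cutoff_eq_const hχ (x := x - L) (by linarith),
      sub_self]

theorem isTest_deriv (hχ : χ ∈ cutoffs δ) : IsTest (deriv χ) := by
  refine ⟨(contDiff_infty_iff_deriv.mp hχ.1).2, ?_⟩
  exact HasCompactSupport.of_support_subset_isCompact (K := Set.Icc 0 (δ / 2)) isCompact_Icc
    fun x hx => Set.Ioo_subset_Icc_self (hχ.2.2.1 (subset_tsupport _ hx))

theorem abs_cutoff_le (hχ : χ ∈ cutoffs δ) : ∃ M : ℝ, ∀ x, |χ x| ≤ M := by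
  obtain ⟨M, hM⟩ := (isCompact_Icc (a := (0 : ℝ)) (b := |δ / 2|)).exists_bound_of_continuousOn
    hχ.1.continuous.continuousOn
  have h0 := (norm_nonneg _).trans (hM 0 (by simp))
  refine ⟨M, fun x => ?_⟩
  rcases lt_or_ge x 0 with h | h
  · rw [cutoff_eq_zero hχ h]; simpa using h0
  rcases le_total x |δ / 2| with h' | h'
  · exact hM x ⟨h, h'⟩
  · have h3 := le_abs_self (δ / 2)
    have h4 := hM |δ / 2| ⟨abs_nonneg _, le_rfl⟩
    rw [cutoff_eq_const hχ (by linarith)] at h4 ⊢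
    exact h4

/-- Near a bounded set a cutoff agrees with a test function whose Fourier moments are bounded
independently of the set. -/
theorem exists_test_eq_cutoff (hχ : χ ∈ cutoffs δ) (N : ℝ) : ∃ ψ : ℝ → ℝ, IsTest ψ ∧
    (∀ x, |x| ≤ N → ψ =ᶠ[𝓝 x] χ) ∧
    ∀ m, ftMoment (m + 1) ψ ≤ 2 * ftMoment m (deriv χ) := by
  refine ⟨_, isTest_sub_translate hχ (N + 1), fun x hx => ?_, fun m =>
    ftMoment_sub_translate_le hχ.1 (isTest_deriv hχ) _ (isTest_sub_translate hχ _) m⟩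
  have h1 : ∀ᶠ y in 𝓝 x, y < N + 1 :=
    eventually_lt_nhds (((le_abs_self x).trans hx).trans_lt (lt_add_one N))
  filter_upwards [h1] with y hy
  rw [cutoff_eq_zero hχ (x := y - (N + 1)) (by linarith), sub_zero]

end Truncation

/-! ### Quadratic form estimates for bounded operators -/

section Forms

variable {𝓗 : Type*} [NormedAddCommGroup 𝓗] [InnerProductSpace ℂ 𝓗] [CompleteSpace 𝓗]
variable {𝓗₂ : Type*} [NormedAddCommGroup 𝓗₂] [InnerProductSpace ℂ 𝓗₂] [CompleteSpace 𝓗₂]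

theorem norm_iterate_ad_le {A₂ : 𝓗₂ →L[ℂ] 𝓗₂} {A : 𝓗 →L[ℂ] 𝓗} (hA₂ : IsSelfAdjoint A₂)
    (hA : IsSelfAdjoint A) (B : 𝓗 →L[ℂ] 𝓗₂) {s : ℝ} (hs : 0 < s) {i k : ℕ} (hi : i ≤ k) :
    s ^ i * ‖(ad A₂ A)^[i] B‖ ≤ interpConst k * (‖B‖ + s ^ k * ‖(ad A₂ A)^[k] B‖) := by
  have h0 : 0 ≤ vandermondeConst k * (k.factorial * (1 + (k : ℝ) ^ k)) :=
    mul_nonneg (vandermondeConst_nonneg k) (by positivity)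
  have h1 : 0 ≤ s ^ k * ‖(ad A₂ A)^[k] B‖ := by positivity
  have h2 := norm_nonneg B
  have h3 := mul_nonneg h0 (add_nonneg h2 h1)
  rw [interpConst, add_mul, one_mul]
  rcases hi.eq_or_lt with rfl | hi
  · linarith
  · linarith [norm_iterate_ad_le_of_lt hA₂ hA B hs hi]

theorem norm_iterate_ad_mul_le {A₂ : 𝓗₂ →L[ℂ] 𝓗₂} {A : 𝓗 →L[ℂ] 𝓗} (hA₂ : IsSelfAdjoint A₂)
    (hA : IsSelfAdjoint A) (B : 𝓗 →L[ℂ] 𝓗₂) {s μ : ℝ} (hs : 0 < s) {k : ℕ} (h0 : ‖B‖ ^ 2 ≤ μ)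
    (hk : (s ^ k * ‖(ad A₂ A)^[k] B‖) ^ 2 ≤ μ) {i j : ℕ} (hij : i + j = k) :
    ‖(ad A₂ A)^[i] B‖ * ‖(ad A₂ A)^[j] B‖ ≤ 4 * interpConst k ^ 2 * (μ / s ^ k) := by
  have hD := interpConst_pos k
  have h1 : ∀ i ≤ k, s ^ i * ‖(ad A₂ A)^[i] B‖ ≤ interpConst k * (2 * √μ) := fun i hi => by
    refine (norm_iterate_ad_le hA₂ hA B hs hi).trans (mul_le_mul_of_nonneg_left ?_ hD.le)
    linarith [Real.le_sqrt_of_sq_le h0, Real.le_sqrt_of_sq_le hk]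
  have hμ : 0 ≤ μ := (sq_nonneg _).trans h0
  have h2 := mul_le_mul (h1 i (by omega)) (h1 j (by omega)) (by positivity) (by positivity)
  have h3 : interpConst k * (2 * √μ) * (interpConst k * (2 * √μ)) =
      4 * interpConst k ^ 2 * μ := by
    have := Real.mul_self_sqrt hμ
    linear_combination 4 * interpConst k ^ 2 * this
  rw [h3] at h2
  rw [mul_div_assoc', le_div_iff₀ (by positivity), ← hij, pow_add]
  refine le_trans (le_of_eq ?_) (hij ▸ h2)
  ring

theorem isSelfAdjoint_cfc (f : ℝ → ℝ) (A : 𝓗 →L[ℂ] 𝓗) : IsSelfAdjoint (cfc f A) :=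
  cfc_predicate f A

theorem inner_cfc_left (f : ℝ → ℝ) (A : 𝓗 →L[ℂ] 𝓗) (x y : 𝓗) :
    ⟪cfc f A x, y⟫_ℂ = ⟪x, cfc f A y⟫_ℂ :=
  (isSelfAdjoint_cfc f A).isSymmetric x y

theorem norm_cfc_apply_le_of_plateau {f g : ℝ → ℝ} (hf : IsTest f) (hg : IsTest g)
    (hfg : IsPlateau g f) (A : 𝓗 →L[ℂ] 𝓗) (x : 𝓗) : ‖cfc f A x‖ ≤ supNorm f * ‖cfc g A x‖ := by
  rw [← cfc_comp_cfc hf.continuous hg.continuous A hfg.mul_eq, ContinuousLinearMap.comp_apply]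
  exact (cfc f A).le_of_opNorm_le (norm_cfc_le_supNorm hf A) _

theorem CutoffData.norm_inner_incr_add_le {χ u g : ℝ → ℝ} (h : CutoffData χ u g)
    {A : 𝓗 →L[ℂ] 𝓗} (hA : IsSelfAdjoint A) {C : 𝓗 →L[ℂ] 𝓗} {Y : ℝ → 𝓗 →L[ℂ] 𝓗}
    (hY : IsIncrement A A C Y) {ψ : ℝ → ℝ} (hψ : IsTest ψ)
    (hψχ : ∀ x ∈ spectrum ℝ A, ψ =ᶠ[𝓝 x] χ) (p : ℕ)
    (hm : ftMoment (p + 2) ψ ≤ 2 * ftMoment (p + 1) (deriv χ)) {ν : ℕ → ℝ}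
    (hν : ∀ k ≤ p, ‖(ad A A)^[k + 1] C‖ ≤ ν k) (φ : 𝓗) :
    ‖⟪φ, (incr A ψ Y + cfc u A ∘L C ∘L cfc u A) φ⟫_ℂ‖ ≤
      ∑ k ∈ Finset.range p, ν k * (supNorm (symCoeff χ u k) * ‖cfc g A φ‖ ^ 2) +
        symConst χ u g p * ν p * ‖φ‖ ^ 2 := by
  have h1 := h.norm_incr_add_le hA hA hY hψ hψχ p hm
  set T := ∑ k ∈ Finset.range p, cfc (symCoeff χ u k) A ∘L (ad A A)^[k + 1] C ∘L cfc g A with hT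
  set X := incr A ψ Y + cfc u A ∘L C ∘L cfc u A
  have e1 : ⟪φ, X φ⟫_ℂ = ⟪φ, T φ⟫_ℂ + ⟪φ, (X - T) φ⟫_ℂ := by
    rw [← inner_add_right, sub_apply, add_sub_cancel]
  have e2 : ‖⟪φ, (X - T) φ⟫_ℂ‖ ≤ symConst χ u g p * ν p * ‖φ‖ ^ 2 := by
    have h2 := (X - T).le_of_opNorm_le (h1.trans
      (mul_le_mul_of_nonneg_left (hν p le_rfl) (symConst_nonneg χ u g p))) φ
    calc _ ≤ ‖φ‖ * ‖(X - T) φ‖ := norm_inner_le_norm _ _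
      _ ≤ ‖φ‖ * (symConst χ u g p * ν p * ‖φ‖) := by gcongr
      _ = _ := by ring
  have e3 : ‖⟪φ, T φ⟫_ℂ‖ ≤
      ∑ k ∈ Finset.range p, ν k * (supNorm (symCoeff χ u k) * ‖cfc g A φ‖ ^ 2) := by
    rw [hT, sum_apply, inner_sum]
    refine norm_sum_le_of_le _ fun k hk => ?_
    have hk' := Finset.mem_range.mp hk
    rw [ContinuousLinearMap.comp_apply, ContinuousLinearMap.comp_apply, ← inner_cfc_left]
    have h3 := norm_cfc_apply_le_of_plateau (h.symCoeff_test k) h.g_test (h.symCoeff_plateau k) A φ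
    have h4 := ((ad A A)^[k + 1] C).le_of_opNorm_le (hν k hk'.le) (cfc g A φ)
    calc _ ≤ _ := norm_inner_le_norm _ _
      _ ≤ (supNorm (symCoeff χ u k) * ‖cfc g A φ‖) * (ν k * ‖cfc g A φ‖) :=
        mul_le_mul h3 h4 (norm_nonneg _) (mul_nonneg (supNorm_nonneg _) (norm_nonneg _))
      _ = _ := by ring
  rw [e1]
  exact (norm_add_le _ _).trans (add_le_add e3 e2)

/-- The weight of the localized error of order `k + 2` for the jump part. -/
noncomputable def jumpWeight (χ u : ℝ → ℝ) (k : ℕ) : ℝ :=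
  4 * interpConst (k + 2) ^ 2 *
    (supNorm (symCoeff χ u k) + supNorm (taylorCoeff u k) * supNorm u)

/-- The constant of the unlocalized error for the jump part. -/
noncomputable def jumpConst (χ u g : ℝ → ℝ) (p : ℕ) : ℝ :=
  4 * interpConst (p + 2) ^ 2 *
    (symConst χ u g p + locConst (symCoeff χ u) g p * supNorm g + incrConst u g p * supNorm u)

/-- The form `⟨Wφ, [χ(A), W]φ⟩` is compared with `⟨W u(A) φ, [A, W] u(A) φ⟩`, where `u² = χ'`. Since
`W` is not localized, `u(A)` has to be moved through it, which produces products of commutators of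
intermediate orders; these are controlled by interpolation. -/
theorem CutoffData.norm_inner_commutator_sub_le {χ u g : ℝ → ℝ} (h : CutoffData χ u g)
    {A₂ : 𝓗₂ →L[ℂ] 𝓗₂} {A : 𝓗 →L[ℂ] 𝓗} (hA₂ : IsSelfAdjoint A₂) (hA : IsSelfAdjoint A)
    (W : 𝓗 →L[ℂ] 𝓗₂) {ψ : ℝ → ℝ} (hψ : IsTest ψ) (hψχ₂ : ∀ x ∈ spectrum ℝ A₂, ψ =ᶠ[𝓝 x] χ)
    (hψχ : ∀ x ∈ spectrum ℝ A, ψ =ᶠ[𝓝 x] χ) (p : ℕ)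
    (hm : ftMoment (p + 2) ψ ≤ 2 * ftMoment (p + 1) (deriv χ)) {s : ℝ} (hs : 0 < s) {μ : ℕ → ℝ}
    (hμ₀ : ∀ k ≤ p, ‖W‖ ^ 2 ≤ μ k)
    (hμ : ∀ k ≤ p, (s ^ (k + 2) * ‖(ad A₂ A)^[k + 2] W‖) ^ 2 ≤ μ k) (φ : 𝓗) :
    ‖⟪W φ, cfc χ A₂ (W φ) - W (cfc χ A φ)⟫_ℂ -
        ⟪W (cfc u A φ), ad A₂ A W (cfc u A φ)⟫_ℂ‖ ≤
      ∑ k ∈ Finset.range p, μ k / s ^ (k + 2) * (jumpWeight χ u k * ‖cfc g A φ‖ ^ 2) +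
        jumpConst χ u g p * (μ p / s ^ (p + 2)) * ‖φ‖ ^ 2 := by
  set N : ℕ → ℝ := fun i => ‖(ad A₂ A)^[i] W‖ with hN
  have hN0 : ∀ i, 0 ≤ N i := fun i => norm_nonneg _
  set Q : ℕ → ℝ := fun k => 4 * interpConst (k + 2) ^ 2 * (μ k / s ^ (k + 2)) with hQ
  -- products of commutators of total order `k + 2` count as one commutator of that order
  have hprod : ∀ k ≤ p, ∀ i j, i + j = k + 2 → N i * N j ≤ Q k := fun k hk i j hij =>
    norm_iterate_ad_mul_le hA₂ hA W hs (hμ₀ k hk) (hμ k hk) hij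
  have hNle : ∀ i x, ‖(ad A₂ A)^[i] W x‖ ≤ N i * ‖x‖ := fun i x =>
    ((ad A₂ A)^[i] W).le_opNorm x
  set y := cfc g A φ with hy
  have hyφ : ‖y‖ ≤ supNorm g * ‖φ‖ :=
    (cfc g A).le_of_opNorm_le (norm_cfc_le_supNorm h.g_test A) φ
  have huy : ‖cfc u A φ‖ ≤ supNorm u * ‖y‖ :=
    norm_cfc_apply_le_of_plateau h.u_test h.g_test h.plateau_u A φ
  have huφ : ‖cfc u A φ‖ ≤ supNorm u * ‖φ‖ :=
    (cfc u A).le_of_opNorm_le (norm_cfc_le_supNorm h.u_test A) φ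
  -- the expansions of the commutators with `χ` and with `u`
  have hY := isIncrement_conj A₂ A W
  have h1 := h.norm_incr_add_le hA₂ hA hY hψ hψχ₂ p hm
  have hc₂ : cfc ψ A₂ = cfc χ A₂ := cfc_congr fun x hx => (hψχ₂ x hx).self_of_nhds
  have hc : cfc ψ A = cfc χ A := cfc_congr fun x hx => (hψχ x hx).self_of_nhds
  rw [incr_conj hψ hA₂ hA, hc₂, hc] at h1
  have h2 := norm_incr_sub_localized_le h.u_test h.g_test h.plateau_u hA₂ hA hY p
  rw [incr_conj h.u_test hA₂ hA] at h2
  simp only [← Function.iterate_succ_apply] at h1 h2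
  set T := ∑ k ∈ Finset.range p,
    cfc (symCoeff χ u k) A₂ ∘L (ad A₂ A)^[(k + 1).succ] W ∘L cfc g A with hT
  set T' := ∑ k ∈ Finset.range p,
    cfc (taylorCoeff u k) A₂ ∘L (ad A₂ A)^[k.succ] W ∘L cfc g A with hT'
  set X := W ∘L cfc χ A - cfc χ A₂ ∘L W + cfc u A₂ ∘L ad A₂ A W ∘L cfc u A - T with hX
  set Z := W ∘L cfc u A - cfc u A₂ ∘L W - T' with hZ
  have e0 : ⟪W φ, cfc χ A₂ (W φ) - W (cfc χ A φ)⟫_ℂ -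
        ⟪W (cfc u A φ), ad A₂ A W (cfc u A φ)⟫_ℂ =
      -(⟪W φ, T φ⟫_ℂ + ⟪W φ, X φ⟫_ℂ + (⟪T' φ, ad A₂ A W (cfc u A φ)⟫_ℂ +
        ⟪Z φ, ad A₂ A W (cfc u A φ)⟫_ℂ)) := by
    have a1 : X φ = W (cfc χ A φ) - cfc χ A₂ (W φ) + cfc u A₂ (ad A₂ A W (cfc u A φ)) - T φ := rfl
    have a2 : Z φ = W (cfc u A φ) - cfc u A₂ (W φ) - T' φ := rfl
    rw [a1, a2]
    simp only [inner_sub_right, inner_add_right, inner_sub_left, inner_cfc_left]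
    ring
  -- the localized terms and the error of the expansion of the commutator with `χ`
  have b1 : ‖⟪W φ, T φ⟫_ℂ‖ ≤ ∑ k ∈ Finset.range p, Q k * (supNorm (symCoeff χ u k) * ‖y‖ ^ 2) +
      Q p * (locConst (symCoeff χ u) g p * supNorm g * ‖φ‖ ^ 2) := by
    have c1 : ∀ k ∈ Finset.range p,
        ‖⟪W φ, (cfc (symCoeff χ u k) A₂ ∘L (ad A₂ A)^[(k + 1).succ] W ∘L cfc g A) φ⟫_ℂ‖ ≤
        Q k * (supNorm (symCoeff χ u k) * ‖y‖ ^ 2) + Q p * (supNorm (symCoeff χ u k) *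
          (ftMoment (p - k) g / ((p - k).factorial : ℝ)) * supNorm g * ‖φ‖ ^ 2) := by
      intro k hk
      have hk' := Finset.mem_range.mp hk
      set σ := supNorm (symCoeff χ u k)
      have hσ : 0 ≤ σ := supNorm_nonneg _
      set κ := ftMoment (p - k) g / ((p - k).factorial : ℝ)
      have hκ : 0 ≤ κ := div_nonneg (ftMoment_nonneg _ _) (Nat.cast_nonneg _)
      have hg0 := supNorm_nonneg g
      have d1 := norm_sub_comp_plateau_le (h.symCoeff_test k) h.g_test (h.symCoeff_plateau k)
        hA₂ hA W (m := p - k) (by omega)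
      have d2 : ‖cfc (symCoeff χ u k) A₂ (W φ)‖ ≤ σ * (N 0 * ‖y‖) + σ * κ * N (p - k) * ‖φ‖ := by
        have d3 : cfc (symCoeff χ u k) A₂ (W φ) = cfc (symCoeff χ u k) A₂ (W y) +
            (cfc (symCoeff χ u k) A₂ ∘L W - cfc (symCoeff χ u k) A₂ ∘L W ∘L cfc g A) φ := by
          simp [hy]
        rw [d3]
        refine (norm_add_le _ _).trans (add_le_add ?_ ?_)
        · exact ((cfc (symCoeff χ u k) A₂).le_of_opNorm_le
            (norm_cfc_le_supNorm (h.symCoeff_test k) A₂) _).trans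
            (mul_le_mul_of_nonneg_left (hNle 0 y) hσ)
        · exact ContinuousLinearMap.le_of_opNorm_le _ d1 φ
      rw [ContinuousLinearMap.comp_apply, ContinuousLinearMap.comp_apply, ← inner_cfc_left]
      have d4 := hNle (k + 2) y
      have d5 := hprod k hk'.le 0 (k + 2) (by omega)
      have d6 := hprod p le_rfl (p - k) (k + 2) (by omega)
      calc _ ≤ ‖cfc (symCoeff χ u k) A₂ (W φ)‖ * ‖(ad A₂ A)^[k + 2] W y‖ := norm_inner_le_norm _ _
        _ ≤ (σ * (N 0 * ‖y‖) + σ * κ * N (p - k) * ‖φ‖) * (N (k + 2) * ‖y‖) := by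
          have := hN0 0
          have := hN0 (p - k)
          gcongr
        _ = N 0 * N (k + 2) * (σ * ‖y‖ ^ 2) +
            N (p - k) * N (k + 2) * (σ * κ * ‖φ‖ * ‖y‖) := by ring
        _ ≤ Q k * (σ * ‖y‖ ^ 2) + Q p * (σ * κ * ‖φ‖ * (supNorm g * ‖φ‖)) := by
          refine add_le_add (mul_le_mul_of_nonneg_right d5 (by positivity)) ?_
          refine mul_le_mul d6 ?_ (by positivity) ?_
          · gcongr
          · exact (mul_nonneg (hN0 _) (hN0 _)).trans d6
        _ = _ := by ring
    rw [hT, sum_apply, inner_sum]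
    refine (norm_sum_le_of_le _ c1).trans_eq ?_
    rw [Finset.sum_add_distrib, locConst]
    simp only [Finset.sum_mul, Finset.mul_sum]
  have b2 : ‖⟪W φ, X φ⟫_ℂ‖ ≤ Q p * (symConst χ u g p * ‖φ‖ ^ 2) := by
    have d1 := X.le_of_opNorm_le h1 φ
    have d2 := hNle 0 φ
    have d5 := hprod p le_rfl 0 (p + 2) (by omega)
    have := symConst_nonneg χ u g p
    calc _ ≤ ‖W φ‖ * ‖X φ‖ := norm_inner_le_norm _ _
      _ ≤ (N 0 * ‖φ‖) * (symConst χ u g p * N (p + 2) * ‖φ‖) :=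
        mul_le_mul d2 d1 (norm_nonneg _) (mul_nonneg (hN0 _) (norm_nonneg _))
      _ = N 0 * N (p + 2) * (symConst χ u g p * ‖φ‖ ^ 2) := by ring
      _ ≤ _ := mul_le_mul_of_nonneg_right d5 (by positivity)
  -- the contribution of the commutator of `W` with `u`
  have b3 : ‖⟪T' φ, ad A₂ A W (cfc u A φ)⟫_ℂ‖ ≤
      ∑ k ∈ Finset.range p, Q k * (supNorm (taylorCoeff u k) * supNorm u * ‖y‖ ^ 2) := by
    rw [hT', sum_apply, sum_inner]
    refine norm_sum_le_of_le _ fun k hk => ?_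
    have hk' := Finset.mem_range.mp hk
    have hσ : 0 ≤ supNorm (taylorCoeff u k) := supNorm_nonneg _
    have hu : 0 ≤ supNorm u := supNorm_nonneg _
    rw [ContinuousLinearMap.comp_apply, ContinuousLinearMap.comp_apply]
    have d1 := (cfc (taylorCoeff u k) A₂).le_of_opNorm_le
      (norm_cfc_le_supNorm (h.u_test.taylorCoeff k) A₂) ((ad A₂ A)^[k.succ] W y)
    have d2 := hNle (k + 1) y
    have d3 := hNle 1 (cfc u A φ)
    have d5 := hprod k hk'.le (k + 1) 1 (by omega)
    calc _ ≤ _ := norm_inner_le_norm _ _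
      _ ≤ (supNorm (taylorCoeff u k) * (N (k + 1) * ‖y‖)) * (N 1 * (supNorm u * ‖y‖)) := by
        refine mul_le_mul (d1.trans (mul_le_mul_of_nonneg_left d2 hσ))
          (d3.trans (mul_le_mul_of_nonneg_left huy (hN0 1))) (norm_nonneg _) ?_
        exact mul_nonneg hσ (mul_nonneg (hN0 _) (norm_nonneg _))
      _ = N (k + 1) * N 1 * (supNorm (taylorCoeff u k) * supNorm u * ‖y‖ ^ 2) := by ring
      _ ≤ _ := mul_le_mul_of_nonneg_right d5 (by positivity)
  have b4 : ‖⟪Z φ, ad A₂ A W (cfc u A φ)⟫_ℂ‖ ≤ Q p * (incrConst u g p * supNorm u * ‖φ‖ ^ 2) := by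
    have d1 := Z.le_of_opNorm_le h2 φ
    have d3 := hNle 1 (cfc u A φ)
    have d5 := hprod p le_rfl (p + 1) 1 (by omega)
    have hi := incrConst_nonneg u g p
    have hu : 0 ≤ supNorm u := supNorm_nonneg _
    calc _ ≤ _ := norm_inner_le_norm _ _
      _ ≤ (incrConst u g p * N (p + 1) * ‖φ‖) * (N 1 * (supNorm u * ‖φ‖)) := by
        refine mul_le_mul d1 (d3.trans (mul_le_mul_of_nonneg_left huφ (hN0 1))) (norm_nonneg _) ?_
        exact mul_nonneg (mul_nonneg hi (hN0 _)) (norm_nonneg _)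
      _ = N (p + 1) * N 1 * (incrConst u g p * supNorm u * ‖φ‖ ^ 2) := by ring
      _ ≤ _ := mul_le_mul_of_nonneg_right d5 (by positivity)
  rw [e0, norm_neg]
  refine ((norm_add_le _ _).trans (add_le_add (norm_add_le _ _) (norm_add_le _ _))).trans ?_
  refine (add_le_add (add_le_add b1 b2) (add_le_add b3 b4)).trans_eq ?_
  have f1 : ∑ k ∈ Finset.range p, μ k / s ^ (k + 2) * (jumpWeight χ u k * ‖y‖ ^ 2) =
      ∑ k ∈ Finset.range p, Q k * (supNorm (symCoeff χ u k) * ‖y‖ ^ 2) +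
      ∑ k ∈ Finset.range p, Q k * (supNorm (taylorCoeff u k) * supNorm u * ‖y‖ ^ 2) := by
    rw [← Finset.sum_add_distrib]
    refine Finset.sum_congr rfl fun k _ => ?_
    rw [hQ, jumpWeight]
    ring
  rw [f1, jumpConst, hQ]
  ring

end Forms

/-! ### Commutators of an unbounded self-adjoint operator with functions of a bounded one -/

section DomainCommutator

variable {𝓗 : Type*} [NormedAddCommGroup 𝓗] [InnerProductSpace ℂ 𝓗] [CompleteSpace 𝓗]

/-- For a self-adjoint operator, a commutator which is bounded in the form sense is bounded in the
operator sense. -/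
theorem IsBddCommutator.isDomainCommutator {H : 𝓗 →ₗ.[ℂ] 𝓗} (hH : IsSelfAdjoint H)
    {X K : 𝓗 →L[ℂ] 𝓗} (h : IsBddCommutator H X K) : IsDomainCommutator H X K := by
  intro u
  obtain ⟨w, hw, hw'⟩ := exists_of_adjoint hH (w := X u) (z := X (H u) + K u) fun v => by
    have := congrArg (starRingEnd ℂ) (h v u)
    rw [map_sub, inner_conj_symm, inner_conj_symm, inner_conj_symm] at this
    rw [inner_add_left, ← this]
    ring
  refine ⟨hw ▸ w.2, ?_⟩
  have : H ⟨X u, hw ▸ w.2⟩ = H w := by congr 1; exact Subtype.ext hw.symm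
  rw [this, hw', add_sub_cancel_left]

theorem IsDomainCommutator.isBddCommutator {H : 𝓗 →ₗ.[ℂ] 𝓗} (hH : IsSelfAdjoint H)
    {X K : 𝓗 →L[ℂ] 𝓗} (h : IsDomainCommutator H X K) : IsBddCommutator H X K := by
  intro u v
  obtain ⟨hv, hK⟩ := h v
  rw [hK, inner_sub_right, inner_symm hH u ⟨X v, hv⟩]

theorem exp_intertwine {E F : Type*} [NormedAddCommGroup E] [NormedSpace ℂ E] [CompleteSpace E]
    [NormedAddCommGroup F] [NormedSpace ℂ F] [CompleteSpace F] {X : E →L[ℂ] E} {Y : F →L[ℂ] F}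
    {T : E →L[ℂ] F} (h : T ∘L X = Y ∘L T) :
    T ∘L NormedSpace.exp X = NormedSpace.exp Y ∘L T := by
  have hn : ∀ n : ℕ, T ∘L (X ^ n) = (Y ^ n) ∘L T := by
    intro n
    induction n with
    | zero => rfl
    | succ n ih =>
      rw [pow_succ, pow_succ, ContinuousLinearMap.mul_def, ← ContinuousLinearMap.comp_assoc, ih,
        ContinuousLinearMap.comp_assoc, h]
      rfl
  have h1 := (NormedSpace.exp_series_hasSum_exp' (𝕂 := ℂ) X).mapL
    (ContinuousLinearMap.compL ℂ E E F T)
  have h2 := (NormedSpace.exp_series_hasSum_exp' (𝕂 := ℂ) Y).mapL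
    ((ContinuousLinearMap.compL ℂ E F F).flip T)
  simp only [ContinuousLinearMap.compL_apply, ContinuousLinearMap.flip_apply,
    ContinuousLinearMap.comp_smul, ContinuousLinearMap.smul_comp, hn] at h1 h2
  exact h1.unique h2

theorem exp_apply_mem {E : Type*} [NormedAddCommGroup E] [NormedSpace ℂ E] [CompleteSpace E]
    {X : E →L[ℂ] E} {G : Submodule ℂ E} (hG : IsClosed (G : Set E)) (h : ∀ x ∈ G, X x ∈ G) {x : E}
    (hx : x ∈ G) : NormedSpace.exp X x ∈ G := by
  have hn : ∀ n : ℕ, (X ^ n) x ∈ G := by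
    intro n
    induction n with
    | zero => exact hx
    | succ n ih => rw [pow_succ']; exact h _ ih
  have h1 := (NormedSpace.exp_series_hasSum_exp' (𝕂 := ℂ) X).mapL
    (ContinuousLinearMap.apply ℂ E x)
  refine hG.mem_of_tendsto h1 (Eventually.of_forall fun s => G.sum_mem fun n _ => ?_)
  exact G.smul_mem _ (hn n)

/-- The exponential of the matrix `(A, 0; K, A)` is `(e^{zA}, 0; κ(z), e^{zA})` with
`κ' = A κ + K e^{zA}`, and it preserves the closed invariant subspaces of the matrix. -/
theorem exists_exp_lower_triangular {E : Type*} [NormedAddCommGroup E] [NormedSpace ℂ E]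
    [CompleteSpace E] (A K : E →L[ℂ] E) : ∃ κ : ℂ → E →L[ℂ] E, κ 0 = 0 ∧
      (∀ z, HasDerivAt κ (A ∘L κ z + K ∘L NormedSpace.exp (z • A)) z) ∧
      ∀ G : Submodule ℂ (E × E), IsClosed (G : Set (E × E)) →
        (∀ x ∈ G, (A x.1, K x.1 + A x.2) ∈ G) → ∀ (z : ℂ), ∀ x ∈ G,
          (NormedSpace.exp (z • A) x.1, κ z x.1 + NormedSpace.exp (z • A) x.2) ∈ G := by
  obtain ⟨M, hM⟩ : ∃ M : E × E →L[ℂ] E × E, ∀ x, M x = (A x.1, K x.1 + A x.2) :=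
    ⟨(A ∘L .fst ℂ E E).prod (K ∘L .fst ℂ E E + A ∘L .snd ℂ E E), fun x => rfl⟩
  have hfst : ∀ z : ℂ, ContinuousLinearMap.fst ℂ E E ∘L NormedSpace.exp (z • M) =
      NormedSpace.exp (z • A) ∘L ContinuousLinearMap.fst ℂ E E := fun z =>
    exp_intertwine (by ext <;> simp [hM])
  have hinr : ∀ z : ℂ, ContinuousLinearMap.inr ℂ E E ∘L NormedSpace.exp (z • A) =
      NormedSpace.exp (z • M) ∘L ContinuousLinearMap.inr ℂ E E := fun z =>
    exp_intertwine (by ext <;> simp [hM])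
  let κ : ℂ → E →L[ℂ] E := fun z =>
    ContinuousLinearMap.snd ℂ E E ∘L NormedSpace.exp (z • M) ∘L ContinuousLinearMap.inl ℂ E E
  refine ⟨κ, ?_, fun z => ?_, fun G hG hGM z x hx => ?_⟩
  · ext x
    simp [κ, NormedSpace.exp_zero]
  · have e1 := hasDerivAt_exp_smul_const' (𝕂 := ℂ) M z
    have e2 := (hasDerivAt_const z (ContinuousLinearMap.snd ℂ E E)).clm_comp
      (e1.clm_comp (hasDerivAt_const z (ContinuousLinearMap.inl ℂ E E)))
    refine e2.congr_deriv ?_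
    ext x
    have h3 := congrArg (fun T : E × E →L[ℂ] E => T (x, 0)) (hfst z)
    simp only [ContinuousLinearMap.comp_apply, ContinuousLinearMap.coe_fst'] at h3
    simp [hM, κ, h3, add_comm]
  · have h1 : NormedSpace.exp (z • M) x ∈ G :=
      exp_apply_mem hG (fun y hy => G.smul_mem z (hM y ▸ hGM y hy)) hx
    have h2 : NormedSpace.exp (z • M) x =
        (NormedSpace.exp (z • A) x.1, κ z x.1 + NormedSpace.exp (z • A) x.2) := by
      refine Prod.ext (congrArg (fun T : E × E →L[ℂ] E => T x) (hfst z)) ?_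
      have e2 : x = ContinuousLinearMap.inl ℂ E E x.1 + ContinuousLinearMap.inr ℂ E E x.2 := by
        simp
      have e3 := congrArg (fun T : E →L[ℂ] E × E => (T x.2).2) (hinr z)
      simp only [ContinuousLinearMap.comp_apply, ContinuousLinearMap.inr_apply] at e3
      conv_lhs => rw [e2, map_add]
      rw [ContinuousLinearMap.inr_apply, Prod.snd_add, ← e3]
      rfl
    rwa [← h2]

/-- If `A` is bounded and `[H, A]` is bounded, then `e^{2πiτA}` preserves `D(H)`, and its commutator
with `H` is given by the increment of the interaction picture. The reason is that the graph of `H`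
is invariant under the matrix `(A, 0; [H, A], A)`. -/
theorem IsDomainCommutator.exists_increment {H : 𝓗 →ₗ.[ℂ] 𝓗} (hH : IsSelfAdjoint H)
    {A K : 𝓗 →L[ℂ] 𝓗} (h : IsDomainCommutator H A K) : ∃ Y : ℝ → 𝓗 →L[ℂ] 𝓗,
    IsIncrement A A (-K) Y ∧ ∀ τ, IsDomainCommutator H (V A τ) (V A τ ∘L Y (-τ)) := by
  obtain ⟨κ, hκ0, hκ, hG⟩ := exists_exp_lower_triangular A K
  have hgraph := hG H.graph hH.isClosed (fun x hx => by
    obtain ⟨u, hu1, hu2⟩ := (LinearPMap.mem_graph_iff H).mp hx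
    obtain ⟨hm, hK⟩ := h u
    refine (LinearPMap.mem_graph_iff H).mpr ⟨⟨A u, hm⟩, by simp [hu1], ?_⟩
    rw [← hu1, ← hu2, hK]
    simp)
  have hY : ∀ z : ℂ, HasDerivAt (fun z => NormedSpace.exp (z • A) ∘L κ (-z))
      (NormedSpace.exp (z • A) ∘L (-K) ∘L NormedSpace.exp (-z • A)) z := by
    intro z
    have e1 := hasDerivAt_exp_smul_const (𝕂 := ℂ) A z
    have e2 := (hκ (-z)).scomp z (hasDerivAt_neg z)
    refine (e1.clm_comp e2).congr_deriv ?_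
    ext x
    simp
  refine ⟨fun τ => V A τ ∘L κ (freq (-τ)), ⟨?_, fun τ => ?_⟩, fun τ u => ?_⟩
  · simp [freq, hκ0]
  · have e1 := (hY (freq τ)).scomp τ (hasDerivAt_freq τ)
    have e2 : (fun τ => V A τ ∘L κ (freq (-τ))) =
        (fun z => NormedSpace.exp (z • A) ∘L κ (-z)) ∘ freq := by
      funext σ
      simp [V, freq_neg]
    rw [e2]
    refine e1.congr_deriv ?_
    simp [V, freq_neg]
  · have e1 : V A τ ∘L V A (-τ) ∘L κ (freq (- -τ)) = κ (freq τ) := by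
      rw [← ContinuousLinearMap.comp_assoc, neg_neg]
      have := V_mul_neg A τ
      rw [ContinuousLinearMap.mul_def] at this
      rw [this]
      rfl
    obtain ⟨w, hw1, hw2⟩ := (LinearPMap.mem_graph_iff H).mp
      (hgraph (freq τ) ((u : 𝓗), H u) (H.mem_graph u))
    have e3 : (w : 𝓗) = V A τ u := hw1
    have e4 : H w = κ (freq τ) u + V A τ (H u) := hw2
    refine ⟨e3 ▸ w.2, ?_⟩
    have e5 : H ⟨V A τ u, e3 ▸ w.2⟩ = H w := by congr 1; exact Subtype.ext e3.symm
    rw [e1, e5, e4, add_sub_cancel_right]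

/-- The commutator of `H` with `f(A) = ∫ f̂(τ) e^{2πiτA} dτ` is obtained by integrating those of `H`
with `e^{2πiτA}`. -/
theorem isDomainCommutator_incr {H : 𝓗 →ₗ.[ℂ] 𝓗} (hH : IsSelfAdjoint H) {A C : 𝓗 →L[ℂ] 𝓗}
    (hA : IsSelfAdjoint A) {Y : ℝ → 𝓗 →L[ℂ] 𝓗} (hY : IsIncrement A A C Y)
    (hYH : ∀ τ, IsDomainCommutator H (V A τ) (V A τ ∘L Y (-τ))) {f : ℝ → ℝ} (hf : IsTest f) :
    IsDomainCommutator H (cfc f A) (incr A f Y) := by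
  refine IsBddCommutator.isDomainCommutator hH fun u v => ?_
  have i1 := integrable_ft_smul_V hf hA
  have i2 := integrable_incr hf hA hA hY
  have j1 : ∀ x : 𝓗, Integrable fun τ => (ft f τ • V A τ) x := fun x =>
    (ContinuousLinearMap.apply ℂ 𝓗 x).integrable_comp i1
  have j2 : Integrable fun τ => (ft f τ • (V A τ ∘L Y (-τ))) (v : 𝓗) :=
    (ContinuousLinearMap.apply ℂ 𝓗 (v : 𝓗)).integrable_comp i2
  rw [cfc_eq_integral hf hA, incr, ContinuousLinearMap.integral_apply i1,
    ContinuousLinearMap.integral_apply i1, ContinuousLinearMap.integral_apply i2,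
    ← integral_inner (j1 _), ← integral_inner (j1 _), ← integral_inner j2,
    ← integral_sub ((j1 _).const_inner _) ((j1 _).const_inner _)]
  refine integral_congr_ae (Eventually.of_forall fun τ => ?_)
  have := (hYH τ).isBddCommutator hH u v
  simp only [smul_apply, inner_smul_right]
  rw [← this]
  ring

end DomainCommutator

/-! ### Resolvents -/

section Resolvent

variable {𝓗 : Type*} [NormedAddCommGroup 𝓗] [InnerProductSpace ℂ 𝓗]

/-- `J` is the resolvent `(Φ - z)⁻¹`. -/
structure IsResolvent (Φ : 𝓗 →ₗ.[ℂ] 𝓗) (z : ℂ) (J : 𝓗 →L[ℂ] 𝓗) : Prop where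
  left : ∀ u : Φ.domain, J (Φ u - z • (u : 𝓗)) = u
  right : ∀ x : 𝓗, ∃ u : Φ.domain, (u : 𝓗) = J x ∧ Φ u - z • (u : 𝓗) = x

/-- The first resolvent identity. -/
theorem IsResolvent.sub_eq {Φ : 𝓗 →ₗ.[ℂ] 𝓗} {z w : ℂ} {J J' : 𝓗 →L[ℂ] 𝓗} (h : IsResolvent Φ z J)
    (h' : IsResolvent Φ w J') : J - J' = (z - w) • (J * J') := by
  ext x
  obtain ⟨u, hu, hx⟩ := h'.right x
  have h1 := h.left u
  have h2 : x = (Φ u - z • (u : 𝓗)) + (z - w) • (u : 𝓗) := by rw [← hx]; module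
  have h3 : J x = u + (z - w) • J u := by
    conv_lhs => rw [h2]
    rw [map_add, h1, map_smul]
  simp [h3, ← hu]

theorem norm_sub_smul_ge_re {Φ : 𝓗 →ₗ.[ℂ] 𝓗} {m : ℝ}
    (hm : ∀ u : Φ.domain, m * ‖(u : 𝓗)‖ ^ 2 ≤ (⟪Φ u, (u : 𝓗)⟫_ℂ).re) (z : ℂ) (u : Φ.domain) :
    (m - z.re) * ‖(u : 𝓗)‖ ≤ ‖Φ u - z • (u : 𝓗)‖ := by
  have h2 : (m - z.re) * ‖(u : 𝓗)‖ ^ 2 ≤ (⟪Φ u - z • (u : 𝓗), (u : 𝓗)⟫_ℂ).re := by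
    rw [inner_sub_left, inner_smul_left, inner_self_eq_norm_sq_to_K, sub_re]
    have := hm u
    simp [← ofReal_pow]
    linarith
  have h3 := h2.trans ((re_le_norm _).trans (norm_inner_le_norm (𝕜 := ℂ) _ _))
  rcases (norm_nonneg (u : 𝓗)).eq_or_lt with h | h
  · rw [← h, mul_zero]; exact norm_nonneg _
  · refine le_of_mul_le_mul_right ?_ h
    linarith [h3, sq ‖(u : 𝓗)‖]

variable [CompleteSpace 𝓗]

theorem isResolvent_resolventI {Φ : 𝓗 →ₗ.[ℂ] 𝓗} (hΦ : IsSelfAdjoint Φ) :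
    IsResolvent Φ (-I) (resolventI Φ) := by
  obtain ⟨h1, h2⟩ := resolventI_spec hΦ
  refine ⟨fun u => by simpa using h1 u, fun x => ?_⟩
  simpa using h2 x

theorem IsResolvent.isSelfAdjoint {Φ : 𝓗 →ₗ.[ℂ] 𝓗} (hΦ : IsSelfAdjoint Φ) {z : ℝ}
    {J : 𝓗 →L[ℂ] 𝓗} (h : IsResolvent Φ z J) : IsSelfAdjoint J := by
  rw [ContinuousLinearMap.isSelfAdjoint_iff_isSymmetric]
  intro x y
  obtain ⟨u, hu, hx⟩ := h.right x
  obtain ⟨v, hv, hy⟩ := h.right y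
  change ⟪J x, y⟫_ℂ = ⟪x, J y⟫_ℂ
  rw [← hu, ← hv, ← hx, ← hy, inner_sub_left, inner_sub_right, inner_symm hΦ, inner_smul_left,
    inner_smul_right, Complex.conj_ofReal]

/-- A self-adjoint operator `Φ` has a bounded resolvent at `z` if `Φ - z` and `Φ - z̄` are bounded
away from zero. -/
theorem exists_isResolvent {Φ : 𝓗 →ₗ.[ℂ] 𝓗} (hΦ : IsSelfAdjoint Φ) {z : ℂ} {c : ℝ} (hc : 0 < c)
    (h1 : ∀ u : Φ.domain, c * ‖(u : 𝓗)‖ ≤ ‖Φ u - z • (u : 𝓗)‖)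
    (h2 : ∀ u : Φ.domain, c * ‖(u : 𝓗)‖ ≤ ‖Φ u - (starRingEnd ℂ z) • (u : 𝓗)‖) :
    ∃ J : 𝓗 →L[ℂ] 𝓗, IsResolvent Φ z J ∧ ‖J‖ ≤ c⁻¹ := by
  let T : Φ.domain →ₗ[ℂ] 𝓗 := Φ.toFun - z • Φ.domain.subtype
  have hT : ∀ u, T u = Φ u - z • (u : 𝓗) := fun u => rfl
  have hbd : ∀ u : Φ.domain, ‖(u : 𝓗)‖ ≤ c⁻¹ * ‖T u‖ := fun u => by
    rw [hT, le_inv_mul_iff₀ hc]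
    exact h1 u
  have hdense : DenseRange T := by
    have : Dense ((LinearMap.range T : Submodule ℂ 𝓗) : Set 𝓗) := by
      rw [Submodule.dense_iff_topologicalClosure_eq_top,
        Submodule.topologicalClosure_eq_top_iff, Submodule.eq_bot_iff]
      intro w hw
      obtain ⟨u, hu, hu'⟩ := exists_of_adjoint hΦ (w := w) (z := (starRingEnd ℂ z) • w) fun u => by
        have h3 := (Submodule.mem_orthogonal' _ _).mp hw (T u) ⟨u, rfl⟩
        rw [hT, inner_sub_right, inner_smul_right] at h3
        rw [inner_smul_left, Complex.conj_conj]
        linear_combination -h3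
      have h3 := h2 u
      rw [hu', hu, sub_self, norm_zero] at h3
      have h4 : ‖w‖ ≤ 0 := by
        by_contra h
        exact absurd h3 (not_le.mpr (mul_pos hc (not_le.mp h)))
      exact norm_le_zero_iff.mp h4
    exact this
  set J := Φ.domain.subtype.extendOfNorm T with hJ
  have hJT : ∀ u, J (T u) = u := fun u =>
    LinearMap.extendOfNorm_eq hdense ⟨c⁻¹, hbd⟩ u
  refine ⟨J, ⟨hJT, fun x => ?_⟩, ?_⟩
  · obtain ⟨a, ha, hax⟩ := mem_closure_iff_seq_limit.mp (hdense x)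
    choose u hu using ha
    have e1 : Tendsto (fun n => (u n : 𝓗)) atTop (𝓝 (J x)) := by
      refine ((J.continuous.tendsto x).comp hax).congr fun n => ?_
      simp [← hu n, hJT]
    have e2 : Tendsto (fun n => Φ (u n)) atTop (𝓝 (x + z • J x)) := by
      refine (hax.add (e1.const_smul z)).congr fun n => ?_
      rw [← hu n, hT, sub_add_cancel]
    have e3 : (J x, x + z • J x) ∈ Φ.graph :=
      hΦ.isClosed.mem_of_tendsto (e1.prodMk_nhds e2) (Eventually.of_forall fun n => Φ.mem_graph _)
    obtain ⟨y, hy1, hy2⟩ := (LinearPMap.mem_graph_iff Φ).mp e3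
    exact ⟨y, hy1, by rw [hy2, hy1]; simp⟩
  · exact LinearMap.opNorm_extendOfNorm_le hdense (inv_nonneg.mpr hc.le) hbd

theorem norm_sub_smul_ge_im {Φ : 𝓗 →ₗ.[ℂ] 𝓗} (hΦ : IsSelfAdjoint Φ) (z : ℂ) (u : Φ.domain) :
    |z.im| * ‖(u : 𝓗)‖ ≤ ‖Φ u - z • (u : 𝓗)‖ := by
  have h1 : (⟪Φ u, (u : 𝓗)⟫_ℂ).im = 0 := by
    refine Complex.conj_eq_iff_im.mp ?_
    rw [inner_conj_symm, inner_symm hΦ]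
  have h2 : (⟪Φ u - z • (u : 𝓗), (u : 𝓗)⟫_ℂ).im = z.im * ‖(u : 𝓗)‖ ^ 2 := by
    rw [inner_sub_left, inner_smul_left, inner_self_eq_norm_sq_to_K, sub_im, h1]
    simp [← ofReal_pow]
  have h3 : |z.im| * ‖(u : 𝓗)‖ ^ 2 ≤ ‖Φ u - z • (u : 𝓗)‖ * ‖(u : 𝓗)‖ := by
    have h4 := (abs_im_le_norm _).trans (norm_inner_le_norm (𝕜 := ℂ) (Φ u - z • (u : 𝓗)) (u : 𝓗))
    rwa [h2, abs_mul, abs_of_nonneg (sq_nonneg ‖(u : 𝓗)‖)] at h4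
  rcases (norm_nonneg (u : 𝓗)).eq_or_lt with h | h
  · rw [← h, mul_zero]; exact norm_nonneg _
  · refine le_of_mul_le_mul_right ?_ h
    linarith [h3, sq ‖(u : 𝓗)‖]

/-- The spectrum of `(Φ + i)⁻¹` for `Φ ≥ m`. -/
theorem mem_spectrum_resolventI {Φ : 𝓗 →ₗ.[ℂ] 𝓗} (hΦ : IsSelfAdjoint Φ) {m : ℝ}
    (hm : ∀ u : Φ.domain, m * ‖(u : 𝓗)‖ ^ 2 ≤ (⟪Φ u, (u : 𝓗)⟫_ℂ).re) {r : ℂ}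
    (hr : r ∈ spectrum ℂ (resolventI Φ)) (hr0 : r ≠ 0) :
    ∃ lam : ℝ, m ≤ lam ∧ r⁻¹ = lam + I := by
  set z := r⁻¹ - I with hz
  by_cases hcase : z.im = 0 ∧ m ≤ z.re
  · refine ⟨z.re, hcase.2, ?_⟩
    have : z = (z.re : ℂ) := Complex.ext rfl (by simp [hcase.1])
    rw [← this, hz, sub_add_cancel]
  exfalso
  obtain ⟨J, hJ, -⟩ : ∃ J : 𝓗 →L[ℂ] 𝓗, IsResolvent Φ z J ∧ True := by
    rw [not_and_or, not_le] at hcase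
    rcases hcase with h | h
    · obtain ⟨J, hJ, -⟩ := exists_isResolvent hΦ (abs_pos.mpr h) (norm_sub_smul_ge_im hΦ z)
        fun u => by simpa using norm_sub_smul_ge_im hΦ (starRingEnd ℂ z) u
      exact ⟨J, hJ, trivial⟩
    · obtain ⟨J, hJ, -⟩ := exists_isResolvent hΦ (sub_pos.mpr h) (norm_sub_smul_ge_re hm z)
        fun u => by simpa using norm_sub_smul_ge_re hm (starRingEnd ℂ z) u
      exact ⟨J, hJ, trivial⟩
  have hR := isResolvent_resolventI hΦ
  have e1 := hR.sub_eq hJ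
  have e2 := hJ.sub_eq hR
  have e3 : -I - z = -r⁻¹ := by rw [hz]; ring
  have e4 : z - -I = r⁻¹ := by rw [hz]; ring
  rw [e3] at e1
  rw [e4] at e2
  refine hr ?_
  rw [spectrum.mem_resolventSet_iff, isUnit_iff_exists]
  refine ⟨r⁻¹ • (1 + r⁻¹ • J), ?_, ?_⟩
  · rw [Algebra.algebraMap_eq_smul_one]
    have e5 : r⁻¹ • (r⁻¹ • (resolventI Φ * J)) = r⁻¹ • (J - resolventI Φ) := by
      rw [← neg_sub (resolventI Φ), e1]; simp
    simp only [sub_mul, mul_add, mul_one, mul_smul_comm, smul_mul_assoc, one_mul, smul_add,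
      smul_smul, smul_sub] at e5 ⊢
    rw [e5, inv_mul_cancel₀ hr0, inv_mul_cancel_right₀ hr0, one_smul]
    abel
  · rw [Algebra.algebraMap_eq_smul_one]
    have e5 : r⁻¹ • (r⁻¹ • (J * resolventI Φ)) = r⁻¹ • (J - resolventI Φ) := by
      rw [e2]
    simp only [mul_sub, add_mul, mul_one, mul_smul_comm, smul_mul_assoc, one_mul, smul_add,
      smul_smul, smul_sub] at e5 ⊢
    rw [e5, mul_inv_cancel_left₀ hr0, mul_inv_cancel₀ hr0, one_smul]
    abel

/-- An invertible operator with bounded commutator with `H` has an inverse preserving `D(H)`. -/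
theorem IsDomainCommutator.inverse_mem {H : 𝓗 →ₗ.[ℂ] 𝓗} (hH : IsSelfAdjoint H)
    {T K N : 𝓗 →L[ℂ] 𝓗} (h : IsDomainCommutator H T K) (hTN : T * N = 1) (hNT : N * T = 1)
    (x : H.domain) : N x ∈ H.domain := by
  -- `(H - iκ) T (H - iκ)⁻¹ = T + K (H - iκ)⁻¹` is invertible for large `κ`
  set κ : ℝ := ‖N‖ * ‖K‖ + 1 with hκ
  have hκ0 : 0 < κ := by positivity
  have him : (κ * I : ℂ).im = κ := by simp
  obtain ⟨J, hJ, hJn⟩ := exists_isResolvent hH (z := κ * I) hκ0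
    (fun u => by simpa [abs_of_pos hκ0] using norm_sub_smul_ge_im hH (κ * I) u)
    (fun u => by simpa [abs_of_pos hκ0] using norm_sub_smul_ge_im hH (starRingEnd ℂ (κ * I)) u)
  have hq : ‖-(N * K * J)‖ < 1 := by
    rw [norm_neg]
    calc ‖N * K * J‖ ≤ ‖N‖ * ‖K‖ * κ⁻¹ :=
          (norm_mul_le _ _).trans (mul_le_mul (norm_mul_le _ _) hJn (norm_nonneg _) (by positivity))
      _ < 1 := by rw [← div_eq_mul_inv, div_lt_one hκ0, hκ]; linarith
  set q := Units.oneSub _ hq with hqdef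
  set w : 𝓗 := H x - (κ * I : ℂ) • (x : 𝓗) with hw
  set w' : 𝓗 := (↑q⁻¹ : 𝓗 →L[ℂ] 𝓗) (N w) with hw'
  have e1 : T w' + K (J w') = w := by
    have h1 : (q : 𝓗 →L[ℂ] 𝓗) w' = N w := by
      rw [hw']
      exact congrArg (fun S : 𝓗 →L[ℂ] 𝓗 => S (N w)) q.mul_inv
    have h2 : (q : 𝓗 →L[ℂ] 𝓗) w' = w' + N (K (J w')) := by
      rw [hqdef, Units.val_oneSub]
      simp
    rw [h2] at h1
    have h3 := congrArg T h1
    have h4 : ∀ y, T (N y) = y := fun y => congrArg (fun S : 𝓗 →L[ℂ] 𝓗 => S y) hTN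
    rwa [map_add, h4, h4] at h3
  obtain ⟨y, hy, hyw⟩ := hJ.right w'
  obtain ⟨hTy, hK⟩ := h y
  have e2 : H ⟨T y, hTy⟩ - (κ * I : ℂ) • T y = w := by
    rw [← e1, ← hy, hK, ← hyw, map_sub, map_smul]
    abel
  have e3 : T y = x := by
    have h1 := hJ.left ⟨T y, hTy⟩
    have h2 := hJ.left x
    rw [← hw] at h2
    have h3 : J w = T y := by rw [← e2]; exact h1
    rw [← h3, h2]
  have e4 : N x = y := by
    rw [← e3]
    exact congrArg (fun S : 𝓗 →L[ℂ] 𝓗 => S (y : 𝓗)) hNT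
  rw [e4]
  exact y.2

/-- `[H, (Φ - z)⁻¹] = (Φ - z)⁻¹ [Φ, H] (Φ - z)⁻¹` if the resolvent preserves `D(H)`. -/
theorem IsResolvent.isDomainCommutator {H Φ : 𝓗 →ₗ.[ℂ] 𝓗} (hH : IsSelfAdjoint H)
    (hΦ : IsSelfAdjoint Φ) {z : ℝ} {J C : 𝓗 →L[ℂ] 𝓗} (hJ : IsResolvent Φ z J)
    (hC : IsCommutator Φ H C) (hmem : ∀ x : H.domain, J x ∈ H.domain) :
    IsDomainCommutator H J (J * C * J) := by
  refine IsBddCommutator.isDomainCommutator hH fun u v => ?_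
  have hsym : ∀ x y, ⟪J x, y⟫_ℂ = ⟪x, J y⟫_ℂ := (hJ.isSelfAdjoint hΦ).isSymmetric
  obtain ⟨u', hu', hu⟩ := hJ.right u
  obtain ⟨v', hv', hv⟩ := hJ.right v
  have hu'' : (u' : 𝓗) ∈ H.domain := hu' ▸ hmem u
  have hv'' : (v' : 𝓗) ∈ H.domain := hv' ▸ hmem v
  have h1 := hC u' v' u'.2 hu'' v'.2 hv''
  have h2 : Φ u' = u + (z : ℂ) • (u' : 𝓗) := by rw [← hu, sub_add_cancel]
  have h3 : Φ v' = v + (z : ℂ) • (v' : 𝓗) := by rw [← hv, sub_add_cancel]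
  have h4 : ⟪(u : 𝓗), (J * C * J) v⟫_ℂ = ⟪(u' : 𝓗), C v'⟫_ℂ := by
    rw [hu', hv', hsym]
    rfl
  rw [h4, ← h1]
  have h5 := inner_symm hH u ⟨v', hv''⟩
  have h6 := inner_symm hH ⟨u', hu''⟩ v
  have h7 := inner_symm hH ⟨u', hu''⟩ ⟨v', hv''⟩
  rw [Subtype.coe_eta, Subtype.coe_eta, h2, h3, inner_add_left, inner_add_right, inner_smul_left,
    inner_smul_right, Complex.conj_ofReal, ← hsym (u : 𝓗) (H v), ← hu', ← hv', h5]
  simp only at h6 h7 ⊢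
  rw [h6, h7]
  ring

/-- Invariance of `D(H)` passes from one real resolvent to another. -/
theorem IsResolvent.preserves_of_preserves {H Φ : 𝓗 →ₗ.[ℂ] 𝓗} (hH : IsSelfAdjoint H)
    (hΦ : IsSelfAdjoint Φ) {z z₀ : ℝ} {J J₀ C : 𝓗 →L[ℂ] 𝓗} (hJ : IsResolvent Φ z J)
    (hJ₀ : IsResolvent Φ z₀ J₀) (hC : IsCommutator Φ H C)
    (hmem : ∀ x : H.domain, J₀ x ∈ H.domain) (x : H.domain) : J x ∈ H.domain := by
  have h0 := hJ₀.isDomainCommutator hH hΦ hC hmem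
  set a : ℂ := z - z₀ with ha
  have h1 : IsDomainCommutator H (1 - a • J₀) (-(a • (J₀ * C * J₀))) := by
    refine IsBddCommutator.isDomainCommutator hH fun u v => ?_
    have := h0.isBddCommutator hH u v
    have e := inner_symm hH u v
    simp only [sub_apply, one_apply_eq_self, smul_apply, neg_apply, inner_sub_right,
      inner_smul_right, inner_neg_right] at this ⊢
    rw [← this, e]
    ring
  have e1 := hJ.sub_eq hJ₀
  have e2 := hJ₀.sub_eq hJ
  rw [← neg_sub (z : ℂ), ← ha] at e2
  rw [← ha] at e1
  have h2 : (1 - a • J₀) * (1 + a • J) = 1 := by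
    have e3 : a • (J₀ * J) = J - J₀ := by rw [← neg_sub J₀ J, e2]; simp
    simp only [sub_mul, mul_add, mul_one, one_mul, smul_mul_assoc, mul_smul_comm]
    rw [e3]
    simp only [smul_sub]
    abel
  have h3 : (1 + a • J) * (1 - a • J₀) = 1 := by
    simp only [mul_sub, add_mul, mul_one, one_mul, smul_mul_assoc, mul_smul_comm]
    rw [← e1]
    rw [add_sub_cancel, add_sub_cancel_right]
  have h4 := h1.inverse_mem hH h2 h3 x
  have h5 : J x = J₀ ((1 + a • J) x) := by
    have e3 : J = J₀ * (1 + a • J) := by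
      have e3 : a • (J₀ * J) = J - J₀ := by rw [← neg_sub J₀ J, e2]; simp
      rw [mul_add, mul_one, mul_smul_comm, e3, add_sub_cancel]
    conv_lhs => rw [e3]
    rfl
  rw [h5]
  exact hmem ⟨_, h4⟩

/-- `[(Φ - z)⁻¹, B] = -(Φ - z)⁻¹ [Φ, B] (Φ - z)⁻¹`. -/
theorem IsResolvent.mul_sub_mul {Φ : 𝓗 →ₗ.[ℂ] 𝓗} (hΦ : IsSelfAdjoint Φ) {z : ℝ}
    {J B C : 𝓗 →L[ℂ] 𝓗} (hJ : IsResolvent Φ z J) (hC : IsBddCommutator Φ B C) :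
    B * J - J * B = J * C * J := by
  have hsym : ∀ x y, ⟪J x, y⟫_ℂ = ⟪x, J y⟫_ℂ := (hJ.isSelfAdjoint hΦ).isSymmetric
  ext y
  refine ext_inner_left ℂ fun x => ?_
  obtain ⟨u, hu', hu⟩ := hJ.right x
  obtain ⟨v, hv', hv⟩ := hJ.right y
  have h1 := hC u v
  have h2 : Φ u = x + (z : ℂ) • (u : 𝓗) := by rw [← hu, sub_add_cancel]
  have h3 : Φ v = y + (z : ℂ) • (v : 𝓗) := by rw [← hv, sub_add_cancel]
  rw [h2, h3, inner_add_left, map_add, inner_add_right, map_smul, inner_smul_left,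
    inner_smul_right, Complex.conj_ofReal, hu', hv'] at h1
  change ⟪x, B (J y) - J (B y)⟫_ℂ = ⟪x, J (C (J y))⟫_ℂ
  rw [inner_sub_right, ← hsym x (B y), ← hsym x (C (J y)), ← h1]
  ring

end Resolvent

/-! ### Bounded regularizations of a semibounded operator -/

section Regularization

variable {𝓗 : Type*} [NormedAddCommGroup 𝓗] [InnerProductSpace ℂ 𝓗]

theorem tendsto_apply_of_dense {T : ℕ → 𝓗 →L[ℂ] 𝓗} {S : 𝓗 →L[ℂ] 𝓗} {c : ℝ}
    (hc : ∀ n, ‖T n‖ ≤ c) {D : Set 𝓗} (hD : Dense D)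
    (h : ∀ x ∈ D, Tendsto (fun n => T n x) atTop (𝓝 (S x))) (x : 𝓗) :
    Tendsto (fun n => T n x) atTop (𝓝 (S x)) := by
  have hc0 : 0 ≤ c := (norm_nonneg _).trans (hc 0)
  rw [Metric.tendsto_atTop]
  intro ε hε
  have hpos : 0 < c + ‖S‖ + 1 := by positivity
  obtain ⟨y, hy, hxy⟩ := hD.exists_dist_lt x (ε := ε / (2 * (c + ‖S‖ + 1))) (by positivity)
  obtain ⟨N, hN⟩ := Metric.tendsto_atTop.mp (h y hy) (ε / 2) (by positivity)
  refine ⟨N, fun n hn => ?_⟩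
  have h1 := hN n hn
  rw [dist_eq_norm] at h1 hxy ⊢
  have h2 : T n x - S x = T n (x - y) + (T n y - S y) - S (x - y) := by
    simp only [map_sub]; abel
  have h3 : ‖T n (x - y)‖ ≤ c * ‖x - y‖ := (T n).le_of_opNorm_le (hc n) _
  have h4 : ‖S (x - y)‖ ≤ ‖S‖ * ‖x - y‖ := S.le_opNorm _
  have h5 : (c + ‖S‖ + 1) * ‖x - y‖ < ε / 2 := by
    rw [lt_div_iff₀ (by positivity)] at hxy
    linarith
  rw [h2]
  have h6 := norm_sub_le (T n (x - y) + (T n y - S y)) (S (x - y))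
  have h7 := norm_add_le (T n (x - y)) (T n y - S y)
  nlinarith [norm_nonneg (x - y)]

/-- The Yosida approximants `m + κ (lam - m) / (lam - m + κ)` of `lam ≥ m` converge to `lam` as
`κ → ∞`, locally uniformly in `lam`. -/
theorem exists_yosida_close {F : ℝ → ℝ} (hF : Continuous F) {M : ℝ} (hM : ∀ x, |F x| ≤ M) (m : ℝ)
    {ε : ℝ} (hε : 0 < ε) : ∃ K : ℝ, ∀ κ, K ≤ κ → 0 < κ → ∀ lam, m ≤ lam →
      |F (κ + m - κ ^ 2 / (lam - m + κ)) - F lam| ≤ ε * ‖(lam + I : ℂ)‖ := by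
  have hM0 : 0 ≤ M := (abs_nonneg _).trans (hM 0)
  have hnorm1 : ∀ lam : ℝ, 1 ≤ ‖(lam + I : ℂ)‖ := fun lam => by
    simpa using Complex.abs_im_le_norm (lam + I : ℂ)
  have hnorm2 : ∀ lam : ℝ, lam ≤ ‖(lam + I : ℂ)‖ := fun lam => by
    simpa using (le_abs_self _).trans (Complex.abs_re_le_norm (lam + I : ℂ))
  set L := max m (2 * M / ε) with hL
  have huc := isCompact_Icc.uniformContinuousOn_of_continuous (hF.continuousOn (s := Set.Icc m L))
  obtain ⟨η, hη, hηF⟩ := Metric.uniformContinuousOn_iff.mp huc ε hε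
  refine ⟨(L - m) ^ 2 / η + 1, fun κ hκ hκ0 lam hlam => ?_⟩
  rcases le_or_gt lam L with h | h
  · have hpos : 0 < lam - m + κ := by linarith
    have e1 : lam - (κ + m - κ ^ 2 / (lam - m + κ)) = (lam - m) ^ 2 / (lam - m + κ) := by
      field_simp; ring
    have e2 : κ + m - κ ^ 2 / (lam - m + κ) = m + κ * (lam - m) / (lam - m + κ) := by
      field_simp; ring
    have e3 : (lam - m) ^ 2 / (lam - m + κ) < η := by
      rw [div_lt_iff₀ hpos]
      have h1 : (L - m) ^ 2 / η < κ := by linarith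
      rw [div_lt_iff₀ hη] at h1
      nlinarith [mul_nonneg hη.le (sub_nonneg.mpr hlam)]
    have e4 : 0 ≤ (lam - m) ^ 2 / (lam - m + κ) := by positivity
    have e5 : 0 ≤ κ * (lam - m) / (lam - m + κ) :=
      div_nonneg (mul_nonneg hκ0.le (sub_nonneg.mpr hlam)) hpos.le
    have e6 := hηF (κ + m - κ ^ 2 / (lam - m + κ)) ⟨by linarith, by linarith⟩ lam ⟨hlam, h⟩ (by
      rw [Real.dist_eq, abs_sub_comm, e1, abs_of_nonneg e4]; exact e3)
    rw [Real.dist_eq] at e6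
    nlinarith [hnorm1 lam]
  · have h1 : 2 * M / ε < lam := (le_max_right _ _).trans_lt h
    rw [div_lt_iff₀ hε] at h1
    have h2 := abs_sub (F (κ + m - κ ^ 2 / (lam - m + κ))) (F lam)
    nlinarith [hM (κ + m - κ ^ 2 / (lam - m + κ)), hM lam, hnorm2 lam]

variable [CompleteSpace 𝓗]

/-- For `r = 1 / (lam + i)`, this is `1 / (lam - z)`. -/
noncomputable def resolventFn (z : ℝ) (r : ℂ) : ℂ := r * (1 - (z + I) * r)⁻¹

theorem resolventFn_of_mem_spectrum {Φ : 𝓗 →ₗ.[ℂ] 𝓗} (hΦ : IsSelfAdjoint Φ) {m : ℝ}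
    (hm : ∀ u : Φ.domain, m * ‖(u : 𝓗)‖ ^ 2 ≤ (⟪Φ u, (u : 𝓗)⟫_ℂ).re) (z : ℝ) {r : ℂ}
    (hr : r ∈ spectrum ℂ (resolventI Φ)) (hr0 : r ≠ 0) :
    ∃ lam : ℝ, m ≤ lam ∧ r⁻¹ = lam + I ∧ resolventFn z r = ((lam - z : ℝ)⁻¹ : ℝ) := by
  obtain ⟨lam, hlam, h⟩ := mem_spectrum_resolventI hΦ hm hr hr0
  refine ⟨lam, hlam, h, ?_⟩
  have h1 : 1 - (z + I) * r = ((lam - z : ℝ) : ℂ) * r := by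
    have : (1 : ℂ) = r⁻¹ * r := (inv_mul_cancel₀ hr0).symm
    conv_lhs => rw [this, h]
    push_cast
    ring
  rw [resolventFn, h1, mul_inv, mul_comm, mul_assoc, inv_mul_cancel₀ hr0, mul_one, ofReal_inv]

section

variable {Φ : 𝓗 →ₗ.[ℂ] 𝓗} (hΦ : IsSelfAdjoint Φ) {m : ℝ}
  (hm : ∀ u : Φ.domain, m * ‖(u : 𝓗)‖ ^ 2 ≤ (⟪Φ u, (u : 𝓗)⟫_ℂ).re) {z : ℝ} (hz : z < m)

include hΦ hm hz

theorem one_sub_mul_ne_zero_of_mem_spectrum {r : ℂ} (hr : r ∈ spectrum ℂ (resolventI Φ)) :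
    1 - (z + I) * r ≠ 0 := by
  by_cases hr0 : r = 0
  · simp [hr0]
  obtain ⟨lam, hlam, h⟩ := mem_spectrum_resolventI hΦ hm hr hr0
  have h1 : 1 - (z + I) * r = ((lam - z : ℝ) : ℂ) * r := by
    have : (1 : ℂ) = r⁻¹ * r := (inv_mul_cancel₀ hr0).symm
    conv_lhs => rw [this, h]
    push_cast
    ring
  rw [h1]
  exact mul_ne_zero (Complex.ofReal_ne_zero.mpr (by linarith)) hr0

theorem continuousOn_resolventFn :
    ContinuousOn (resolventFn z) (spectrum ℂ (resolventI Φ)) := by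
  unfold resolventFn
  exact continuousOn_id.mul (ContinuousOn.inv₀ (by fun_prop) fun r hr =>
    one_sub_mul_ne_zero_of_mem_spectrum hΦ hm hz hr)

theorem IsResolvent.eq_cfc {J : 𝓗 →L[ℂ] 𝓗} (hJ : IsResolvent Φ z J) :
    J = cfc (resolventFn z) (resolventI Φ) := by
  have hN := isStarNormal_resolventI hΦ
  have h1 := hJ.sub_eq (isResolvent_resolventI hΦ)
  set R := resolventI Φ with hR
  have hne := fun r hr => one_sub_mul_ne_zero_of_mem_spectrum hΦ hm hz (r := r) hr
  have hc : ContinuousOn (fun r : ℂ => (1 - (z + I) * r)⁻¹) (spectrum ℂ R) :=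
    ContinuousOn.inv₀ (by fun_prop) hne
  have e1 : cfc (fun r : ℂ => 1 - (z + I) * r) R = 1 - (z + I : ℂ) • R := by
    rw [cfc_sub (fun _ => (1 : ℂ)) (fun r => (z + I) * r) R, cfc_const_mul _ _ R, cfc_id' ℂ R,
      cfc_const_one ℂ R]
  have e2 : cfc (fun r : ℂ => 1 - (z + I) * r) R * cfc (fun r : ℂ => (1 - (z + I) * r)⁻¹) R = 1 := by
    rw [← cfc_mul _ _ R (by fun_prop) hc, ← cfc_const_one ℂ R]
    exact cfc_congr fun r hr => mul_inv_cancel₀ (hne r hr)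
  have e3 : J * cfc (fun r : ℂ => 1 - (z + I) * r) R = R := by
    rw [e1, mul_sub, mul_one, mul_smul_comm, ← sub_neg_eq_add (z : ℂ) I, ← h1, sub_sub_cancel]
  calc J = J * (cfc (fun r : ℂ => 1 - (z + I) * r) R *
        cfc (fun r : ℂ => (1 - (z + I) * r)⁻¹) R) := by rw [e2, mul_one]
    _ = cfc (fun r : ℂ => r) R * cfc (fun r : ℂ => (1 - (z + I) * r)⁻¹) R := by
        rw [← mul_assoc, e3, cfc_id' ℂ R]
    _ = cfc (resolventFn z) R := by rw [← cfc_mul _ _ R (by fun_prop) hc]; rfl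

theorem IsResolvent.cfc_sub_smul {J : 𝓗 →L[ℂ] 𝓗} (hJ : IsResolvent Φ z J) {f : ℝ → ℝ}
    (hf : Continuous f) (α β : ℝ) : cfc f ((α : ℂ) • (1 : 𝓗 →L[ℂ] 𝓗) - (β : ℂ) • J) =
      cfc (fun r => (f (α - β * (resolventFn z r).re) : ℂ)) (resolventI Φ) := by
  have hN := isStarNormal_resolventI hΦ
  have hc := continuousOn_resolventFn hΦ hm hz
  have hsa : IsSelfAdjoint ((α : ℂ) • (1 : 𝓗 →L[ℂ] 𝓗) - (β : ℂ) • J) :=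
    (IsSelfAdjoint.smul (Complex.conj_ofReal α) (.one _)).sub
      (IsSelfAdjoint.smul (Complex.conj_ofReal β) (hJ.isSelfAdjoint hΦ))
  have e1 : (α : ℂ) • (1 : 𝓗 →L[ℂ] 𝓗) - (β : ℂ) • J =
      cfc (fun r => (α : ℂ) - β * resolventFn z r) (resolventI Φ) := by
    rw [cfc_sub (fun _ => (α : ℂ)) (fun r => β * resolventFn z r) _ (by fun_prop)
      (by fun_prop), cfc_const_mul _ _ _ hc, ← hJ.eq_cfc hΦ hm hz, cfc_const _ _ hN,
      Algebra.algebraMap_eq_smul_one]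
  rw [cfc_real_eq_complex f hsa, e1, ← cfc_comp (fun x : ℂ => (f x.re : ℂ))
    (fun r => (α : ℂ) - β * resolventFn z r) _ hN (by fun_prop) (by fun_prop)]
  refine cfc_congr fun r _ => ?_
  simp

theorem IsResolvent.norm_cfc_mul_resolventI_sub_le {J : 𝓗 →L[ℂ] 𝓗} (hJ : IsResolvent Φ z J)
    {f F : ℝ → ℝ} (hf : Continuous f) (hF : Continuous F) {M : ℝ} (hM : ∀ x, |F x| ≤ M)
    {α β ε : ℝ} (hε : 0 ≤ ε)
    (h : ∀ lam, m ≤ lam → |f (α - β / (lam - z)) - F lam| ≤ ε * ‖(lam + I : ℂ)‖) :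
    ‖cfc f ((α : ℂ) • (1 : 𝓗 →L[ℂ] 𝓗) - (β : ℂ) • J) * resolventI Φ - regularizedCalc Φ F‖ ≤ ε := by
  have hN := isStarNormal_resolventI hΦ
  have hc := continuousOn_resolventFn hΦ hm hz
  have hc1 : ContinuousOn (fun r => (f (α - β * (resolventFn z r).re) : ℂ))
      (spectrum ℂ (resolventI Φ)) :=
    (continuous_ofReal.comp (hf.comp (g := f) (f := fun w : ℂ => α - β * w.re)
      (by fun_prop))).comp_continuousOn hc
  have hc2 := continuous_regularized hF hM
  have e1 : cfc f ((α : ℂ) • (1 : 𝓗 →L[ℂ] 𝓗) - (β : ℂ) • J) * resolventI Φ - regularizedCalc Φ F =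
      cfc (fun r => (f (α - β * (resolventFn z r).re) : ℂ) * r - regularized F r)
        (resolventI Φ) := by
    rw [cfc_sub (fun r => (f (α - β * (resolventFn z r).re) : ℂ) * r) _ _ (by fun_prop)
      (by fun_prop), cfc_mul _ (fun r => r) _ hc1 (by fun_prop), cfc_id' ℂ (resolventI Φ),
      hJ.cfc_sub_smul hΦ hm hz hf, regularizedCalc]
  rw [e1]
  refine norm_cfc_le hε fun r hr => ?_
  by_cases hr0 : r = 0
  · simpa [hr0, regularized] using hε
  obtain ⟨lam, hlam, h1, h2⟩ := resolventFn_of_mem_spectrum hΦ hm z hr hr0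
  have h3 : (r⁻¹ - I).re = lam := by rw [h1]; simp
  rw [regularized, h3, h2, ofReal_re, ← sub_mul, ← ofReal_sub, norm_mul, Complex.norm_real,
    Real.norm_eq_abs, ← div_eq_mul_inv]
  have h4 := h lam hlam
  rw [← h1, norm_inv] at h4
  rwa [← le_div_iff₀ (norm_pos_iff.mpr hr0), div_eq_mul_inv]

end

end Regularization

section Regularization

variable {𝓗 : Type*} [NormedAddCommGroup 𝓗] [InnerProductSpace ℂ 𝓗] [CompleteSpace 𝓗]

/-- `A` is a bounded substitute for `Φ / s`, up to an additive constant: its commutators with bounded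
operators and with `H` are those of `Φ / s`, sandwiched between two copies of a contraction `T` which
commutes with `A`. -/
structure IsRegularization (H Φ : 𝓗 →ₗ.[ℂ] 𝓗) (s : ℝ) (A T : 𝓗 →L[ℂ] 𝓗) : Prop where
  isSelfAdjoint_left : IsSelfAdjoint A
  isSelfAdjoint_right : IsSelfAdjoint T
  norm_le_one : ‖T‖ ≤ 1
  commute : Commute A T
  mul_sub_mul : ∀ B C : 𝓗 →L[ℂ] 𝓗, IsBddCommutator Φ B C →
    A * B - B * A = ((s⁻¹ : ℝ) : ℂ) • (T * C * T)
  isDomainCommutator : ∀ C : 𝓗 →L[ℂ] 𝓗, IsCommutator Φ H C →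
    IsDomainCommutator H A (-(((s⁻¹ : ℝ) : ℂ) • (T * C * T)))

theorem IsDomainCommutator.smul_one_sub_smul {H : 𝓗 →ₗ.[ℂ] 𝓗} (hH : IsSelfAdjoint H)
    {X K : 𝓗 →L[ℂ] 𝓗} (h : IsDomainCommutator H X K) (a b : ℂ) :
    IsDomainCommutator H (a • 1 - b • X) (-(b • K)) := by
  refine IsBddCommutator.isDomainCommutator hH fun u v => ?_
  have h1 := h.isBddCommutator hH u v
  have e := inner_symm hH u v
  simp only [sub_apply, one_apply_eq_self, smul_apply, neg_apply, inner_sub_right,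
    inner_smul_right, inner_neg_right] at h1 ⊢
  rw [← h1, e]
  ring

/-- With `J = (Φ - m + κ)⁻¹` and `m` a lower bound of `Φ`, the Yosida approximant `κ + m - κ² J` of
`Φ` gives a regularization, with `T = κ J`. -/
theorem IsResolvent.isRegularization {H Φ : 𝓗 →ₗ.[ℂ] 𝓗} (hH : IsSelfAdjoint H)
    (hΦ : IsSelfAdjoint Φ) {z z₀ κ : ℝ} {J J₀ : 𝓗 →L[ℂ] 𝓗} (hJ : IsResolvent Φ z J)
    (hJ₀ : IsResolvent Φ z₀ J₀) (hmem : ∀ x : H.domain, J₀ x ∈ H.domain) (hκ : 0 < κ)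
    (hJn : ‖J‖ ≤ κ⁻¹) (α s : ℝ) :
    IsRegularization H Φ s ((α : ℂ) • 1 - ((κ ^ 2 / s : ℝ) : ℂ) • J) ((κ : ℂ) • J) where
  isSelfAdjoint_left := (IsSelfAdjoint.smul (Complex.conj_ofReal α) (.one _)).sub
      (IsSelfAdjoint.smul (Complex.conj_ofReal _) (hJ.isSelfAdjoint hΦ))
  isSelfAdjoint_right := IsSelfAdjoint.smul (Complex.conj_ofReal _) (hJ.isSelfAdjoint hΦ)
  norm_le_one := by
    rw [norm_smul, Complex.norm_real, Real.norm_eq_abs, abs_of_pos hκ]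
    exact (mul_le_mul_of_nonneg_left hJn hκ.le).trans_eq (mul_inv_cancel₀ hκ.ne')
  commute := (((Commute.one_left J).smul_left _).sub_left
    ((Commute.refl J).smul_left _)).smul_right _
  mul_sub_mul B C hC := by
    have h1 := hJ.mul_sub_mul hΦ hC
    simp only [sub_mul, mul_sub, smul_mul_assoc, mul_smul_comm, one_mul, mul_one, smul_smul] at h1 ⊢
    rw [sub_sub_sub_cancel_left, ← smul_sub, h1]
    congr 1
    push_cast
    ring
  isDomainCommutator C hC := by
    have h1 := hJ.isDomainCommutator hH hΦ hC
      (hJ.preserves_of_preserves hH hΦ hJ₀ hC hmem)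
    convert h1.smul_one_sub_smul hH (α : ℂ) ((κ ^ 2 / s : ℝ) : ℂ) using 2
    simp only [smul_mul_assoc, mul_smul_comm, smul_smul]
    congr 1
    push_cast
    ring

/-- `A n` is a sequence of regularizations of `(Φ - v t) / s` whose functional calculus converges
strongly to that of `(Φ - v t) / s`. -/
structure IsApproximation (H Φ : 𝓗 →ₗ.[ℂ] 𝓗) (v t s : ℝ) (A T : ℕ → 𝓗 →L[ℂ] 𝓗) : Prop where
  isRegularization : ∀ n, IsRegularization H Φ s (A n) (T n)
  tendsto_right : ∀ x, Tendsto (fun n => T n x) atTop (𝓝 x)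
  tendsto_cfc : ∀ f : ℝ → ℝ, Continuous f → (∃ M, ∀ x, |f x| ≤ M) →
    ∀ x, Tendsto (fun n => cfc f (A n) x) atTop (𝓝 (fts Φ f v t s x))

/-- The Yosida approximants of a semibounded operator `Φ`, one of whose real resolvents preserves
`D(H)`, converge in the sense of `IsApproximation`. -/
theorem exists_isApproximation {H Φ : 𝓗 →ₗ.[ℂ] 𝓗} (hH : IsSelfAdjoint H)
    (hΦ : IsSelfAdjoint Φ) {m : ℝ}
    (hm : ∀ u : Φ.domain, m * ‖(u : 𝓗)‖ ^ 2 ≤ (⟪Φ u, (u : 𝓗)⟫_ℂ).re) {z₀ : ℝ} {J₀ : 𝓗 →L[ℂ] 𝓗}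
    (hJ₀ : IsResolvent Φ z₀ J₀) (hmem : ∀ x : H.domain, J₀ x ∈ H.domain) (v t s : ℝ) :
    ∃ A T : ℕ → 𝓗 →L[ℂ] 𝓗, IsApproximation H Φ v t s A T := by
  have hκ : ∀ n : ℕ, (0 : ℝ) < n + 1 := fun n => by positivity
  have hex : ∀ n : ℕ, ∃ J : 𝓗 →L[ℂ] 𝓗,
      IsResolvent Φ ((m - (n + 1) : ℝ) : ℂ) J ∧ ‖J‖ ≤ ((n : ℝ) + 1)⁻¹ := fun n => by
    refine exists_isResolvent hΦ (hκ n) (fun u => ?_) fun u => ?_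
    · simpa using norm_sub_smul_ge_re hm ((m - (n + 1) : ℝ) : ℂ) u
    · rw [Complex.conj_ofReal]
      simpa using norm_sub_smul_ge_re hm ((m - (n + 1) : ℝ) : ℂ) u
  choose J hJ hJn using hex
  -- the choice `κ = n + 1` in the Yosida approximant `κ + m - κ² J` of `Φ`
  refine ⟨fun n : ℕ => ((((n : ℝ) + 1 + m - v * t) / s : ℝ) : ℂ) • 1 -
      ((((n : ℝ) + 1) ^ 2 / s : ℝ) : ℂ) • J n,
    fun n : ℕ => (((n : ℝ) + 1 : ℝ) : ℂ) • J n,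
    fun n => (hJ n).isRegularization hH hΦ hJ₀ hmem (hκ n) (hJn n) _ _, ?_, ?_⟩
  · have hT : ∀ n : ℕ, ‖(((n : ℝ) + 1 : ℝ) : ℂ) • J n‖ ≤ 1 := fun n =>
      ((hJ n).isRegularization hH hΦ hJ₀ hmem (hκ n) (hJn n) 0 0).norm_le_one
    refine tendsto_apply_of_dense (S := 1) hT hΦ.dense_domain fun u hu => ?_
    have e1 : ∀ n : ℕ, (((n : ℝ) + 1 : ℝ) : ℂ) • J n u =
        u - J n (Φ ⟨u, hu⟩ - (m : ℂ) • u) := fun n => by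
      have h1 := (hJ n).left ⟨u, hu⟩
      simp only at h1
      rw [eq_sub_iff_add_eq]
      conv_rhs => rw [← h1]
      simp only [map_sub, map_smul]
      push_cast
      module
    have e2 : Tendsto (fun n => J n (Φ ⟨u, hu⟩ - (m : ℂ) • u)) atTop (𝓝 0) := by
      refine squeeze_zero_norm (fun n => (J n).le_of_opNorm_le (hJn n) _) ?_
      have h1 : Tendsto (fun n : ℕ => ((n : ℝ) + 1)⁻¹) atTop (𝓝 0) :=
        (tendsto_atTop_add_const_right _ _ tendsto_natCast_atTop_atTop).inv_tendsto_atTop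
      simpa using h1.mul_const ‖Φ ⟨u, hu⟩ - (m : ℂ) • u‖
    have e3 := (tendsto_const_nhds (x := u)).sub e2
    rw [sub_zero] at e3
    exact e3.congr fun n => (e1 n).symm
  · rintro f hf ⟨M, hM⟩
    have hM0 : 0 ≤ M := (abs_nonneg _).trans (hM 0)
    refine tendsto_apply_of_dense (c := M) (fun n => norm_cfc_le hM0 fun x _ => hM x)
      (D := Set.range (resolventI Φ)) ?_ ?_
    · exact hΦ.dense_domain.mono fun u hu => ⟨_, (resolventI_spec hΦ).1 ⟨u, hu⟩⟩
    -- on the range of `(Φ + i)⁻¹` the functional calculi of `Φ` and of `A n` can be compared in norm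
    rintro _ ⟨y, rfl⟩
    have hF : Continuous fun lam => f ((lam - v * t) / s) := hf.comp (by fun_prop)
    rw [fts, fnCalc_resolventI hΦ hF (fun x => hM _), Metric.tendsto_atTop]
    intro ε hε
    obtain ⟨K, hK⟩ := exists_yosida_close hF (fun x => hM _) m
      (ε := ε / (‖y‖ + 1)) (by positivity)
    obtain ⟨N, hN⟩ := exists_nat_ge K
    refine ⟨N, fun n hn => ?_⟩
    have hKn : K ≤ n + 1 := by
      have : (N : ℝ) ≤ n := Nat.cast_le.mpr hn
      linarith
    have h1 := (hJ n).norm_cfc_mul_resolventI_sub_le hΦ hm (by linarith [hκ n]) hf hF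
      (fun x => hM _) (ε := ε / (‖y‖ + 1)) (by positivity)
      (α := (n + 1 + m - v * t) / s) (β := ((n : ℝ) + 1) ^ 2 / s) fun lam hlam => by
        have h2 := hK _ hKn (hκ n) lam hlam
        have h3 : (↑n + 1 + m - v * t) / s - (↑n + 1) ^ 2 / s / (lam - (m - (↑n + 1))) =
            (↑n + 1 + m - (↑n + 1) ^ 2 / (lam - m + (↑n + 1)) - v * t) / s := by
          rw [show lam - (m - ((n : ℝ) + 1)) = lam - m + (n + 1) by ring]
          ring
        rwa [h3]
    rw [dist_eq_norm]
    have h2 := ContinuousLinearMap.le_of_opNorm_le _ h1 y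
    refine h2.trans_lt ?_
    rw [div_mul_eq_mul_div, div_lt_iff₀ (by positivity)]
    nlinarith [norm_nonneg y]

section Iterate

variable {H Φ : 𝓗 →ₗ.[ℂ] 𝓗} {s : ℝ} {A T : 𝓗 →L[ℂ] 𝓗}

theorem IsRegularization.norm_sandwich_le (h : IsRegularization H Φ s A T) (C : 𝓗 →L[ℂ] 𝓗)
    (k : ℕ) : ‖T ^ k * C * T ^ k‖ ≤ ‖C‖ := by
  have hT : ‖T ^ k‖ ≤ 1 := by
    induction k with
    | zero => exact ContinuousLinearMap.norm_id_le
    | succ k ih =>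
      rw [pow_succ]
      exact (norm_mul_le _ _).trans (mul_le_one₀ ih (norm_nonneg _) h.norm_le_one)
  calc ‖T ^ k * C * T ^ k‖ ≤ ‖T ^ k * C‖ * ‖T ^ k‖ := norm_mul_le _ _
    _ ≤ ‖T ^ k‖ * ‖C‖ * ‖T ^ k‖ := by gcongr; exact norm_mul_le _ _
    _ ≤ 1 * ‖C‖ * 1 := by gcongr
    _ = ‖C‖ := by ring

theorem IsRegularization.ad_sandwich (h : IsRegularization H Φ s A T) {B C : 𝓗 →L[ℂ] 𝓗}
    (hC : IsBddCommutator Φ B C) (k : ℕ) :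
    ad A A (((s⁻¹ : ℝ) : ℂ) ^ k • (T ^ k * B * T ^ k)) =
      ((s⁻¹ : ℝ) : ℂ) ^ (k + 1) • (T ^ (k + 1) * C * T ^ (k + 1)) := by
  have h1 := h.mul_sub_mul B C hC
  have h2 := (h.commute.pow_right k).eq
  have h3 : A * (T ^ k * (B * T ^ k)) = T ^ k * (A * (B * T ^ k)) := by
    rw [← mul_assoc, h2, mul_assoc]
  change A * (_ • _) - (_ • _) * A = _
  rw [mul_smul_comm, smul_mul_assoc, ← smul_sub, pow_succ _ k, mul_smul]
  congr 1
  calc A * (T ^ k * B * T ^ k) - T ^ k * B * T ^ k * A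
      = (A * T ^ k) * B * T ^ k - T ^ k * B * (T ^ k * A) := by simp only [mul_assoc]
    _ = T ^ k * (A * B - B * A) * T ^ k := by
        rw [← h2]; simp only [mul_assoc, mul_sub, sub_mul]; rw [h3]
    _ = ((s⁻¹ : ℝ) : ℂ) • (T ^ (k + 1) * C * T ^ (k + 1)) := by
        rw [h1, mul_smul_comm, smul_mul_assoc, pow_succ T k]
        congr 1
        rw [← pow_succ T k, pow_succ T k]
        simp only [mul_assoc]
        rw [← pow_succ', pow_succ]

/-- Since `T` commutes with `A`, the factors `T` accumulate outside the commutators with `Φ`. -/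
theorem IsRegularization.iterate_ad (h : IsRegularization H Φ s A T) {B : 𝓗 →L[ℂ] 𝓗} (k : ℕ)
    {C : 𝓗 →L[ℂ] 𝓗} (hC : IsAd Φ B k C) :
    (ad A A)^[k] B = ((s⁻¹ : ℝ) : ℂ) ^ k • (T ^ k * C * T ^ k) := by
  induction k generalizing C with
  | zero =>
    have : C = B := hC
    simp [this]
  | succ k ih =>
    obtain ⟨B', hB', hC'⟩ := hC
    rw [Function.iterate_succ_apply', ih hB', h.ad_sandwich hC']

theorem IsRegularization.iterate_ad_unbdd (h : IsRegularization H Φ s A T)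
    {C₁ : 𝓗 →L[ℂ] 𝓗} (huniq : ∀ C, IsCommutator Φ H C → C = C₁) (k : ℕ) {C : 𝓗 →L[ℂ] 𝓗}
    (hC : IsAdUnbdd Φ H (k + 1) C) :
    (ad A A)^[k] (((s⁻¹ : ℝ) : ℂ) • (T * C₁ * T)) =
      ((s⁻¹ : ℝ) : ℂ) ^ (k + 1) • (T ^ (k + 1) * C * T ^ (k + 1)) := by
  induction k generalizing C with
  | zero => simp [huniq C hC]
  | succ k ih =>
    obtain ⟨B', hB', hC'⟩ := hC
    rw [Function.iterate_succ_apply', ih hB', h.ad_sandwich hC']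

end Iterate

end Regularization

/-! ### Columns of operators -/

section Column

variable {𝓗 : Type*} [NormedAddCommGroup 𝓗] [InnerProductSpace ℂ 𝓗]

/-- The operator `x ↦ (B₁ x, …, B_N x)` into the Hilbert sum of `N` copies of `𝓗`. -/
noncomputable def column {N : ℕ} (B : Fin N → 𝓗 →L[ℂ] 𝓗) :
    𝓗 →L[ℂ] PiLp 2 (fun _ : Fin N => 𝓗) :=
  (PiLp.continuousLinearEquiv 2 ℂ (fun _ : Fin N => 𝓗)).symm.toContinuousLinearMap ∘L
    ContinuousLinearMap.pi B

theorem inner_column {N : ℕ} (B C : Fin N → 𝓗 →L[ℂ] 𝓗) (x y : 𝓗) :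
    ⟪column B x, column C y⟫_ℂ = ∑ i, ⟪B i x, C i y⟫_ℂ := PiLp.inner_apply _ _

theorem norm_column_apply_sq {N : ℕ} (B : Fin N → 𝓗 →L[ℂ] 𝓗) (x : 𝓗) :
    ‖column B x‖ ^ 2 = ∑ i, ‖B i x‖ ^ 2 := PiLp.norm_sq_eq_of_L2 _ _

theorem norm_column_sq_le_of_forall {N : ℕ} {B : Fin N → 𝓗 →L[ℂ] 𝓗} {c : ℝ} (hc : 0 ≤ c)
    (h : ∀ x, ∑ i, ‖B i x‖ ^ 2 ≤ c * ‖x‖ ^ 2) : ‖column B‖ ^ 2 ≤ c := by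
  have h1 : ‖column B‖ ≤ √c := by
    refine ContinuousLinearMap.opNorm_le_bound _ (Real.sqrt_nonneg c) fun x => ?_
    refine le_of_sq_le_sq ?_ (by positivity)
    rw [norm_column_apply_sq, mul_pow, Real.sq_sqrt hc]
    exact h x
  calc ‖column B‖ ^ 2 ≤ √c ^ 2 := by gcongr
    _ = c := Real.sq_sqrt hc

theorem norm_column_sq_le {N : ℕ} (B : Fin N → 𝓗 →L[ℂ] 𝓗) : ‖column B‖ ^ 2 ≤ ∑ i, ‖B i‖ ^ 2 := by
  refine norm_column_sq_le_of_forall (by positivity) fun x => ?_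
  rw [Finset.sum_mul]
  refine Finset.sum_le_sum fun i _ => ?_
  rw [← mul_pow]
  gcongr
  exact (B i).le_opNorm x

variable [CompleteSpace 𝓗]

variable (𝓗) in
/-- The operator acting by `A` on each of `N` copies of `𝓗`. -/
noncomputable def diagonal (N : ℕ) : (𝓗 →L[ℂ] 𝓗) →⋆ₐ[ℂ]
    (PiLp 2 (fun _ : Fin N => 𝓗) →L[ℂ] PiLp 2 (fun _ : Fin N => 𝓗)) where
  toFun A := (PiLp.continuousLinearEquiv 2 ℂ (fun _ : Fin N => 𝓗)).symm.toContinuousLinearMap ∘L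
    ContinuousLinearMap.pi fun i => A ∘L PiLp.proj 2 (fun _ : Fin N => 𝓗) i
  map_one' := rfl
  map_mul' A B := rfl
  map_zero' := rfl
  map_add' A B := rfl
  commutes' c := rfl
  map_star' A := by
    rw [ContinuousLinearMap.star_eq_adjoint, ContinuousLinearMap.star_eq_adjoint,
      ContinuousLinearMap.eq_adjoint_iff]
    intro x y
    rw [PiLp.inner_apply, PiLp.inner_apply]
    exact Finset.sum_congr rfl fun i _ => ContinuousLinearMap.adjoint_inner_left A _ _

theorem cfc_diagonal {f : ℝ → ℝ} (hf : Continuous f) {A : 𝓗 →L[ℂ] 𝓗} (hA : IsSelfAdjoint A)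
    (N : ℕ) : cfc f (diagonal 𝓗 N A) = diagonal 𝓗 N (cfc f A) :=
  (StarAlgHom.map_cfc (diagonal 𝓗 N) f A hf.continuousOn (map_continuous _) hA (hA.map _)).symm

theorem iterate_ad_column {N : ℕ} (A : 𝓗 →L[ℂ] 𝓗) (B : Fin N → 𝓗 →L[ℂ] 𝓗) (k : ℕ) :
    (ad (diagonal 𝓗 N A) A)^[k] (column B) = column fun i => (ad A A)^[k] (B i) := by
  induction k generalizing B with
  | zero => rfl
  | succ k ih =>
    have h1 : ad (diagonal 𝓗 N A) A (column B) = column fun i => ad A A (B i) := rfl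
    rw [Function.iterate_succ_apply, h1, ih]
    simp only [Function.iterate_succ_apply]

theorem sum_norm_sq_le_of_strongSum {W : ℕ → 𝓗 →L[ℂ] 𝓗} {S : 𝓗 →L[ℂ] 𝓗}
    (hS : StrongSum (fun j => (W j).adjoint ∘L W j) S) (N : ℕ) (x : 𝓗) :
    ∑ j ∈ Finset.range N, ‖W j x‖ ^ 2 ≤ ‖S‖ * ‖x‖ ^ 2 := by
  have h1 : Tendsto (fun n => ∑ j ∈ Finset.range n, ‖W j x‖ ^ 2) atTop
      (𝓝 (⟪x, S x⟫_ℂ).re) := by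
    refine ((Complex.continuous_re.tendsto _).comp
      (Tendsto.inner (𝕜 := ℂ) tendsto_const_nhds (hS x))).congr fun n => ?_
    simp only [Function.comp_apply, inner_sum, re_sum]
    refine Finset.sum_congr rfl fun j _ => ?_
    rw [ContinuousLinearMap.comp_apply, ContinuousLinearMap.adjoint_inner_right,
      inner_self_eq_norm_sq_to_K, ← RCLike.ofReal_pow]
    exact ofReal_re _
  have hmono : Monotone fun n => ∑ j ∈ Finset.range n, ‖W j x‖ ^ 2 :=
    monotone_nat_of_le_succ fun n => by
      rw [Finset.sum_range_succ]
      exact le_add_of_nonneg_right (sq_nonneg _)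
  refine (hmono.ge_of_tendsto h1 N).trans ((re_le_norm _).trans
    ((norm_inner_le_norm (𝕜 := ℂ) x (S x)).trans ?_))
  have := S.le_opNorm x
  nlinarith [norm_nonneg x]

/-- The comparison of the two jump terms, for finitely many jump operators and a regularization of
`Φ`. The estimate for a single operator is applied to the column of the `W_j`: the resulting bounds
involve sums over `j` only, and not the number of operators. -/
theorem IsRegularization.norm_sum_inner_commutator_sub_le {H Φ : 𝓗 →ₗ.[ℂ] 𝓗} {s : ℝ} (hs : 0 < s)
    {A T : 𝓗 →L[ℂ] 𝓗} (hreg : IsRegularization H Φ s A T) {δ : ℝ} {χ u g : ℝ → ℝ}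
    (hχ : χ ∈ cutoffs δ) (h : CutoffData χ u g) {W : ℕ → 𝓗 →L[ℂ] 𝓗} {S : 𝓗 →L[ℂ] 𝓗}
    (hS : StrongSum (fun j => (W j).adjoint ∘L W j) S) (p : ℕ) {D : ℕ → 𝓗 →L[ℂ] 𝓗}
    (hD : ∀ j, IsBddCommutator Φ (W j) (D j)) {C : ℕ → ℕ → 𝓗 →L[ℂ] 𝓗}
    (hC : ∀ k ≤ p, ∀ j, IsAd Φ (W j) (k + 2) (C k j)) {μ : ℕ → ℝ} (hμ₀ : ∀ k ≤ p, ‖S‖ ≤ μ k)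
    (hμ : ∀ k ≤ p, ∀ N, ∑ j ∈ Finset.range N, ‖C k j‖ ^ 2 ≤ μ k) (N : ℕ) (φ : 𝓗) :
    ‖∑ j ∈ Finset.range N, (⟪W j φ, cfc χ A (W j φ) - W j (cfc χ A φ)⟫_ℂ -
        ((s⁻¹ : ℝ) : ℂ) * ⟪W j (cfc u A φ), T (D j (T (cfc u A φ)))⟫_ℂ)‖ ≤
      ∑ k ∈ Finset.range p, μ k / s ^ (k + 2) * (jumpWeight χ u k * ‖cfc g A φ‖ ^ 2) +
        jumpConst χ u g p * (μ p / s ^ (p + 2)) * ‖φ‖ ^ 2 := by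
  have hA := hreg.isSelfAdjoint_left
  have hA₂ : IsSelfAdjoint (diagonal 𝓗 N A) := hA.map _
  obtain ⟨ψ, hψ, hψχ, hψm⟩ := exists_test_eq_cutoff hχ
    (max (‖A‖ * ‖(1 : 𝓗 →L[ℂ] 𝓗)‖)
      (‖diagonal 𝓗 N A‖ * ‖(1 : PiLp 2 (fun _ : Fin N => 𝓗) →L[ℂ] PiLp 2 (fun _ : Fin N => 𝓗))‖))
  have h1 := h.norm_inner_commutator_sub_le hA₂ hA (column fun j : Fin N => W j) hψ
    (fun x hx => hψχ x ((spectrum.norm_le_norm_mul_of_mem hx).trans (le_max_right _ _)))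
    (fun x hx => hψχ x ((spectrum.norm_le_norm_mul_of_mem hx).trans (le_max_left _ _))) p
    (hψm _) hs (μ := μ) (fun k hk => ?_) (fun k hk => ?_) φ
  · convert h1 using 2
    rw [cfc_diagonal h.smooth.continuous hA]
    have e1 : diagonal 𝓗 N (cfc χ A) (column (fun j : Fin N => W j) φ) -
        column (fun j : Fin N => W j) (cfc χ A φ) =
        column (fun j : Fin N => cfc χ A ∘L W j - W j ∘L cfc χ A) φ := rfl
    have e2 := iterate_ad_column A (fun j : Fin N => W j) 1
    simp only [Function.iterate_one] at e2
    rw [e1, e2, inner_column, inner_column, ← Finset.sum_sub_distrib, Finset.sum_range]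
    refine Finset.sum_congr rfl fun j _ => ?_
    have e3 := hreg.mul_sub_mul _ _ (hD j)
    have e4 : ad A A (W j) = A * W j - W j * A := rfl
    rw [e4, e3, smul_apply, inner_smul_right]
    rfl
  · refine (norm_column_sq_le_of_forall (norm_nonneg S) fun x => ?_).trans (hμ₀ k hk)
    rw [← Finset.sum_range fun j => ‖W j x‖ ^ 2]
    exact sum_norm_sq_le_of_strongSum hS N x
  · rw [iterate_ad_column, mul_pow]
    refine le_trans ?_ (hμ k hk N)
    rw [← le_div_iff₀' (by positivity), Finset.sum_div, Finset.sum_range]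
    refine (norm_column_sq_le _).trans (Finset.sum_le_sum fun j _ => ?_)
    rw [hreg.iterate_ad _ (hC k hk j), norm_smul, norm_pow, Complex.norm_real, norm_inv,
      Real.norm_of_nonneg hs.le, ← div_pow]
    gcongr
    rw [inv_pow, inv_mul_eq_div]
    gcongr
    exact hreg.norm_sandwich_le _ _

end Column

/-! ### Removal of the regularization -/

section Limit

variable {𝓗 : Type*} [NormedAddCommGroup 𝓗] [InnerProductSpace ℂ 𝓗]

theorem tendsto_apply_of_tendsto {T : ℕ → 𝓗 →L[ℂ] 𝓗} {c : ℝ} (hc : ∀ n, ‖T n‖ ≤ c) {x y : 𝓗}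
    {a : ℕ → 𝓗} (ha : Tendsto a atTop (𝓝 x)) (hx : Tendsto (fun n => T n x) atTop (𝓝 y)) :
    Tendsto (fun n => T n (a n)) atTop (𝓝 y) := by
  have h1 : Tendsto (fun n => T n (a n - x)) atTop (𝓝 0) := by
    refine squeeze_zero_norm (fun n => (T n).le_of_opNorm_le (hc n) _) ?_
    have := ((ha.sub_const x).norm.const_mul c)
    simpa using this
  have h2 := h1.add hx
  rw [zero_add] at h2
  refine h2.congr fun n => ?_
  rw [← map_add, sub_add_cancel]

variable [CompleteSpace 𝓗]

/-- Bounded commutators with a self-adjoint operator persist under strong limits, if they are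
uniformly bounded. -/
theorem exists_isDomainCommutator_of_tendsto {H : 𝓗 →ₗ.[ℂ] 𝓗} (hH : IsSelfAdjoint H)
    {X K : ℕ → 𝓗 →L[ℂ] 𝓗} {Y : 𝓗 →L[ℂ] 𝓗} {c : ℝ} (hc : ∀ n, ‖K n‖ ≤ c)
    (hX : ∀ x, Tendsto (fun n => X n x) atTop (𝓝 (Y x)))
    (hK : ∀ n, IsDomainCommutator H (X n) (K n)) :
    ∃ L : 𝓗 →L[ℂ] 𝓗, IsDomainCommutator H Y L ∧
      ∀ u : H.domain, Tendsto (fun n => ⟪(u : 𝓗), K n u⟫_ℂ) atTop (𝓝 ⟪(u : 𝓗), L u⟫_ℂ) := by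
  have hc0 : 0 ≤ c := (norm_nonneg _).trans (hc 0)
  have hform : ∀ u v : H.domain, Tendsto (fun n => ⟪(u : 𝓗), K n v⟫_ℂ) atTop
      (𝓝 (⟪H u, Y v⟫_ℂ - ⟪(u : 𝓗), Y (H v)⟫_ℂ)) := fun u v =>
    ((tendsto_const_nhds.inner (hX v)).sub (tendsto_const_nhds.inner (hX (H v)))).congr
      fun n => (hK n).isBddCommutator hH u v
  have hbd : ∀ u v : H.domain,
      ‖⟪H u, Y v⟫_ℂ - ⟪(u : 𝓗), Y (H v)⟫_ℂ‖ ≤ c * ‖(v : 𝓗)‖ * ‖(u : 𝓗)‖ := fun u v => by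
    refine le_of_tendsto (hform u v).norm (Eventually.of_forall fun n => ?_)
    refine (norm_inner_le_norm _ _).trans ?_
    rw [mul_comm]
    gcongr
    exact (K n).le_of_opNorm_le (hc n) _
  have hmem : ∀ v : H.domain, Y v ∈ H.domain := fun v => by
    have h1 : Y v ∈ H.adjoint.domain := by
      rw [LinearPMap.mem_adjoint_domain_iff]
      refine AddMonoidHomClass.continuous_of_bound _ (c * ‖(v : 𝓗)‖ + ‖Y (H v)‖) fun u => ?_
      have h2 := hbd u v
      have h3 : ‖⟪(u : 𝓗), Y (H v)⟫_ℂ‖ ≤ ‖(u : 𝓗)‖ * ‖Y (H v)‖ := norm_inner_le_norm _ _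
      have h4 : ‖⟪Y v, H u⟫_ℂ‖ = ‖⟪H u, Y v⟫_ℂ‖ := norm_inner_symm _ _
      change ‖⟪Y v, H u⟫_ℂ‖ ≤ _ * ‖(u : 𝓗)‖
      have h5 := norm_sub_norm_le ⟪H u, Y v⟫_ℂ ⟪(u : 𝓗), Y (H v)⟫_ℂ
      rw [h4, add_mul]
      linarith
    rwa [LinearPMap.isSelfAdjoint_def.mp hH] at h1
  let L₀ : H.domain →ₗ[ℂ] 𝓗 :=
    { toFun := fun v => H ⟨Y v, hmem v⟩ - Y (H v)
      map_add' := fun v w => by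
        have : (⟨Y ((v + w : H.domain) : 𝓗), hmem (v + w)⟩ : H.domain) =
            ⟨Y v, hmem v⟩ + ⟨Y w, hmem w⟩ := Subtype.ext (by simp)
        rw [this, LinearPMap.map_add, LinearPMap.map_add, map_add]
        abel
      map_smul' := fun a v => by
        have : (⟨Y ((a • v : H.domain) : 𝓗), hmem (a • v)⟩ : H.domain) =
            a • ⟨Y v, hmem v⟩ := Subtype.ext (by simp)
        rw [this, LinearPMap.map_smul, LinearPMap.map_smul, map_smul, smul_sub]
        rfl }
  have hL₀ : ∀ v, L₀ v = H ⟨Y v, hmem v⟩ - Y (H v) := fun v => rfl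
  have hL₀form : ∀ u v : H.domain, ⟪(u : 𝓗), L₀ v⟫_ℂ = ⟪H u, Y v⟫_ℂ - ⟪(u : 𝓗), Y (H v)⟫_ℂ :=
    fun u v => by rw [hL₀, inner_sub_right, inner_symm hH u ⟨Y v, hmem v⟩]
  have hL₀bd : ∀ v : H.domain, ‖L₀ v‖ ≤ c * ‖H.domain.subtype v‖ := fun v => by
    have h1 : ∀ x : 𝓗, ‖⟪x, L₀ v⟫_ℂ‖ ≤ c * ‖(v : 𝓗)‖ * ‖x‖ := fun x => by
      refine isClosed_property hH.dense_domain.denseRange_val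
        (p := fun x : 𝓗 => ‖⟪x, L₀ v⟫_ℂ‖ ≤ c * ‖(v : 𝓗)‖ * ‖x‖)
        (isClosed_le (by fun_prop) (by fun_prop)) (fun u => ?_) x
      rw [hL₀form]
      exact hbd u v
    have h2 := h1 (L₀ v)
    rw [inner_self_eq_norm_sq_to_K, norm_pow, RCLike.norm_ofReal, abs_norm, sq] at h2
    rcases (norm_nonneg (L₀ v)).eq_or_lt with h | h
    · rw [← h]; positivity
    · exact le_of_mul_le_mul_right h2 h
  have hdense : DenseRange H.domain.subtype := hH.dense_domain.denseRange_val
  have hL : ∀ v : H.domain, L₀.extendOfNorm H.domain.subtype (v : 𝓗) = L₀ v := fun v =>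
    LinearMap.extendOfNorm_eq hdense ⟨c, hL₀bd⟩ v
  refine ⟨L₀.extendOfNorm H.domain.subtype, fun v => ⟨hmem v, hL v⟩, fun u => ?_⟩
  rw [hL, hL₀form]
  exact hform u u

theorem IsTest.exists_abs_le {f : ℝ → ℝ} (hf : IsTest f) : ∃ M, ∀ x, |f x| ≤ M :=
  ⟨supNorm f, hf.abs_le_supNorm⟩

theorem IsApproximation.isSelfAdjoint_fts {H Φ : 𝓗 →ₗ.[ℂ] 𝓗} {v t s : ℝ} {A T : ℕ → 𝓗 →L[ℂ] 𝓗}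
    (h : IsApproximation H Φ v t s A T) {f : ℝ → ℝ} (hf : Continuous f)
    (hM : ∃ M, ∀ x, |f x| ≤ M) : IsSelfAdjoint (fts Φ f v t s) := by
  rw [ContinuousLinearMap.isSelfAdjoint_iff_isSymmetric]
  intro x y
  refine tendsto_nhds_unique ((h.tendsto_cfc f hf hM x).inner tendsto_const_nhds)
    ((tendsto_const_nhds.inner (h.tendsto_cfc f hf hM y)).congr fun n => ?_)
  exact (inner_cfc_left f (A n) x y).symm

theorem IsApproximation.inner_fts_const_mul_sq {H Φ : 𝓗 →ₗ.[ℂ] 𝓗} {v t s : ℝ}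
    {A T : ℕ → 𝓗 →L[ℂ] 𝓗} (h : IsApproximation H Φ v t s A T) {g : ℝ → ℝ} (hg : IsTest g) (a : ℝ)
    (x : 𝓗) : ⟪x, fts Φ (fun r => a * (g r * g r)) v t s x⟫_ℂ =
      ((a * ‖fts Φ g v t s x‖ ^ 2 : ℝ) : ℂ) := by
  have hgc := hg.continuous
  have hM : ∃ M, ∀ r, |a * (g r * g r)| ≤ M := ((hg.mul hg).const_mul a).exists_abs_le
  have h1 := (tendsto_const_nhds (x := x)).inner
    (h.tendsto_cfc (fun r => a * (g r * g r)) (by fun_prop) hM x) (𝕜 := ℂ)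
  have h2 : Tendsto (fun n => ((a * ‖cfc g (A n) x‖ ^ 2 : ℝ) : ℂ)) atTop
      (𝓝 ((a * ‖fts Φ g v t s x‖ ^ 2 : ℝ) : ℂ)) :=
    (continuous_ofReal.tendsto _).comp
      (((h.tendsto_cfc g hgc hg.exists_abs_le x).norm.pow 2).const_mul a)
  refine tendsto_nhds_unique h1 (h2.congr fun n => ?_)
  have hA := (h.isRegularization n).isSelfAdjoint_left
  rw [cfc_const_mul a _ (A n) (by fun_prop), cfc_mul g g (A n) (by fun_prop) (by fun_prop),
    smul_apply, ← Complex.coe_smul, inner_smul_right]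
  change _ = (a : ℂ) * ⟪x, cfc g (A n) (cfc g (A n) x)⟫_ℂ
  rw [← inner_cfc_left, inner_self_eq_norm_sq_to_K]
  push_cast
  rfl

/-- The commutator of `H` with `χ_ts` is bounded, and it is compared with its leading term. -/
theorem IsApproximation.exists_commutator_estimate {H Φ : 𝓗 →ₗ.[ℂ] 𝓗} (hH : IsSelfAdjoint H)
    {v t s : ℝ} (hs : 0 < s) {A T : ℕ → 𝓗 →L[ℂ] 𝓗} (happ : IsApproximation H Φ v t s A T) {δ : ℝ}
    {χ u g : ℝ → ℝ} (hχ : χ ∈ cutoffs δ) (h : CutoffData χ u g) (p : ℕ) {C : ℕ → 𝓗 →L[ℂ] 𝓗}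
    (huniq : ∀ C', IsCommutator Φ H C' → C' = C 0)
    (hC : ∀ k ≤ p + 1, IsAdUnbdd Φ H (k + 1) (C k)) {ν : ℕ → ℝ} (hν : ∀ k ≤ p, ‖C (k + 1)‖ ≤ ν k) :
    ∃ K : 𝓗 →L[ℂ] 𝓗, IsDomainCommutator H (fts Φ χ v t s) K ∧ ∀ φ,
      ‖⟪φ, K φ⟫_ℂ + ((s⁻¹ : ℝ) : ℂ) * ⟪fts Φ u v t s φ, C 0 (fts Φ u v t s φ)⟫_ℂ‖ ≤
        ∑ k ∈ Finset.range p, ν k / s ^ (k + 2) *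
          (supNorm (symCoeff χ u k) * ‖fts Φ g v t s φ‖ ^ 2) +
        symConst χ u g p * (ν p / s ^ (p + 2)) * ‖φ‖ ^ 2 := by
  have hC0 : IsCommutator Φ H (C 0) := hC 0 (Nat.zero_le _)
  -- the estimate for the regularizations; the bound on `K` has to be uniform in `n`
  have hex : ∀ n, ∃ K : 𝓗 →L[ℂ] 𝓗, ‖K‖ ≤ 2 * ftMoment 0 (deriv χ) * (s⁻¹ * ‖C 0‖) ∧
      IsDomainCommutator H (cfc χ (A n)) K ∧ ∀ φ,
      ‖⟪φ, K φ⟫_ℂ +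
          ((s⁻¹ : ℝ) : ℂ) * ⟪T n (cfc u (A n) φ), C 0 (T n (cfc u (A n) φ))⟫_ℂ‖ ≤
        ∑ k ∈ Finset.range p, ν k / s ^ (k + 2) *
          (supNorm (symCoeff χ u k) * ‖cfc g (A n) φ‖ ^ 2) +
        symConst χ u g p * (ν p / s ^ (p + 2)) * ‖φ‖ ^ 2 := fun n => by
    have hreg := happ.isRegularization n
    have hA := hreg.isSelfAdjoint_left
    obtain ⟨Y, hY, hYH⟩ := (hreg.isDomainCommutator _ hC0).exists_increment hH
    rw [neg_neg] at hY
    -- a test function which equals `χ` near the spectrum of `A n`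
    obtain ⟨ψ, hψ, hψχ, hψm⟩ := exists_test_eq_cutoff hχ (‖A n‖ * ‖(1 : 𝓗 →L[ℂ] 𝓗)‖)
    have hψχ' : ∀ x ∈ spectrum ℝ (A n), ψ =ᶠ[𝓝 x] χ := fun x hx =>
      hψχ x (spectrum.norm_le_norm_mul_of_mem hx)
    have hcfc : cfc ψ (A n) = cfc χ (A n) := cfc_congr fun x hx => (hψχ' x hx).eq_of_nhds
    have hnormC : ‖((s⁻¹ : ℝ) : ℂ) • (T n * C 0 * T n)‖ ≤ s⁻¹ * ‖C 0‖ := by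
      have h1 := hreg.norm_sandwich_le (C 0) 1
      rw [pow_one] at h1
      rw [norm_smul, Complex.norm_real, Real.norm_of_nonneg (inv_nonneg.mpr hs.le)]
      gcongr
    refine ⟨incr (A n) ψ Y, ?_, hcfc ▸ isDomainCommutator_incr hH hA hY hYH hψ, fun φ => ?_⟩
    · have h1 := norm_incr_sub_le hψ hA hA hY 0
      simp only [Finset.range_zero, Finset.sum_empty, sub_zero, zero_add, Nat.factorial_one,
        Nat.cast_one, div_one, Function.iterate_zero, id_eq] at h1
      exact h1.trans (mul_le_mul (hψm 0) hnormC (norm_nonneg _)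
        (mul_nonneg zero_le_two (ftMoment_nonneg _ _)))
    · have h1 := h.norm_inner_incr_add_le hA hY hψ hψχ' p (hψm _)
        (ν := fun k => ν k / s ^ (k + 2)) (fun k hk => ?_) φ
      · convert h1 using 3
        rw [add_apply, inner_add_right]
        congr 1
        simp only [ContinuousLinearMap.comp_apply, smul_apply, map_smul, inner_smul_right]
        congr 1
        change _ = ⟪φ, cfc u (A n) (T n (C 0 (T n (cfc u (A n) φ))))⟫_ℂ
        rw [← inner_cfc_left]
        exact hreg.isSelfAdjoint_right.isSymmetric _ _
      · rw [hreg.iterate_ad_unbdd huniq (k + 1) (hC (k + 1) (by omega)), norm_smul, norm_pow,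
          Complex.norm_real, Real.norm_of_nonneg (inv_nonneg.mpr hs.le), inv_pow, inv_mul_eq_div]
        gcongr
        exact (hreg.norm_sandwich_le _ _).trans (hν k hk)
  choose K hKn hKH hKφ using hex
  have hχM := abs_cutoff_le hχ
  obtain ⟨L, hL, hLlim⟩ := exists_isDomainCommutator_of_tendsto hH hKn
    (happ.tendsto_cfc χ h.smooth.continuous hχM) hKH
  refine ⟨L, hL, fun φ => ?_⟩
  -- both sides are continuous in `φ`, and `K n φ` converges for `φ ∈ D(H)`
  refine isClosed_property hH.dense_domain.denseRange_val
    (p := fun φ : 𝓗 => ‖⟪φ, L φ⟫_ℂ +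
        ((s⁻¹ : ℝ) : ℂ) * ⟪fts Φ u v t s φ, C 0 (fts Φ u v t s φ)⟫_ℂ‖ ≤
      ∑ k ∈ Finset.range p, ν k / s ^ (k + 2) *
        (supNorm (symCoeff χ u k) * ‖fts Φ g v t s φ‖ ^ 2) +
      symConst χ u g p * (ν p / s ^ (p + 2)) * ‖φ‖ ^ 2)
    (isClosed_le (by fun_prop) (by fun_prop)) (fun φ => ?_) φ
  have hu := happ.tendsto_cfc u h.u_test.continuous h.u_test.exists_abs_le φ
  have hg := happ.tendsto_cfc g h.g_test.continuous h.g_test.exists_abs_le φ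
  have hTu := tendsto_apply_of_tendsto (fun n => (happ.isRegularization n).norm_le_one) hu
    (happ.tendsto_right _)
  have hCTu := ((C 0).continuous.tendsto _).comp hTu
  refine le_of_tendsto_of_tendsto
    ((hLlim φ).add ((hTu.inner hCTu).const_mul ((s⁻¹ : ℝ) : ℂ))).norm
    ((tendsto_finsetSum _ fun k _ =>
      (((hg.norm.pow 2).const_mul (supNorm (symCoeff χ u k))).const_mul
        (ν k / s ^ (k + 2)))).add_const
        (symConst χ u g p * (ν p / s ^ (p + 2)) * ‖(φ : 𝓗)‖ ^ 2))
    (Eventually.of_forall fun n => hKφ n φ)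

/-- The comparison of the two jump terms, for finitely many jump operators. -/
theorem IsApproximation.norm_sum_inner_commutator_sub_le {H Φ : 𝓗 →ₗ.[ℂ] 𝓗} {v t s : ℝ}
    (hs : 0 < s) {A T : ℕ → 𝓗 →L[ℂ] 𝓗} (happ : IsApproximation H Φ v t s A T) {δ : ℝ}
    {χ u g : ℝ → ℝ} (hχ : χ ∈ cutoffs δ) (h : CutoffData χ u g) {W : ℕ → 𝓗 →L[ℂ] 𝓗}
    {S : 𝓗 →L[ℂ] 𝓗} (hS : StrongSum (fun j => (W j).adjoint ∘L W j) S) (p : ℕ)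
    {D : ℕ → 𝓗 →L[ℂ] 𝓗} (hD : ∀ j, IsBddCommutator Φ (W j) (D j)) {C : ℕ → ℕ → 𝓗 →L[ℂ] 𝓗}
    (hC : ∀ k ≤ p, ∀ j, IsAd Φ (W j) (k + 2) (C k j)) {μ : ℕ → ℝ} (hμ₀ : ∀ k ≤ p, ‖S‖ ≤ μ k)
    (hμ : ∀ k ≤ p, ∀ N, ∑ j ∈ Finset.range N, ‖C k j‖ ^ 2 ≤ μ k) (N : ℕ) (φ : 𝓗) :
    ‖∑ j ∈ Finset.range N,
        (⟪W j φ, fts Φ χ v t s (W j φ) - W j (fts Φ χ v t s φ)⟫_ℂ -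
          ((s⁻¹ : ℝ) : ℂ) * ⟪W j (fts Φ u v t s φ), D j (fts Φ u v t s φ)⟫_ℂ)‖ ≤
      ∑ k ∈ Finset.range p, μ k / s ^ (k + 2) *
          (jumpWeight χ u k * ‖fts Φ g v t s φ‖ ^ 2) +
        jumpConst χ u g p * (μ p / s ^ (p + 2)) * ‖φ‖ ^ 2 := by
  have hχM := abs_cutoff_le hχ
  have hX := happ.tendsto_cfc χ h.smooth.continuous hχM
  have hu := happ.tendsto_cfc u h.u_test.continuous h.u_test.exists_abs_le φ
  have hg := happ.tendsto_cfc g h.g_test.continuous h.g_test.exists_abs_le φ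
  have hT1 := fun n => (happ.isRegularization n).norm_le_one
  have hTu := tendsto_apply_of_tendsto hT1 hu (happ.tendsto_right _)
  refine le_of_tendsto_of_tendsto (tendsto_finsetSum _ fun j _ => Tendsto.sub
      (tendsto_const_nhds.inner ((hX (W j φ)).sub (((W j).continuous.tendsto _).comp (hX φ))))
      (Tendsto.const_mul _ ((((W j).continuous.tendsto _).comp hu).inner
        (tendsto_apply_of_tendsto hT1 (((D j).continuous.tendsto _).comp hTu)
          (happ.tendsto_right _))))).norm
    ((tendsto_finsetSum _ fun k _ =>
      (((hg.norm.pow 2).const_mul (jumpWeight χ u k)).const_mul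
        (μ k / s ^ (k + 2)))).add_const (jumpConst χ u g p * (μ p / s ^ (p + 2)) * ‖φ‖ ^ 2))
    (Eventually.of_forall fun n => (happ.isRegularization n).norm_sum_inner_commutator_sub_le hs hχ
      h hS p hD hC hμ₀ hμ N φ)

end Limit

/-! ### Strong series and the jump part of the generator -/

section Jump

variable {𝓗 : Type*} [NormedAddCommGroup 𝓗] [InnerProductSpace ℂ 𝓗]

theorem sum_norm_comp_sq_le {B : ℕ → 𝓗 →L[ℂ] 𝓗} {b : ℝ}
    (hB : ∀ N x, ∑ j ∈ Finset.range N, ‖B j x‖ ^ 2 ≤ b * ‖x‖ ^ 2) (X : 𝓗 →L[ℂ] 𝓗) (N : ℕ)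
    (x : 𝓗) : ∑ j ∈ Finset.range N, ‖(X ∘L B j) x‖ ^ 2 ≤ ‖X‖ ^ 2 * b * ‖x‖ ^ 2 := by
  rw [mul_assoc]
  refine le_trans ?_ (mul_le_mul_of_nonneg_left (hB N x) (sq_nonneg _))
  rw [Finset.mul_sum]
  refine Finset.sum_le_sum fun j _ => ?_
  rw [← mul_pow]
  gcongr
  exact X.le_opNorm _

theorem StrongSum.tendsto_inner {T : ℕ → 𝓗 →L[ℂ] 𝓗} {G : 𝓗 →L[ℂ] 𝓗} (h : StrongSum T G) (x : 𝓗) :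
    Tendsto (fun N => ∑ j ∈ Finset.range N, ⟪x, T j x⟫_ℂ) atTop (𝓝 ⟪x, G x⟫_ℂ) :=
  (tendsto_const_nhds.inner (h x)).congr fun _ => inner_sum _ _ _

theorem le_of_inner_eq {R E : 𝓗 →L[ℂ] 𝓗} (r e : 𝓗 → ℝ) (hR : ∀ x, ⟪x, R x⟫_ℂ = r x)
    (hE : ∀ x, ⟪x, E x⟫_ℂ = e x) (h : ∀ x, r x ≤ e x) : R ≤ E := by
  rw [ContinuousLinearMap.le_def, ContinuousLinearMap.isPositive_iff_complex]
  intro x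
  have h1 : ⟪(E - R) x, x⟫_ℂ = ((e x - r x : ℝ) : ℂ) := by
    rw [← inner_conj_symm, sub_apply, inner_sub_right, hR, hE, ← ofReal_sub, conj_ofReal]
  rw [h1]
  exact ⟨rfl, sub_nonneg.mpr (h x)⟩

theorem le_and_neg_le_of_norm_inner_le {R E : 𝓗 →L[ℂ] 𝓗} (e : 𝓗 → ℝ)
    (hR : ∀ x, (⟪x, R x⟫_ℂ).im = 0) (hE : ∀ x, ⟪x, E x⟫_ℂ = e x)
    (h : ∀ x, ‖⟪x, R x⟫_ℂ‖ ≤ e x) : R ≤ E ∧ -R ≤ E := by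
  have h1 : ∀ x, ⟪x, R x⟫_ℂ = ((⟪x, R x⟫_ℂ).re : ℂ) := fun x =>
    Complex.ext rfl (by rw [hR, ofReal_im])
  refine ⟨le_of_inner_eq (fun x => (⟪x, R x⟫_ℂ).re) e h1 hE fun x =>
    (re_le_norm _).trans (h x), le_of_inner_eq (fun x => -(⟪x, R x⟫_ℂ).re) e (fun x => ?_) hE
    fun x => (neg_le_abs _).trans ((abs_re_le_norm _).trans (h x))⟩
  rw [neg_apply, inner_neg_right, h1 x, ofReal_neg, ofReal_re]

variable [CompleteSpace 𝓗]

theorem norm_sum_adjoint_comp_sq_le {B C : ℕ → 𝓗 →L[ℂ] 𝓗} {b : ℝ} (s : Finset ℕ)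
    (hB : ∀ x, ∑ j ∈ s, ‖B j x‖ ^ 2 ≤ b * ‖x‖ ^ 2) (x : 𝓗) :
    ‖∑ j ∈ s, (B j).adjoint (C j x)‖ ^ 2 ≤ b * ∑ j ∈ s, ‖C j x‖ ^ 2 := by
  set z := ∑ j ∈ s, (B j).adjoint (C j x) with hz
  have h1 : ‖z‖ ^ 2 ≤ ∑ j ∈ s, ‖B j z‖ * ‖C j x‖ := by
    have e1 : ⟪z, z⟫_ℂ = ∑ j ∈ s, ⟪B j z, C j x⟫_ℂ := by
      conv_lhs => rw [hz, inner_sum]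
      exact Finset.sum_congr rfl fun j _ => ContinuousLinearMap.adjoint_inner_right _ _ _
    have e2 : ‖z‖ ^ 2 = ‖⟪z, z⟫_ℂ‖ := by
      rw [inner_self_eq_norm_sq_to_K, norm_pow, RCLike.norm_ofReal, abs_norm]
    rw [e2, e1]
    exact (norm_sum_le _ _).trans (Finset.sum_le_sum fun j _ => norm_inner_le_norm _ _)
  have h2 := Finset.sum_mul_sq_le_sq_mul_sq s (fun j => ‖B j z‖) fun j => ‖C j x‖
  have h3 := hB z
  have h4 : 0 ≤ ∑ j ∈ s, ‖C j x‖ ^ 2 := by positivity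
  rcases (sq_nonneg ‖z‖).eq_or_lt with h | h
  · have h5 : 0 ≤ (∑ j ∈ s, ‖B j x‖ ^ 2) := by positivity
    rw [← h]
    have h6 := h5.trans (hB x)
    rcases (sq_nonneg ‖x‖).eq_or_lt with h7 | h7
    · have : x = 0 := by simpa using h7.symm
      simp [this]
    · exact mul_nonneg (by by_contra hb; nlinarith [mul_neg_of_neg_of_pos (not_le.mp hb) h7]) h4
  · have h5 : (‖z‖ ^ 2) ^ 2 ≤ b * ‖z‖ ^ 2 * ∑ j ∈ s, ‖C j x‖ ^ 2 :=
      (pow_le_pow_left₀ (sq_nonneg _) h1 2).trans (h2.trans (mul_le_mul_of_nonneg_right h3 h4))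
    refine le_of_mul_le_mul_right ?_ h
    linarith

/-- If `∑ B_j^* B_j` and `∑ C_j^* C_j` are bounded, then `∑ B_j^* C_j` converges strongly. -/
theorem exists_strongSum {B C : ℕ → 𝓗 →L[ℂ] 𝓗} {b c : ℝ}
    (hB : ∀ N x, ∑ j ∈ Finset.range N, ‖B j x‖ ^ 2 ≤ b * ‖x‖ ^ 2)
    (hC : ∀ N x, ∑ j ∈ Finset.range N, ‖C j x‖ ^ 2 ≤ c * ‖x‖ ^ 2) :
    ∃ G, StrongSum (fun j => (B j).adjoint ∘L C j) G := by
  have hlim : ∀ x, ∃ y, Tendsto (fun N => ∑ j ∈ Finset.range N, (B j).adjoint (C j x)) atTop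
      (𝓝 y) := fun x => by
    refine cauchySeq_tendsto_of_complete ?_
    set a : ℕ → ℝ := fun N => ∑ j ∈ Finset.range N, ‖C j x‖ ^ 2 with ha
    have hmono : Monotone a := monotone_nat_of_le_succ fun n => by
      simp only [ha, Finset.sum_range_succ]
      exact le_add_of_nonneg_right (sq_nonneg _)
    obtain ⟨L, hL⟩ : ∃ L, Tendsto a atTop (𝓝 L) :=
      ⟨_, tendsto_atTop_ciSup hmono ⟨c * ‖x‖ ^ 2, by rintro _ ⟨N, rfl⟩; exact hC N x⟩⟩
    have hstep : ∀ m n N, N ≤ m → m ≤ n →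
        ‖∑ j ∈ Finset.range n, (B j).adjoint (C j x) -
          ∑ j ∈ Finset.range m, (B j).adjoint (C j x)‖ ≤ √(|b| * (L - a N)) :=
      fun m n N hNm hmn => by
        rw [← Finset.sum_Ico_eq_sub _ hmn]
        refine Real.le_sqrt_of_sq_le ?_
        have h1 := norm_sum_adjoint_comp_sq_le (C := C) (b := |b|) (Finset.Ico m n) (fun y => by
          refine le_trans (Finset.sum_le_sum_of_subset_of_nonneg
            (fun j hj => Finset.mem_range.mpr (Finset.mem_Ico.mp hj).2) fun _ _ _ => sq_nonneg _)
            ((hB n y).trans ?_)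
          gcongr
          exact le_abs_self b) x
        rw [Finset.sum_Ico_eq_sub (fun j => ‖C j x‖ ^ 2) hmn] at h1
        refine h1.trans ?_
        have h2 := hmono.ge_of_tendsto hL n
        have h3 := hmono hNm
        exact mul_le_mul_of_nonneg_left (sub_le_sub h2 h3) (abs_nonneg b)
    refine cauchySeq_of_le_tendsto_0' (fun N => √(|b| * (L - a N))) (fun m n hmn => ?_) ?_
    · rw [dist_comm, dist_eq_norm]
      exact hstep m n m le_rfl hmn
    · have h1 : Tendsto (fun N => |b| * (L - a N)) atTop (𝓝 (|b| * (L - L))) :=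
        (hL.const_sub L).const_mul _
      have h2 := (Real.continuous_sqrt.tendsto _).comp h1
      rw [sub_self, mul_zero, Real.sqrt_zero] at h2
      exact h2
  choose G hG using hlim
  have hlim' : Tendsto (fun N x => (∑ j ∈ Finset.range N, (B j).adjoint ∘L C j) x) atTop (𝓝 G) := by
    rw [tendsto_pi_nhds]
    intro x
    refine (hG x).congr fun N => ?_
    rw [sum_apply]
    rfl
  exact ⟨continuousLinearMapOfTendsto _ hlim', fun x => hG x⟩

/-- For bounded `X`, the series of `G'(X)` converges strongly to
`∑ W_j^* X W_j - (S X + X S) / 2`. -/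
theorem exists_isGPrime {W : ℕ → 𝓗 →L[ℂ] 𝓗} {S : 𝓗 →L[ℂ] 𝓗}
    (hS : StrongSum (fun j => (W j).adjoint ∘L W j) S) (X : 𝓗 →L[ℂ] 𝓗) :
    ∃ G, IsGPrime W X G := by
  have hW := sum_norm_sq_le_of_strongSum hS
  obtain ⟨G, hG⟩ := exists_strongSum hW (sum_norm_comp_sq_le hW X)
  refine ⟨G - (1 / 2 : ℂ) • (S ∘L X + X ∘L S), fun x => ?_⟩
  have h1 := (hG x).sub (((hS (X x)).add ((X.continuous.tendsto _).comp (hS x))).const_smul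
    (1 / 2 : ℂ))
  refine h1.congr fun N => ?_
  simp only [Function.comp_apply, map_sum, ← Finset.sum_add_distrib, Finset.smul_sum,
    ← Finset.sum_sub_distrib]
  refine Finset.sum_congr rfl fun j _ => ?_
  simp only [ContinuousLinearMap.comp_apply, smul_apply, add_apply, sub_apply, map_sub]
  module

theorem IsBddCommutator.adjoint {Φ : 𝓗 →ₗ.[ℂ] 𝓗} {B D : 𝓗 →L[ℂ] 𝓗} (h : IsBddCommutator Φ B D) :
    IsBddCommutator Φ B.adjoint (-D.adjoint) := fun u v => by
  have h1 := congrArg (starRingEnd ℂ) (h v u)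
  rw [map_sub, inner_conj_symm, inner_conj_symm, inner_conj_symm] at h1
  rw [neg_apply, inner_neg_right, ContinuousLinearMap.adjoint_inner_right,
    ContinuousLinearMap.adjoint_inner_right, ContinuousLinearMap.adjoint_inner_right, ← h1]
  ring

theorem exists_isGPrimeUnbdd {Φ : 𝓗 →ₗ.[ℂ] 𝓗} {W D : ℕ → 𝓗 →L[ℂ] 𝓗} {b d : ℝ}
    (hW : ∀ N x, ∑ j ∈ Finset.range N, ‖W j x‖ ^ 2 ≤ b * ‖x‖ ^ 2)
    (hD : ∀ j, IsBddCommutator Φ (W j) (D j))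
    (hDd : ∀ N x, ∑ j ∈ Finset.range N, ‖D j x‖ ^ 2 ≤ d * ‖x‖ ^ 2) :
    ∃ G, IsGPrimeUnbdd W Φ G ∧
      StrongSum (fun j => (1 / 2 : ℂ) •
        ((W j).adjoint ∘L D j + (D j).adjoint ∘L W j)) G := by
  obtain ⟨G₁, hG₁⟩ := exists_strongSum hW hDd
  obtain ⟨G₂, hG₂⟩ := exists_strongSum hDd hW
  have h : StrongSum (fun j => (1 / 2 : ℂ) •
      ((W j).adjoint ∘L D j + (D j).adjoint ∘L W j)) ((1 / 2 : ℂ) • (G₁ + G₂)) := fun x => by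
    refine (((hG₁ x).add (hG₂ x)).const_smul (1 / 2 : ℂ)).congr fun N => ?_
    rw [← Finset.sum_add_distrib, Finset.smul_sum]
    rfl
  refine ⟨_, ⟨D, fun j => -(D j).adjoint, hD, fun j => (hD j).adjoint, ?_⟩, h⟩
  simpa only [neg_neg] using h

theorem inner_half_add_adjoint (B D : 𝓗 →L[ℂ] 𝓗) (x : 𝓗) :
    ⟪x, ((1 / 2 : ℂ) • (B.adjoint ∘L D + D.adjoint ∘L B)) x⟫_ℂ = ((⟪B x, D x⟫_ℂ).re : ℂ) := by
  simp only [smul_apply, add_apply, ContinuousLinearMap.comp_apply, inner_smul_right,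
    inner_add_right, ContinuousLinearMap.adjoint_inner_right]
  rw [← inner_conj_symm (D x) (B x), Complex.add_conj]
  push_cast
  ring

/-- A summand of `G'(X)` is the real part of `W_j^* [X, W_j]` if `X` is self-adjoint. -/
theorem half_jump_eq {X : 𝓗 →L[ℂ] 𝓗} (hX : IsSelfAdjoint X) (B : 𝓗 →L[ℂ] 𝓗) :
    (1 / 2 : ℂ) • (B.adjoint ∘L (X ∘L B - B ∘L X) + (B.adjoint ∘L X - X ∘L B.adjoint) ∘L B) =
      (1 / 2 : ℂ) • (B.adjoint ∘L (X ∘L B - B ∘L X) + (X ∘L B - B ∘L X).adjoint ∘L B) := by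
  rw [map_sub, ContinuousLinearMap.adjoint_comp, ContinuousLinearMap.adjoint_comp,
    ContinuousLinearMap.isSelfAdjoint_iff'.mp hX]

/-- If the partial sums of `⟨W_j φ, [X, W_j] φ⟩ - a ⟨W_j ψ, D_j ψ⟩` are bounded, then so is the
difference of the corresponding quadratic forms of `G'`. -/
theorem norm_inner_gPrime_sub_le {W D : ℕ → 𝓗 →L[ℂ] 𝓗} {X G₁ G₂ : 𝓗 →L[ℂ] 𝓗}
    (hX : IsSelfAdjoint X) (hG₁ : IsGPrime W X G₁)
    (hG₂ : StrongSum (fun j => (1 / 2 : ℂ) •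
      ((W j).adjoint ∘L D j + (D j).adjoint ∘L W j)) G₂) {a e : ℝ} {φ ψ : 𝓗}
    (h : ∀ N, ‖∑ j ∈ Finset.range N,
      (⟪W j φ, X (W j φ) - W j (X φ)⟫_ℂ - (a : ℂ) * ⟪W j ψ, D j ψ⟫_ℂ)‖ ≤ e) :
    ‖⟪φ, G₁ φ⟫_ℂ - (a : ℂ) * ⟪ψ, G₂ ψ⟫_ℂ‖ ≤ e := by
  have h1 := (StrongSum.tendsto_inner hG₁ φ).sub ((hG₂.tendsto_inner ψ).const_mul (a : ℂ))
  refine le_of_tendsto h1.norm (Eventually.of_forall fun N => ?_)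
  have e1 : ∑ j ∈ Finset.range N, ⟪φ, ((1 / 2 : ℂ) • ((W j).adjoint ∘L (X ∘L W j - W j ∘L X)
        + ((W j).adjoint ∘L X - X ∘L (W j).adjoint) ∘L W j)) φ⟫_ℂ -
      (a : ℂ) * ∑ j ∈ Finset.range N, ⟪ψ, ((1 / 2 : ℂ) •
        ((W j).adjoint ∘L D j + (D j).adjoint ∘L W j)) ψ⟫_ℂ =
      (((∑ j ∈ Finset.range N,
        (⟪W j φ, X (W j φ) - W j (X φ)⟫_ℂ - (a : ℂ) * ⟪W j ψ, D j ψ⟫_ℂ)).re : ℝ) : ℂ) := by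
    rw [Finset.mul_sum, ← Finset.sum_sub_distrib, re_sum, ofReal_sum]
    refine Finset.sum_congr rfl fun j _ => ?_
    rw [half_jump_eq hX, inner_half_add_adjoint, inner_half_add_adjoint, sub_re, re_ofReal_mul]
    push_cast
    rfl
  rw [e1, Complex.norm_real, Real.norm_eq_abs]
  exact (abs_re_le_norm _).trans (h N)

theorem inner_gPrime_im {W : ℕ → 𝓗 →L[ℂ] 𝓗} {X G : 𝓗 →L[ℂ] 𝓗} (hX : IsSelfAdjoint X)
    (hG : IsGPrime W X G) (x : 𝓗) : (⟪x, G x⟫_ℂ).im = 0 := by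
  have h1 := (Complex.continuous_im.tendsto _).comp (StrongSum.tendsto_inner hG x)
  refine tendsto_nhds_unique h1 (tendsto_const_nhds.congr fun N => ?_)
  simp only [Function.comp_apply, im_sum]
  refine (Finset.sum_eq_zero fun j _ => ?_).symm
  rw [half_jump_eq hX, inner_half_add_adjoint, ofReal_im]

theorem inner_half_sum_im {W D : ℕ → 𝓗 →L[ℂ] 𝓗} {G : 𝓗 →L[ℂ] 𝓗}
    (hG : StrongSum (fun j => (1 / 2 : ℂ) •
      ((W j).adjoint ∘L D j + (D j).adjoint ∘L W j)) G) (x : 𝓗) : (⟪x, G x⟫_ℂ).im = 0 := by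
  have h1 := (Complex.continuous_im.tendsto _).comp (hG.tendsto_inner x)
  refine tendsto_nhds_unique h1 (tendsto_const_nhds.congr fun N => ?_)
  simp only [Function.comp_apply, im_sum]
  refine (Finset.sum_eq_zero fun j _ => ?_).symm
  rw [inner_half_add_adjoint, ofReal_im]

end Jump

/-! ### Multiple commutators and their norms -/

section Unique

variable {𝓗 : Type*} [NormedAddCommGroup 𝓗] [InnerProductSpace ℂ 𝓗]

theorem extNorm_eq {P : (𝓗 →L[ℂ] 𝓗) → Prop} {C : 𝓗 →L[ℂ] 𝓗} (hC : P C)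
    (huniq : ∀ C', P C' → C' = C) : extNorm P = ‖C‖ₑ :=
  le_antisymm (iInf₂_le C hC) (le_iInf₂ fun C' h => by rw [huniq C' h])

theorem exists_of_extNorm_lt_top {P : (𝓗 →L[ℂ] 𝓗) → Prop} (h : extNorm P < ⊤) : ∃ C, P C := by
  by_contra! hP
  exact h.ne (by simp [extNorm, hP])

theorem eq_of_inner_eq_of_dense {D : Set 𝓗} (hD : Dense D) {B C : 𝓗 →L[ℂ] 𝓗}
    (h : ∀ u ∈ D, ∀ v ∈ D, ⟪u, B v⟫_ℂ = ⟪u, C v⟫_ℂ) : B = C := by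
  refine ContinuousLinearMap.ext fun x => ?_
  refine isClosed_property hD.denseRange_val (p := fun x => B x = C x)
    (isClosed_eq (by fun_prop) (by fun_prop)) (fun v => ?_) x
  exact hD.eq_of_inner_right (𝕜 := ℂ) fun u hu => h u hu v v.2

variable [CompleteSpace 𝓗]

theorem IsBddCommutator.unique {Φ : 𝓗 →ₗ.[ℂ] 𝓗} (hΦ : IsSelfAdjoint Φ) {B C C' : 𝓗 →L[ℂ] 𝓗}
    (h : IsBddCommutator Φ B C) (h' : IsBddCommutator Φ B C') : C = C' :=
  eq_of_inner_eq_of_dense hΦ.dense_domain fun u hu v hv =>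
    (h ⟨u, hu⟩ ⟨v, hv⟩).symm.trans (h' ⟨u, hu⟩ ⟨v, hv⟩)

theorem IsAd.unique {Φ : 𝓗 →ₗ.[ℂ] 𝓗} (hΦ : IsSelfAdjoint Φ) {B : 𝓗 →L[ℂ] 𝓗} (k : ℕ)
    {C C' : 𝓗 →L[ℂ] 𝓗} (h : IsAd Φ B k C) (h' : IsAd Φ B k C') : C = C' := by
  induction k generalizing C C' with
  | zero => exact Eq.trans h (Eq.symm h')
  | succ k ih =>
    obtain ⟨D, hD, hDC⟩ := h
    obtain ⟨D', hD', hDC'⟩ := h'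
    obtain rfl := ih hD hD'
    exact hDC.unique hΦ hDC'

/-- A resolvent of `Φ` maps `D(H)` onto a dense subspace. If it preserves `D(H)`, a form on
`D(Φ) ∩ D(H)` therefore determines at most one bounded operator. -/
theorem IsResolvent.denseRange {H Φ : 𝓗 →ₗ.[ℂ] 𝓗} (hH : IsSelfAdjoint H) (hΦ : IsSelfAdjoint Φ)
    {z : ℂ} {J : 𝓗 →L[ℂ] 𝓗} (hJ : IsResolvent Φ z J) : DenseRange fun x : H.domain => J x := by
  have h1 : DenseRange J := hΦ.dense_domain.mono fun u hu => ⟨_, hJ.left ⟨u, hu⟩⟩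
  exact h1.comp hH.dense_domain.denseRange_val J.continuous

theorem IsCommutator.unique {H Φ : 𝓗 →ₗ.[ℂ] 𝓗} (hH : IsSelfAdjoint H) (hΦ : IsSelfAdjoint Φ)
    {z : ℂ} {J : 𝓗 →L[ℂ] 𝓗} (hJ : IsResolvent Φ z J) (hmem : ∀ x : H.domain, J x ∈ H.domain)
    {C C' : 𝓗 →L[ℂ] 𝓗} (h : IsCommutator Φ H C) (h' : IsCommutator Φ H C') : C = C' := by
  have hdom : ∀ x, J x ∈ Φ.domain := fun x => by
    obtain ⟨u, hu, -⟩ := hJ.right x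
    exact hu ▸ u.2
  refine eq_of_inner_eq_of_dense (hJ.denseRange hH hΦ) ?_
  rintro _ ⟨x, rfl⟩ _ ⟨y, rfl⟩
  exact (h _ _ (hdom x) (hmem x) (hdom y) (hmem y)).symm.trans
    (h' _ _ (hdom x) (hmem x) (hdom y) (hmem y))

theorem IsAdUnbdd.unique {H Φ : 𝓗 →ₗ.[ℂ] 𝓗} (hH : IsSelfAdjoint H) (hΦ : IsSelfAdjoint Φ)
    {z : ℂ} {J : 𝓗 →L[ℂ] 𝓗} (hJ : IsResolvent Φ z J) (hmem : ∀ x : H.domain, J x ∈ H.domain)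
    (k : ℕ) {C C' : 𝓗 →L[ℂ] 𝓗} (h : IsAdUnbdd Φ H (k + 1) C) (h' : IsAdUnbdd Φ H (k + 1) C') :
    C = C' := by
  induction k generalizing C C' with
  | zero => exact IsCommutator.unique hH hΦ hJ hmem h h'
  | succ k ih =>
    obtain ⟨D, hD, hDC⟩ := h
    obtain ⟨D', hD', hDC'⟩ := h'
    obtain rfl := ih hD hD'
    exact hDC.unique hΦ hDC'

theorem IsCommutator.inner_re_eq_zero {H Φ : 𝓗 →ₗ.[ℂ] 𝓗} (hH : IsSelfAdjoint H)
    (hΦ : IsSelfAdjoint Φ) {z : ℂ} {J : 𝓗 →L[ℂ] 𝓗} (hJ : IsResolvent Φ z J)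
    (hmem : ∀ x : H.domain, J x ∈ H.domain) {C : 𝓗 →L[ℂ] 𝓗} (h : IsCommutator Φ H C) (φ : 𝓗) :
    (⟪φ, C φ⟫_ℂ).re = 0 := by
  refine isClosed_property (hJ.denseRange hH hΦ) (p := fun φ => (⟪φ, C φ⟫_ℂ).re = 0)
    (isClosed_eq (by fun_prop) (by fun_prop)) (fun x => ?_) φ
  have hdom : J x ∈ Φ.domain := by
    obtain ⟨u, hu, -⟩ := hJ.right x
    exact hu ▸ u.2
  rw [← h _ _ hdom (hmem x) hdom (hmem x), ← inner_conj_symm (H _) (Φ _), sub_re, conj_re,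
    sub_self]

theorem IsDomainCommutator.inner_re_eq_zero {H : 𝓗 →ₗ.[ℂ] 𝓗} (hH : IsSelfAdjoint H)
    {X K : 𝓗 →L[ℂ] 𝓗} (hX : IsSelfAdjoint X) (h : IsDomainCommutator H X K) (φ : 𝓗) :
    (⟪φ, K φ⟫_ℂ).re = 0 := by
  refine isClosed_property hH.dense_domain.denseRange_val (p := fun φ => (⟪φ, K φ⟫_ℂ).re = 0)
    (isClosed_eq (by fun_prop) (by fun_prop)) (fun x => ?_) φ
  have h1 : ⟪(x : 𝓗), X (H x)⟫_ℂ = ⟪X x, H x⟫_ℂ := (hX.isSymmetric _ _).symm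
  rw [← h.isBddCommutator hH x x, h1, ← inner_conj_symm (X x) (H x), sub_re, conj_re, sub_self]

end Unique

section Assumptions

variable {𝓗 : Type*} [NormedAddCommGroup 𝓗] [InnerProductSpace ℂ 𝓗]
  {n : ℕ} {H Φ : 𝓗 →ₗ.[ℂ] 𝓗} {W : ℕ → 𝓗 →L[ℂ] 𝓗} {S : 𝓗 →L[ℂ] 𝓗}

theorem IsAd.isBddCommutator {B C : 𝓗 →L[ℂ] 𝓗} (h : IsAd Φ B 1 C) : IsBddCommutator Φ B C := by
  obtain ⟨B', hB', hC⟩ := h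
  have : B' = B := hB'
  rwa [this] at hC

theorem extNorm_isAdUnbdd_sq_le (k : ℕ) : 1 + extNorm (IsAdUnbdd Φ H k) ^ 2 ≤ M H Φ W S k := by
  unfold M
  rw [add_assoc (1 + extNorm (IsAdUnbdd Φ H k) ^ 2)]
  exact le_self_add

theorem enorm_le_M (k : ℕ) : ‖S‖ₑ ≤ M H Φ W S k :=
  le_add_self.trans le_self_add

theorem tsum_extNorm_le_M (k : ℕ) : ∑' j, extNorm (IsAd Φ (W j) k) ^ 2 ≤ M H Φ W S k :=
  le_add_self

theorem norm_le_toReal_M {k : ℕ} (hk : M H Φ W S k < ⊤) : ‖S‖ ≤ (M H Φ W S k).toReal := by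
  have h1 := ENNReal.toReal_mono hk.ne (enorm_le_M (H := H) (Φ := Φ) (W := W) (S := S) k)
  rwa [toReal_enorm] at h1

variable [CompleteSpace 𝓗]

/-- By the theorem of Hellinger and Toeplitz, the inverse of `Φ + c`, being symmetric and everywhere
defined, is bounded. -/
theorem Assumptions.exists_isResolvent (h : Assumptions n H Φ W S) :
    ∃ (z : ℝ) (J : 𝓗 →L[ℂ] 𝓗), IsResolvent Φ z J ∧ ∀ x : H.domain, J x ∈ H.domain := by
  obtain ⟨c, -, hbij, hpres⟩ := h.preserves_domain
  have hΦ := h.selfAdjoint_Φ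
  let e : Φ.domain ≃ₗ[ℂ] 𝓗 :=
    LinearEquiv.ofBijective (Φ.toFun + (c : ℂ) • Φ.domain.subtype) hbij
  have he : ∀ u, e u = Φ u + (c : ℂ) • (u : 𝓗) := fun u => rfl
  let J₀ : 𝓗 →ₗ[ℂ] 𝓗 := Φ.domain.subtype ∘ₗ e.symm.toLinearMap
  have hJ₀ : ∀ x, J₀ x = e.symm x := fun x => rfl
  have hsymm : J₀.IsSymmetric := fun x y => by
    obtain ⟨u, rfl⟩ := e.surjective x
    obtain ⟨v, rfl⟩ := e.surjective y
    rw [hJ₀, hJ₀, e.symm_apply_apply, e.symm_apply_apply, he, he, inner_add_left, inner_add_right,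
      inner_smul_left, inner_smul_right, inner_symm hΦ, conj_ofReal]
  have hsub : ∀ u : Φ.domain, Φ u - ((-c : ℝ) : ℂ) • (u : 𝓗) = e u := fun u => by
    rw [he, ofReal_neg, neg_smul, sub_neg_eq_add]
  refine ⟨-c, ⟨J₀, hsymm.continuous⟩, ⟨fun u => ?_, fun x => ⟨e.symm x, rfl, ?_⟩⟩, fun x => ?_⟩
  · rw [hsub]
    change J₀ (e u) = u
    rw [hJ₀, e.symm_apply_apply]
  · rw [hsub, e.apply_symm_apply]
  · refine hpres (e.symm x) ?_
    rw [← he, e.apply_symm_apply]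
    exact x.2

/-- Finiteness of `M_1, …, M_{n+1}` provides the multiple commutators of `H`. Since `‖C‖ ≤ 1 + ‖C‖²`,
they are bounded by `M_k` itself. -/
theorem Assumptions.exists_isAdUnbdd (h : Assumptions n H Φ W S) : ∃ C : ℕ → 𝓗 →L[ℂ] 𝓗,
    (∀ C', IsCommutator Φ H C' → C' = C 0) ∧ (∀ k ≤ n, IsAdUnbdd Φ H (k + 1) (C k)) ∧
      ∀ k ≤ n, ‖C k‖ ≤ (M H Φ W S (k + 1)).toReal := by
  obtain ⟨z, J, hJ, hmem⟩ := h.exists_isResolvent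
  have hH := h.selfAdjoint_H
  have hΦ := h.selfAdjoint_Φ
  have hex : ∀ k, ∃ C, k ≤ n → IsAdUnbdd Φ H (k + 1) C := fun k => by
    by_cases hk : k ≤ n
    · have h1 := (extNorm_isAdUnbdd_sq_le (k + 1)).trans_lt (h.finite_M (k + 1) (by omega) (by omega))
      have h2 : extNorm (IsAdUnbdd Φ H (k + 1)) < ⊤ := by
        by_contra h3
        rw [not_lt, top_le_iff] at h3
        simp [h3] at h1
      obtain ⟨C, hC⟩ := exists_of_extNorm_lt_top h2
      exact ⟨C, fun _ => hC⟩
    · exact ⟨0, fun h => absurd h hk⟩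
  choose C hC using hex
  refine ⟨C, fun C' hC' => IsCommutator.unique hH hΦ hJ hmem hC' (hC 0 (Nat.zero_le n)), hC,
    fun k hk => ?_⟩
  have hfin := h.finite_M (k + 1) (by omega) (by omega)
  have h1 := extNorm_isAdUnbdd_sq_le (H := H) (Φ := Φ) (W := W) (S := S) (k + 1)
  rw [extNorm_eq (hC k hk) fun C' hC' => IsAdUnbdd.unique hH hΦ hJ hmem k hC' (hC k hk)] at h1
  have h2 : ‖C k‖ₑ ≤ 1 + ‖C k‖ₑ ^ 2 := by
    rcases le_total ‖C k‖ₑ 1 with h3 | h3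
    · exact h3.trans le_self_add
    · refine le_trans ?_ le_add_self
      rw [sq]
      exact le_mul_of_one_le_left' h3
  have h3 := ENNReal.toReal_mono hfin.ne (h2.trans h1)
  rwa [toReal_enorm] at h3

theorem Assumptions.exists_isAd (h : Assumptions n H Φ W S) : ∃ C : ℕ → ℕ → 𝓗 →L[ℂ] 𝓗,
    (∀ k ≤ n, ∀ j, IsAd Φ (W j) (k + 1) (C k j)) ∧
      ∀ k ≤ n, ∀ N, ∑ j ∈ Finset.range N, ‖C k j‖ ^ 2 ≤ (M H Φ W S (k + 1)).toReal := by
  have hΦ := h.selfAdjoint_Φ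
  have hex : ∀ k j, ∃ C, k ≤ n → IsAd Φ (W j) (k + 1) C := fun k j => by
    by_cases hk : k ≤ n
    · have h1 := (tsum_extNorm_le_M (k + 1)).trans_lt (h.finite_M (k + 1) (by omega) (by omega))
      have h2 := (ENNReal.le_tsum j).trans_lt h1
      have h3 : extNorm (IsAd Φ (W j) (k + 1)) < ⊤ := by
        by_contra h4
        rw [not_lt, top_le_iff] at h4
        simp [h4] at h2
      obtain ⟨C, hC⟩ := exists_of_extNorm_lt_top h3
      exact ⟨C, fun _ => hC⟩
    · exact ⟨0, fun h => absurd h hk⟩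
  choose C hC using hex
  refine ⟨C, fun k hk j => hC k j hk, fun k hk N => ?_⟩
  have hfin := h.finite_M (k + 1) (by omega) (by omega)
  have h1 : ∑ j ∈ Finset.range N, ‖C k j‖ₑ ^ 2 ≤ M H Φ W S (k + 1) := by
    refine le_trans (le_trans (Finset.sum_le_sum fun j _ => ?_)
      (ENNReal.sum_le_tsum (Finset.range N))) (tsum_extNorm_le_M (k + 1))
    rw [extNorm_eq (hC k j hk) fun C' hC' => IsAd.unique hΦ _ hC' (hC k j hk)]
  have h2 := ENNReal.toReal_mono hfin.ne h1
  rw [ENNReal.toReal_sum fun j _ => by simp] at h2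
  simpa only [ENNReal.toReal_pow, toReal_enorm] using h2

theorem Assumptions.toReal_M_le_toReal_mu (h : Assumptions n H Φ W S) (hn : 1 ≤ n) :
    (M H Φ W S (n + 1)).toReal ≤ (mu H Φ W S n).toReal := by
  refine ENNReal.toReal_mono (ne_of_lt ?_) (Finset.le_sup (Finset.mem_Icc.mpr ⟨by omega, le_rfl⟩))
  rw [mu, Finset.sup_lt_iff (by simp)]
  intro k hk
  rw [Finset.mem_Icc] at hk
  exact h.finite_M k (by omega) hk.2

end Assumptions

/-! ### The error functions -/

section ErrorFunctions

/-- A smooth plateau function may be supported in any prescribed neighbourhood of the support. -/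
theorem exists_isPlateau {f : ℝ → ℝ} (hf : HasCompactSupport f) {U : Set ℝ} (hU : IsOpen U)
    (hfU : tsupport f ⊆ U) :
    ∃ g : ℝ → ℝ, IsTest g ∧ (∀ x, 0 ≤ g x) ∧ tsupport g ⊆ U ∧ IsPlateau g f := by
  obtain ⟨L, hL, hfL, hLU⟩ := exists_compact_between hf.isCompact hU hfU
  obtain ⟨g, hg1, hg0, hg⟩ := exists_contMDiffMap_one_nhds_of_subset_interior (n := (⊤ : ℕ∞))
    (modelWithCornersSelf ℝ ℝ) (isClosed_tsupport f) hfL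
  have hsupp : tsupport g ⊆ L :=
    closure_minimal (fun x hx => by_contra fun h => hx (hg0 x h)) hL.isClosed
  refine ⟨g, ⟨g.contMDiff.contDiff, HasCompactSupport.of_support_subset_isCompact hL
    (subset_closure.trans hsupp)⟩, fun x => (hg x).1, hsupp.trans hLU, fun x hx => ?_⟩
  exact (eventually_nhdsSet_iff_forall.mp hg1) x hx

/-- The cutoff function with derivative `a g²`. -/
noncomputable def sqPrimitive (a : ℝ) (g : ℝ → ℝ) (x : ℝ) : ℝ := ∫ y in (0 : ℝ)..x, a * (g y * g y)

theorem deriv_sqPrimitive {g : ℝ → ℝ} (hg : Continuous g) (a : ℝ) :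
    deriv (sqPrimitive a g) = fun x => a * (g x * g x) := by
  funext x
  exact Continuous.deriv_integral _ (by fun_prop) 0 x

theorem sqPrimitive_mem_cutoffs {δ a : ℝ} (ha : 0 ≤ a) {g : ℝ → ℝ} (hg : IsTest g)
    (hg0 : ∀ x, 0 ≤ g x) (hgδ : tsupport g ⊆ Set.Ioo 0 (δ / 2)) :
    sqPrimitive a g ∈ cutoffs δ := by
  have hgc := hg.continuous
  have hgs : ContDiff ℝ ∞ g := hg.1
  have hd := deriv_sqPrimitive hgc a
  refine ⟨?_, ?_, ?_, fun x => ?_, ?_⟩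
  · rw [contDiff_infty_iff_deriv]
    refine ⟨fun x => ?_, ?_⟩
    · exact (intervalIntegral.integral_hasDerivAt_right
        (Continuous.intervalIntegrable (by fun_prop) _ _)
        (Continuous.stronglyMeasurableAtFilter (by fun_prop) _ _)
        (Continuous.continuousAt (by fun_prop))).differentiableAt
    · rw [hd]
      fun_prop
  · refine closure_minimal (fun x hx => ?_) isClosed_Ici
    by_contra h
    rw [Set.mem_Ici, not_le] at h
    refine hx ?_
    rw [sqPrimitive, intervalIntegral.integral_congr (g := fun _ => (0 : ℝ))]
    · simp
    · intro y hy
      rw [Set.uIcc_of_ge h.le] at hy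
      have : g y = 0 := image_eq_zero_of_notMem_tsupport fun h' => absurd (hgδ h').1 (not_lt.mpr hy.2)
      simp [this]
  · rw [hd]
    refine subset_trans (closure_mono fun x hx => ?_) hgδ
    intro h
    exact hx (by simp [h])
  · rw [hd]
    exact mul_nonneg ha (mul_self_nonneg _)
  · have : (fun x => √(deriv (sqPrimitive a g) x)) = fun x => √a * g x := by
      funext x
      rw [hd, Real.sqrt_mul ha, Real.sqrt_mul_self (hg0 x)]
    rw [this]
    fun_prop

theorem exists_cutoffData {δ : ℝ} {χ : ℝ → ℝ} (hχ : χ ∈ cutoffs δ) : ∃ g : ℝ → ℝ,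
    CutoffData χ (fun x => √(deriv χ x)) g ∧ (∀ x, 0 ≤ g x) ∧ tsupport g ⊆ Set.Ioo 0 (δ / 2) := by
  have hd := isTest_deriv hχ
  obtain ⟨g, hg, hg0, hgδ, hgp⟩ := exists_isPlateau hd.2 isOpen_Ioo hχ.2.2.1
  refine ⟨g, ⟨hχ.1, hd, ⟨hχ.2.2.2.2, ?_⟩, hg, fun x => Real.mul_self_sqrt (hχ.2.2.2.1 x), hgp⟩,
    hg0, hgδ⟩
  exact hd.2.mono fun x hx h => hx (by simp [h])

/-- The quadratic form of the error bound, if every `ξ^k` has derivative `w_{k-2} g²`. The sum over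
`2 ≤ k ≤ n` is shifted to `k < p`, where `n = p + 1`. -/
theorem IsApproximation.inner_errorBound {𝓗 : Type*} [NormedAddCommGroup 𝓗]
    [InnerProductSpace ℂ 𝓗] [CompleteSpace 𝓗] {H Φ : 𝓗 →ₗ.[ℂ] 𝓗} {v t s : ℝ}
    {A T : ℕ → 𝓗 →L[ℂ] 𝓗} (h : IsApproximation H Φ v t s A T) {g : ℝ → ℝ} (hg : IsTest g)
    (W : ℕ → 𝓗 →L[ℂ] 𝓗) (S : 𝓗 →L[ℂ] 𝓗) (w : ℕ → ℝ) (p : ℕ) (b : ℝ) (φ : 𝓗) :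
    ⟪φ, errorBound (p + 1) H Φ W S (fun k => sqPrimitive (w (k - 2)) g) b v t s φ⟫_ℂ =
      ((∑ k ∈ Finset.range p, (M H Φ W S (k + 2)).toReal / s ^ (k + 2) *
        (w k * ‖fts Φ g v t s φ‖ ^ 2) + b / s ^ (p + 2) * ‖φ‖ ^ 2 : ℝ) : ℂ) := by
  rw [errorBound, add_apply, inner_add_right, sum_apply, inner_sum]
  have e1 : Finset.Icc 2 (p + 1) = Finset.Ico 2 (p + 2) := by ext; simp; omega
  rw [e1, Finset.sum_Ico_eq_sum_range, ofReal_add, ofReal_sum]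
  congr 1
  · refine Finset.sum_congr rfl fun k _ => ?_
    rw [smul_apply, inner_smul_right, deriv_sqPrimitive hg.continuous,
      h.inner_fts_const_mul_sq hg, ← ofReal_mul, add_comm 2 k, Nat.add_sub_cancel]
  · rw [smul_apply, inner_smul_right, ContinuousLinearMap.id_apply, inner_self_eq_norm_sq_to_K]
    push_cast
    rfl

theorem jumpWeight_nonneg (χ u : ℝ → ℝ) (k : ℕ) : 0 ≤ jumpWeight χ u k :=
  mul_nonneg (by positivity) (add_nonneg (supNorm_nonneg _)
    (mul_nonneg (supNorm_nonneg _) (supNorm_nonneg _)))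

theorem jumpConst_nonneg (χ u g : ℝ → ℝ) (p : ℕ) : 0 ≤ jumpConst χ u g p :=
  mul_nonneg (by positivity) (add_nonneg (add_nonneg (symConst_nonneg _ _ _ _)
    (mul_nonneg (locConst_nonneg _ _ _) (supNorm_nonneg _)))
    (mul_nonneg (incrConst_nonneg _ _ _) (supNorm_nonneg _)))

end ErrorFunctions

/-! ### The two operator inequalities -/

section Inequalities

variable {𝓗 : Type*} [NormedAddCommGroup 𝓗] [InnerProductSpace ℂ 𝓗] [CompleteSpace 𝓗]
  {p : ℕ} {H Φ : 𝓗 →ₗ.[ℂ] 𝓗} {W : ℕ → 𝓗 →L[ℂ] 𝓗} {S : 𝓗 →L[ℂ] 𝓗}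

theorem IsApproximation.inner_remainder {v t s : ℝ} {A T : ℕ → 𝓗 →L[ℂ] 𝓗}
    (happ : IsApproximation H Φ v t s A T) {χ : ℝ → ℝ} (hu : IsTest fun x => √(deriv χ x))
    (B D : 𝓗 →L[ℂ] 𝓗) (φ : 𝓗) : ⟪φ, remainder Φ χ v t s B D φ⟫_ℂ =
      ⟪φ, B φ⟫_ℂ - ((s⁻¹ : ℝ) : ℂ) * ⟪sqrtDeriv Φ χ v t s φ, D (sqrtDeriv Φ χ v t s φ)⟫_ℂ := by
  have h1 : IsSelfAdjoint (sqrtDeriv Φ χ v t s) :=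
    happ.isSelfAdjoint_fts hu.continuous hu.exists_abs_le
  rw [remainder, sub_apply, inner_sub_right, smul_apply, inner_smul_right]
  congr 2
  exact (h1.isSymmetric φ _).symm

theorem Assumptions.exists_isApproximation {n : ℕ} (h : Assumptions n H Φ W S) (v t s : ℝ) :
    ∃ A T : ℕ → 𝓗 →L[ℂ] 𝓗, IsApproximation H Φ v t s A T := by
  obtain ⟨z, J, hJ, hmem⟩ := h.exists_isResolvent
  obtain ⟨m, hm⟩ := h.bddBelow_Φ
  exact LightCone.exists_isApproximation h.selfAdjoint_H h.selfAdjoint_Φ hm hJ hmem v t s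

/-- The expansion of `[H, χ_ts]`. The remainder is self-adjoint, so that it is bounded from above and
below once the modulus of its quadratic form is bounded. -/
theorem Assumptions.exists_commutator_le (h : Assumptions (p + 1) H Φ W S) {δ : ℝ}
    {χ g : ℝ → ℝ} (hχ : χ ∈ cutoffs δ) (hg : CutoffData χ (fun x => √(deriv χ x)) g) (v t : ℝ)
    {s : ℝ} (hs : 0 < s) : ∃ K P : 𝓗 →L[ℂ] 𝓗,
      IsDomainCommutator H (fts Φ χ v t s) K ∧ IsCommutator H Φ P ∧
      remainder Φ χ v t s (I • K) (I • P) ≤ errorBound (p + 1) H Φ W S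
        (fun k => sqPrimitive (supNorm (symCoeff χ (fun x => √(deriv χ x)) (k - 2))) g)
        ((symConst χ (fun x => √(deriv χ x)) g p + 1) * (M H Φ W S (p + 1 + 1)).toReal) v t s ∧
      -remainder Φ χ v t s (I • K) (I • P) ≤ errorBound (p + 1) H Φ W S
        (fun k => sqPrimitive (supNorm (symCoeff χ (fun x => √(deriv χ x)) (k - 2))) g)
        ((symConst χ (fun x => √(deriv χ x)) g p + 1) * (M H Φ W S (p + 1 + 1)).toReal) v t s := by
  obtain ⟨A, T, happ⟩ := h.exists_isApproximation v t s
  obtain ⟨z, J, hJ, hmem⟩ := h.exists_isResolvent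
  obtain ⟨C, huniq, hC, hCn⟩ := h.exists_isAdUnbdd
  have hC0 : IsCommutator Φ H (C 0) := hC 0 (Nat.zero_le _)
  have hH := h.selfAdjoint_H
  have hΦ := h.selfAdjoint_Φ
  obtain ⟨K, hK, hKle⟩ := happ.exists_commutator_estimate hH hs hχ hg p huniq hC
    (ν := fun k => (M H Φ W S (k + 2)).toReal) fun k hk => hCn (k + 1) (by omega)
  refine ⟨K, -C 0, hK, fun a b aH aΦ bH bΦ => ?_, ?_⟩
  · rw [neg_apply, inner_neg_right, ← hC0 a b aΦ aH bΦ bH, neg_sub]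
  have hrem : ∀ φ, ⟪φ, remainder Φ χ v t s (I • K) (I • -C 0) φ⟫_ℂ =
      I * (⟪φ, K φ⟫_ℂ + ((s⁻¹ : ℝ) : ℂ) *
        ⟪sqrtDeriv Φ χ v t s φ, C 0 (sqrtDeriv Φ χ v t s φ)⟫_ℂ) := fun φ => by
    rw [happ.inner_remainder hg.u_test]
    simp only [smul_apply, neg_apply, inner_smul_right, inner_neg_right]
    ring
  refine le_and_neg_le_of_norm_inner_le _ (fun φ => ?_)
    (happ.inner_errorBound hg.g_test W S
      (fun k => supNorm (symCoeff χ (fun x => √(deriv χ x)) k)) p _) fun φ => ?_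
  · have hX := happ.isSelfAdjoint_fts hg.smooth.continuous (abs_cutoff_le hχ)
    rw [hrem, I_mul_im, add_re, re_ofReal_mul, hK.inner_re_eq_zero hH hX,
      hC0.inner_re_eq_zero hH hΦ hJ hmem, mul_zero, add_zero]
  · rw [hrem, norm_mul, norm_I, one_mul]
    refine (hKle φ).trans (add_le_add_right (mul_le_mul_of_nonneg_right ?_ (sq_nonneg _)) _)
    rw [mul_div_assoc]
    refine mul_le_mul_of_nonneg_right (by linarith) ?_
    positivity

/-- The expansion of `G'(χ_ts)`. The bound for finitely many jump operators is uniform in their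
number, and passes to the series. -/
theorem Assumptions.exists_gPrime_le (h : Assumptions (p + 1) H Φ W S) {δ : ℝ}
    {χ g : ℝ → ℝ} (hχ : χ ∈ cutoffs δ) (hg : CutoffData χ (fun x => √(deriv χ x)) g) (v t : ℝ)
    {s : ℝ} (hs : 0 < s) : ∃ G₁ G₂ : 𝓗 →L[ℂ] 𝓗,
      IsGPrime W (fts Φ χ v t s) G₁ ∧ IsGPrimeUnbdd W Φ G₂ ∧
      remainder Φ χ v t s G₁ G₂ ≤ errorBound (p + 1) H Φ W S
        (fun k => sqPrimitive (jumpWeight χ (fun x => √(deriv χ x)) (k - 2)) g)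
        ((jumpConst χ (fun x => √(deriv χ x)) g p + 1) * (mu H Φ W S (p + 1)).toReal) v t s ∧
      -remainder Φ χ v t s G₁ G₂ ≤ errorBound (p + 1) H Φ W S
        (fun k => sqPrimitive (jumpWeight χ (fun x => √(deriv χ x)) (k - 2)) g)
        ((jumpConst χ (fun x => √(deriv χ x)) g p + 1) * (mu H Φ W S (p + 1)).toReal) v t s := by
  obtain ⟨A, T, happ⟩ := h.exists_isApproximation v t s
  obtain ⟨C, hC, hCn⟩ := h.exists_isAd
  have hS := h.strongSum_W
  have hX := happ.isSelfAdjoint_fts hg.smooth.continuous (abs_cutoff_le hχ)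
  have hD : ∀ j, IsBddCommutator Φ (W j) (C 0 j) := fun j =>
    IsAd.isBddCommutator (hC 0 (Nat.zero_le _) j)
  obtain ⟨G₁, hG₁⟩ := exists_isGPrime hS (fts Φ χ v t s)
  obtain ⟨G₂, hG₂, hG₂'⟩ := exists_isGPrimeUnbdd (sum_norm_sq_le_of_strongSum hS) hD
    (d := (M H Φ W S (0 + 1)).toReal) fun N x => by
      refine le_trans ?_ (mul_le_mul_of_nonneg_right (hCn 0 (Nat.zero_le _) N) (sq_nonneg _))
      rw [Finset.sum_mul]
      refine Finset.sum_le_sum fun j _ => ?_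
      rw [← mul_pow]
      gcongr
      exact (C 0 j).le_opNorm x
  refine ⟨G₁, G₂, hG₁, hG₂, ?_⟩
  refine le_and_neg_le_of_norm_inner_le _ (fun φ => ?_)
    (happ.inner_errorBound hg.g_test W S (jumpWeight χ fun x => √(deriv χ x)) p _) fun φ => ?_
  · rw [happ.inner_remainder hg.u_test, sub_im, im_ofReal_mul, inner_gPrime_im hX hG₁,
      inner_half_sum_im hG₂', mul_zero, sub_zero]
  · rw [happ.inner_remainder hg.u_test]
    have h1 := norm_inner_gPrime_sub_le hX hG₁ hG₂' fun N =>
      happ.norm_sum_inner_commutator_sub_le hs hχ hg hS p hD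
        (C := fun k => C (k + 1)) (fun k hk j => hC (k + 1) (by omega) j)
        (μ := fun k => (M H Φ W S (k + 2)).toReal)
        (fun k hk => norm_le_toReal_M (h.finite_M (k + 2) (by omega) (by omega)))
        (fun k hk N => hCn (k + 1) (by omega) N) N φ
    refine h1.trans (add_le_add_right (mul_le_mul_of_nonneg_right ?_ (sq_nonneg _)) _)
    have h2 := h.toReal_M_le_toReal_mu (by omega)
    have h3 := jumpConst_nonneg χ (fun x => √(deriv χ x)) g p
    rw [← mul_div_assoc]
    refine div_le_div_of_nonneg_right ?_ (by positivity)
    exact mul_le_mul (by linarith) h2 ENNReal.toReal_nonneg (by linarith)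

end Inequalities

end LightCone

theorem mainTheorem4 (δ : ℝ) (hδ : 0 < δ) (χ : ℝ → ℝ) (hχ : χ ∈ LightCone.cutoffs δ) :
    (∃ ξ : ℕ → ℝ → ℝ, (∀ k, ξ k ∈ LightCone.cutoffs δ) ∧
      ∀ n : ℕ, 1 ≤ n → ∃ C : ℝ, 0 < C ∧
        ∀ (𝓗 : Type u) [NormedAddCommGroup 𝓗] [InnerProductSpace ℂ 𝓗] [CompleteSpace 𝓗]
          (H Φ : 𝓗 →ₗ.[ℂ] 𝓗) (W : ℕ → 𝓗 →L[ℂ] 𝓗) (S : 𝓗 →L[ℂ] 𝓗),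
          LightCone.Assumptions n H Φ W S → ∀ v t s : ℝ, 0 < s →
            ∃ K P : 𝓗 →L[ℂ] 𝓗,
              LightCone.IsDomainCommutator H (LightCone.fts Φ χ v t s) K ∧
              LightCone.IsCommutator H Φ P ∧
              LightCone.remainder Φ χ v t s (Complex.I • K) (Complex.I • P) ≤
                LightCone.errorBound n H Φ W S ξ
                  (C * (LightCone.M H Φ W S (n + 1)).toReal) v t s ∧
              -LightCone.remainder Φ χ v t s (Complex.I • K) (Complex.I • P) ≤
                LightCone.errorBound n H Φ W S ξ
                  (C * (LightCone.M H Φ W S (n + 1)).toReal) v t s) ∧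
    (∃ ξ : ℕ → ℝ → ℝ, (∀ k, ξ k ∈ LightCone.cutoffs δ) ∧
      ∀ n : ℕ, 1 ≤ n → ∃ C : ℝ, 0 < C ∧
        ∀ (𝓗 : Type u) [NormedAddCommGroup 𝓗] [InnerProductSpace ℂ 𝓗] [CompleteSpace 𝓗]
          (H Φ : 𝓗 →ₗ.[ℂ] 𝓗) (W : ℕ → 𝓗 →L[ℂ] 𝓗) (S : 𝓗 →L[ℂ] 𝓗),
          LightCone.Assumptions n H Φ W S → ∀ v t s : ℝ, 0 < s →
            ∃ G₁ G₂ : 𝓗 →L[ℂ] 𝓗,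
              LightCone.IsGPrime W (LightCone.fts Φ χ v t s) G₁ ∧
              LightCone.IsGPrimeUnbdd W Φ G₂ ∧
              LightCone.remainder Φ χ v t s G₁ G₂ ≤
                LightCone.errorBound n H Φ W S ξ
                  (C * (LightCone.mu H Φ W S n).toReal) v t s ∧
              -LightCone.remainder Φ χ v t s G₁ G₂ ≤
                LightCone.errorBound n H Φ W S ξ
                  (C * (LightCone.mu H Φ W S n).toReal) v t s) := by
  obtain ⟨g, hg, hg0, hgδ⟩ := LightCone.exists_cutoffData hχ
  refine ⟨⟨fun k => LightCone.sqPrimitive (LightCone.supNorm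
      (LightCone.symCoeff χ (fun x => √(deriv χ x)) (k - 2))) g,
      fun k => LightCone.sqPrimitive_mem_cutoffs (LightCone.supNorm_nonneg _) hg.g_test
      hg0 hgδ, fun n hn => ?_⟩,
    ⟨fun k => LightCone.sqPrimitive
      (LightCone.jumpWeight χ (fun x => √(deriv χ x)) (k - 2)) g,
      fun k => LightCone.sqPrimitive_mem_cutoffs (LightCone.jumpWeight_nonneg _ _ _) hg.g_test
      hg0 hgδ, fun n hn => ?_⟩⟩
  · obtain ⟨p, rfl⟩ := Nat.exists_eq_add_of_le' hn
    -- `1` is added to the constant, which is only known to be nonnegative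
    exact ⟨_, add_pos_of_nonneg_of_pos (LightCone.symConst_nonneg χ _ g p) one_pos,
      fun 𝓗 _ _ _ H Φ W S h v t s hs => h.exists_commutator_le hχ hg v t hs⟩
  · obtain ⟨p, rfl⟩ := Nat.exists_eq_add_of_le' hn
    exact ⟨_, add_pos_of_nonneg_of_pos (LightCone.jumpConst_nonneg χ _ g p) one_pos,
      fun 𝓗 _ _ _ H Φ W S h v t s hs => h.exists_gPrime_le hχ hg v t hs⟩
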